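/- Let $N\ge 2$ be an even integer, $\kappa_N=(-1)^{1+N/2}$, and let $p(t;x)$ be the elementary solution of $\partial u/\partial t=\kappa_N\,\partial^N u/\partial x^N$, i.e. $\int_{\mathbb R} e^{i\mu x}p(t;x)\,dx=e^{\kappa_N t(-i\mu)^N}$. Let $X$ be the associated pseudo-process started at $X(0)=0$: for $n,k\in\mathbb N$ and a bounded Borel function $F:\mathbb R^k\to\mathbb C$, $$\mathbb E\big[F(X(1/2^n),\dots,X(k/2^n))\big]=\int_{\mathbb R^k}F(x_1,\dots,x_k)\prod_{j=1}^k p(1/2^n;x_{j-1}-x_j)\,dx_1\cdots dx_k,\qquad x_0=0 .$$ The expectation of a series of such functionals is the sum of the series of expectations when that series converges absolutely, and the expectation of a limit in $n$ is the limit of the expectations. Put $X_n(t)=X(\lfloor 2^nt\rfloor/2^n)$, $T_n(t)=\int_0^t \mathbf 1_{[0,\infty)}(X_n(u))\,du$ and $E(\lambda,\mu,\nu)=\lim_{n\to\infty}\mathbb E\big[\int_0^\infty e^{-\lambda t+i\mu X_n(t)-\nu T_n(t)}dt\big]$, where the integral over $t$ is the series of the integrals over $[k/2^n,(k+1)/2^n]$,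 $k\ge 0$. With $T(t)=\int_0^t\mathbf 1_{[0,\infty)}(X(u))\,du$, a joint (pseudo-)density $\mathbb P\{T(t)\in ds,X(t)\in dx\}/(ds\,dx)$ is a real function $f(t;s,x)$ on $\Omega=\{(t,s,x):0<s<t,\ x\in\mathbb R\}$ such that $e^{-\lambda t}f$ is integrable on $\Omega$ for all $\lambda>0$ and $$\int_0^\infty e^{-\lambda t}\int_0^t\int_{\mathbb R}e^{i\mu x-\nu s}f(t;s,x)\,dx\,ds\,dt=E(\lambda,\mu,\nu)\qquad(\lambda,\nu>0,\ \mu\in\mathbb R)$$ (in particular, all the expectations and the limit that define $E(\lambda,\mu,\nu)$ exist). Let $\theta_1,\dots,\theta_N$ be the $N$-th roots of $\kappa_N$, $J=\{i:\Re\theta_i>0\}$, $K=\{i:\Re\theta_i<0\}$, $A_j=\prod_{i\in J\setminus\{j\}}\frac{\theta_i}{\theta_i-\theta_j}$ for $j\in J$, $B_k=\prod_{i\in K\setminus\{k\}}\frac{\theta_i}{\theta_i-\theta_k}$ for $k\in K$, $\beta_m=\sum_{k\in K}B_k\theta_k^m$ for $m\in\mathbb Z$, $E_{a,b}(z)=\sum_{r\ge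 0}\frac{z^r}{\Gamma(ar+b)}$, and $$\mathcal J_m(z)=e^{-i\frac{\#J-m-1}{N}\pi}\sum_{j\in J}A_j\theta_j^{m+1}e^{-\theta_je^{i\pi/N}z}-e^{i\frac{\#J-m-1}{N}\pi}\sum_{j\in J}A_j\theta_j^{m+1}e^{-\theta_je^{-i\pi/N}z}.$$ Theorem. A joint density of $(T(t),X(t))$ exists; it is unique up to a Lebesgue-null subset of $\Omega$ and has a version $f$ that is continuous on $\Omega$. For all $t>s>0$ and $x\ge 0$, all the integrals below converge absolutely, and $$f(t;s,x)=\frac{Ni}{2\pi}\sum_{m=0}^{\#J}\beta_{-m}\,(t-s)^{\frac{m-\#J}{N}}\int_0^\infty \xi^{m+\#K}e^{-s\xi^N}\mathcal J_m(x\xi)\,E_{1,\frac{m+\#K}{N}}\big(-(t-s)\xi^N\big)\,d\xi .$$ -/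

import Mathlib

open MeasureTheory Filter Topology

noncomputable section

namespace PseudoProcess

/-! ### The heat-type kernel and pseudo-expectations -/

/-- The sign `κ_N = (-1)^(1 + N/2)`, for even `N`. -/
def kappa (N : ℕ) : ℝ := (-1) ^ (1 + N / 2)

/-- The elementary solution `p(t; x)` of `∂u/∂t = κ_N ∂^N u/∂x^N`, that is, the function whose
Fourier transform `∫ e^{iμx} p(t; x) dx` is `exp (κ_N t (-iμ)^N)`, written by Fourier inversion. -/
def heatKernel (N : ℕ) (t x : ℝ) : ℝ :=
  1 / (2 * Real.pi) *
    (∫ μ : ℝ, Complex.exp (-Complex.I * μ * x) *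
      Complex.exp (kappa N * t * (-Complex.I * μ) ^ N)).re

/-- The discrete trajectory started at `0` and observed at `x_1, …, x_k`
(and continued by `0`, which is never used). -/
def trajectory {k : ℕ} (x : Fin k → ℝ) (j : ℕ) : ℝ :=
  if h : 1 ≤ j ∧ j ≤ k then x ⟨j - 1, by omega⟩ else 0

/-- A functional `F` of discrete trajectories is tame with `k` observations when it is evaluated
on the first `k` observations only, as a bounded Borel function of them. -/
def IsTame (k : ℕ) (F : (ℕ → ℝ) → ℂ) : Prop :=
  Measurable (fun x : Fin k → ℝ => F (trajectory x)) ∧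
    ∃ C : ℝ, ∀ x : Fin k → ℝ, ‖F (trajectory x)‖ ≤ C

/-- Pseudo-expectation of a tame functional of the `k` observations `X(1/2^n), …, X(k/2^n)`,
with `X(0) = 0`. -/
def tameExpectation (N n k : ℕ) (F : (ℕ → ℝ) → ℂ) : ℂ :=
  ∫ x : Fin k → ℝ, F (trajectory x) *
    ∏ j ∈ Finset.range k,
      (heatKernel N (1 / 2 ^ n) (trajectory x j - trajectory x (j + 1)) : ℂ)

/-- `∑_k F n k`, `n ∈ ℕ`, are functions of the discrete observations (series of tame functionals
with absolutely convergent series of pseudo-expectations), and their pseudo-expectations converge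
to `e` as `n → ∞`: the admissible functional they define has pseudo-expectation `e`. -/
def HasPseudoExpectation (N : ℕ) (F : ℕ → ℕ → (ℕ → ℝ) → ℂ) (e : ℂ) : Prop :=
  (∀ n k, IsTame k (F n k)) ∧
  (∀ n, Summable fun k => ‖tameExpectation N n k (F n k)‖) ∧
  Tendsto (fun n => ∑' k, tameExpectation N n k (F n k)) atTop (𝓝 e)

/-! ### The step process, its sojourn time, and the joint density -/

/-- `X_n(t)`: the step process equal to the `k`-th observation on `[k/2^n, (k+1)/2^n)`. -/
def stepProcess (n : ℕ) (y : ℕ → ℝ) (t : ℝ) : ℝ := y ⌊2 ^ n * t⌋₊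

/-- `T_n(t)`: time spent by `X_n` in `[0, ∞)` up to time `t`. -/
def sojournTime (n : ℕ) (y : ℕ → ℝ) (t : ℝ) : ℝ :=
  ∫ s in (0 : ℝ)..t, (Set.Ici (0 : ℝ)).indicator (fun _ => (1 : ℝ)) (stepProcess n y s)

/-- The `k`-th term of the decomposition of `∫_0^∞ exp (-λ t + i μ X_n(t) - ν T_n(t)) dt` into a
series of tame functionals: the integral over `[k/2^n, (k+1)/2^n]`. -/
def transformTerm (lam μ ν : ℝ) (n k : ℕ) (y : ℕ → ℝ) : ℂ :=
  ∫ t in ((k : ℝ) / 2 ^ n)..(((k : ℝ) + 1) / 2 ^ n),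
    Complex.exp (-lam * t + Complex.I * μ * stepProcess n y t - ν * sojournTime n y t)

/-- The set of all `(t, s, x)` with `0 < s < t`. -/
def region : Set (ℝ × ℝ × ℝ) := {q | 0 < q.2.1 ∧ q.2.1 < q.1}

/-- `f t s x` is a density, in `(s, x)`, of the pseudo-distribution of `(T(t), X(t))`, `t > 0`:
its Laplace-Fourier transform
`∫_0^∞ e^{-λt} (∫_ℝ ∫_0^t e^{iμx - νs} f(t, s, x) ds dx) dt`
is the pseudo-expectation of `∫_0^∞ exp (-λ t + i μ X(t) - ν T(t)) dt`. -/
structure IsJointDensity (N : ℕ) (f : ℝ → ℝ → ℝ → ℝ) : Prop where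
  integrable : ∀ lam : ℝ, 0 < lam →
    IntegrableOn (fun q : ℝ × ℝ × ℝ => Real.exp (-lam * q.1) * f q.1 q.2.1 q.2.2) region
  transform : ∀ lam μ ν : ℝ, 0 < lam → 0 < ν →
    HasPseudoExpectation N (transformTerm lam μ ν)
      (∫ q in region,
        Complex.exp (-lam * q.1 + Complex.I * μ * q.2.2 - ν * q.2.1) * (f q.1 q.2.1 q.2.2 : ℂ))

/-! ### The algebraic quantities and special functions of the formula -/

/-- The `N`-th roots `θ_j`, `j ∈ J`, of `κ_N` with positive real part. -/
def rootsJ (N : ℕ) : Finset ℂ :=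
  (Polynomial.nthRootsFinset N (kappa N : ℂ)).filter fun z => 0 < z.re

/-- The `N`-th roots `θ_k`, `k ∈ K`, of `κ_N` with negative real part. -/
def rootsK (N : ℕ) : Finset ℂ :=
  (Polynomial.nthRootsFinset N (kappa N : ℂ)).filter fun z => z.re < 0

/-- `∏_{η ∈ S \ {θ}} η / (η - θ)`. It is `A_j` for `S = rootsJ N`, `θ = θ_j` and `B_k` for
`S = rootsK N`, `θ = θ_k`. -/
def coeff (S : Finset ℂ) (θ : ℂ) : ℂ := ∏ η ∈ S.erase θ, η / (η - θ)

/-- `β_m = ∑_{k ∈ K} B_k θ_k^m`, `m ∈ ℤ`. -/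
def beta (N : ℕ) (m : ℤ) : ℂ := ∑ θ ∈ rootsK N, coeff (rootsK N) θ * θ ^ m

/-- The Mittag-Leffler function `E_{a,b}(z) = ∑_r z^r / Γ(a r + b)`. -/
def mittagLeffler (a b : ℝ) (z : ℂ) : ℂ := ∑' r : ℕ, z ^ r / (Real.Gamma (a * r + b) : ℂ)

/-- The function `𝒥_m`. -/
def calJ (N m : ℕ) (z : ℂ) : ℂ :=
  Complex.exp (-Complex.I * ((((rootsJ N).card : ℂ) - m - 1) / N) * Real.pi) *
      ∑ θ ∈ rootsJ N, coeff (rootsJ N) θ * θ ^ (m + 1) *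
        Complex.exp (-θ * Complex.exp (Complex.I * (Real.pi / N)) * z) -
    Complex.exp (Complex.I * ((((rootsJ N).card : ℂ) - m - 1) / N) * Real.pi) *
      ∑ θ ∈ rootsJ N, coeff (rootsJ N) θ * θ ^ (m + 1) *
        Complex.exp (-θ * Complex.exp (-Complex.I * (Real.pi / N)) * z)

/-- The integrand `ξ^{m+#K} e^{-sξ^N} 𝒥_m(xξ) E_{1,(m+#K)/N}(-(t-s)ξ^N)`. -/
def integrand (N m : ℕ) (t s x ξ : ℝ) : ℂ :=
  (ξ : ℂ) ^ (m + (rootsK N).card) * Complex.exp (-s * ξ ^ N) * calJ N m (x * ξ) *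
    mittagLeffler 1 (((m : ℝ) + (rootsK N).card) / N) (-(t - s) * ξ ^ N)

end PseudoProcess

end

namespace PseudoProcess

/-! ### The roots of `κ_N` -/

/-! Put `M = #J = #K = N/2` and, for `λ, ν > 0`, let `a, b > 0` be given by `b^N = λ` and `a^N = λ +
ν`. By the choice of `κ_N` the symbol of `p(t; ·)` is `exp (-t μ^N)`, and `a^N + μ^N` is the product
of the factors `a - iμθ` over all roots `θ`. The inverse of such a factor is the Fourier transform
of an exponential carried by the positive half-line if `θ ∈ J`, by the negative one if `θ ∈ K`. This
is a Wiener–Hopf factorisation; the transform `E` is computed from it, inverted, and the inverse is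
made explicit.

The transform. With mesh `h = 2^{-n}`, `z = e^{-λh}` and `w = e^{-νh}`, the functional lives on a
random walk with signed steps, weighted by `w` at each visit to `[0, ∞)`. Spitzer's identity
(`fourierInt_indicator_chainDensity`) gives the two half-line parts of its generating function as
exponentials of series in `(1 - w^k) z^k / k` times the transform of `p(kh; ·)` restricted to a
half-line. It holds because a sum of transforms carried by complementary half-lines determines both
summands (`eq_of_isFourierOn_add_eq`), and it also yields the absolute convergence. As `h → 0` the
exponents are Riemann sums, and `E = (exp L₋ - exp (-L₊)) / ν`
(`hasPseudoExpectation_transformTerm`), where `L₊` and `L₋` are integrals over `p ∈ [λ, λ + ν]` of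
the Laplace transform in time of a half-line part. That Laplace transform is a sum of partial
fractions (`laplaceHalfHeat_eq`), hence a logarithmic derivative, and `exp_logLimit_sub` obtains `E
= ∏_J (a - iμθ)⁻¹ ∏_K (b - iμθ)⁻¹`.

The inverse. The function `u = wave` has Laplace transform `∏_J (a + ζθ)⁻¹` in `(s, y)`
(`wave_transform`): integrating out `y` and `s` leaves integrals along the rays `θ e^{±iπ/N}`, which
for `ξ = e^x` are the two edges of a strip. A residue (`integral_strip_boundary`) and partial
fractions over `θ` give the product. Since `K = -J`, `E` is the product of such transforms at `ζ =
-iμ` and `ζ = iμ`, so a density is `∫ u(s; y) u(t - s; y - x) dy` with both factors cut off to the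
quadrant (`density_transform`). The decay of `u` makes it continuous, and it is unique because
damped exponentials separate points (`ae_eq_of_isJointDensity`).

The formula. For `x ≥ 0` shift `y` by `x` and insert the integral that defines `u(s; x + y)`. The
`y`-integral becomes the Laplace transform of `u(t - s; ·)` at `ωξ`, `ω` a ray direction. In the
time variable this has transform `∏_J (a + ωξθ)⁻¹ = ∏_J (a - ωξθ) / (a^N + ξ^N)`. Expanding the
numerator with the `β_{-m}` (`sum_beta_pow`) and recognising each quotient as the transform of a
Mittag-Leffler term gives `laplace_wave`; the powers `ω^m` turn `𝒥_0` into `𝒥_m` (`density_eq_sum`).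
-/

theorem kappa_sq (N : ℕ) : (kappa N) ^ 2 = 1 := by
  unfold kappa; rw [← pow_mul, mul_comm, pow_mul]; simp

theorem kappa_ne_zero (N : ℕ) : (kappa N : ℂ) ≠ 0 := by
  unfold kappa; push_cast; exact pow_ne_zero _ (by norm_num)

theorem I_pow_even {N : ℕ} (hN : Even N) : Complex.I ^ N = -(kappa N : ℂ) := by
  obtain ⟨M, rfl⟩ := hN
  have h : (M + M) / 2 = M := by omega
  rw [kappa, h, ← two_mul, pow_mul, Complex.I_sq]; push_cast; ring

/-- The purpose of the sign `κ_N`: it makes the symbol of the equation `exp (-t μ^N)`, which decays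
because `N` is even. -/
theorem kappa_mul_neg_I_mul_pow {N : ℕ} (hN : Even N) (z : ℂ) :
    (kappa N : ℂ) * (-Complex.I * z) ^ N = -z ^ N := by
  have h : (kappa N : ℂ) * kappa N = 1 := by
    have := kappa_sq N
    rw [← Complex.ofReal_mul, ← sq, this, Complex.ofReal_one]
  rw [mul_pow, neg_pow, hN.neg_one_pow, I_pow_even hN]
  linear_combination (-z ^ N) * h

theorem mem_nthRoots_kappa {N : ℕ} (h2 : 2 ≤ N) {z : ℂ} :
    z ∈ Polynomial.nthRootsFinset N (kappa N : ℂ) ↔ z ^ N = kappa N :=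
  Polynomial.mem_nthRootsFinset (by omega) _

theorem mem_rootsJ {N : ℕ} (h2 : 2 ≤ N) {z : ℂ} :
    z ∈ rootsJ N ↔ z ^ N = kappa N ∧ 0 < z.re := by
  rw [rootsJ, Finset.mem_filter, mem_nthRoots_kappa h2]

theorem mem_rootsK {N : ℕ} (h2 : 2 ≤ N) {z : ℂ} :
    z ∈ rootsK N ↔ z ^ N = kappa N ∧ z.re < 0 := by
  rw [rootsK, Finset.mem_filter, mem_nthRoots_kappa h2]

theorem norm_of_pow_eq_kappa {N : ℕ} (h2 : 2 ≤ N) {z : ℂ} (hz : z ^ N = kappa N) : ‖z‖ = 1 := by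
  have h : ‖z‖ ^ N = 1 := by
    rw [← norm_pow, hz, kappa]; simp
  exact (pow_eq_one_iff_of_nonneg (norm_nonneg _) (by omega)).1 h

/-- On the imaginary axis `z ^ N` is `-κ_N` times a nonnegative real, so it never equals `κ_N`.
Hence `J` and `K` exhaust the roots. -/
theorem re_ne_zero_of_pow_eq_kappa {N : ℕ} (hN : Even N) {z : ℂ}
    (hz : z ^ N = kappa N) : z.re ≠ 0 := by
  intro h0
  have hz' : z = Complex.I * (z.im : ℂ) := by
    apply Complex.ext <;> simp [h0]
  rw [hz', mul_pow, I_pow_even hN] at hz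
  have h1 : ((z.im ^ N : ℝ) : ℂ) = ((-1 : ℝ) : ℂ) := by
    push_cast
    have := kappa_ne_zero N
    apply mul_left_cancel₀ this
    linear_combination -hz
  have h2 := Complex.ofReal_injective h1
  have := hN.pow_nonneg z.im
  linarith

theorem conj_eq_inv_of_norm_one {z : ℂ} (h : ‖z‖ = 1) : (starRingEnd ℂ) z = z⁻¹ := by
  rw [Complex.inv_def, Complex.normSq_eq_norm_sq, h]; simp

/-- The roots lie on the unit circle, where inversion is conjugation, and conjugation fixes `κ_N`
and the real part. -/
theorem inv_mem_rootsJ {N : ℕ} (h2 : 2 ≤ N) {z : ℂ} (hz : z ∈ rootsJ N) : z⁻¹ ∈ rootsJ N := by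
  rw [mem_rootsJ h2] at *
  have hn := norm_of_pow_eq_kappa h2 hz.1
  rw [← conj_eq_inv_of_norm_one hn, ← map_pow, hz.1]
  simpa using hz.2

theorem conj_mem_rootsJ {N : ℕ} (h2 : 2 ≤ N) {z : ℂ} (hz : z ∈ rootsJ N) :
    (starRingEnd ℂ) z ∈ rootsJ N := by
  rw [conj_eq_inv_of_norm_one (norm_of_pow_eq_kappa h2 ((mem_rootsJ h2).1 hz).1)]
  exact inv_mem_rootsJ h2 hz

theorem inv_mem_rootsK {N : ℕ} (h2 : 2 ≤ N) {z : ℂ} (hz : z ∈ rootsK N) : z⁻¹ ∈ rootsK N := by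
  rw [mem_rootsK h2] at *
  have hn := norm_of_pow_eq_kappa h2 hz.1
  rw [← conj_eq_inv_of_norm_one hn, ← map_pow, hz.1]
  simpa using hz.2

theorem neg_mem_rootsK {N : ℕ} (hN : Even N) (h2 : 2 ≤ N) {z : ℂ} :
    -z ∈ rootsK N ↔ z ∈ rootsJ N := by
  rw [mem_rootsJ h2, mem_rootsK h2, hN.neg_pow]; simp

theorem rootsK_eq_image {N : ℕ} (hN : Even N) (h2 : 2 ≤ N) :
    rootsK N = (rootsJ N).map (Equiv.neg ℂ).toEmbedding := by
  ext z
  simp only [Finset.mem_map, Equiv.coe_toEmbedding, Equiv.neg_apply]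
  constructor
  · intro h; exact ⟨-z, (neg_mem_rootsK hN h2).1 (by simpa using h), by simp⟩
  · rintro ⟨w, hw, rfl⟩; exact (neg_mem_rootsK hN h2).2 hw

theorem prod_rootsK {N : ℕ} (hN : Even N) (h2 : 2 ≤ N) {β : Type*} [CommMonoid β] (g : ℂ → β) :
    ∏ θ ∈ rootsK N, g θ = ∏ θ ∈ rootsJ N, g (-θ) := by
  rw [rootsK_eq_image hN h2, Finset.prod_map]; rfl

theorem card_rootsK {N : ℕ} (hN : Even N) (h2 : 2 ≤ N) : (rootsK N).card = (rootsJ N).card := by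
  rw [rootsK_eq_image hN h2, Finset.card_map]

theorem prod_inv_rootsJ {N : ℕ} (h2 : 2 ≤ N) (g : ℂ → ℂ) :
    ∏ θ ∈ rootsJ N, g θ⁻¹ = ∏ θ ∈ rootsJ N, g θ :=
  Finset.prod_nbij' (·⁻¹) (·⁻¹) (fun _ h => inv_mem_rootsJ h2 h) (fun _ h => inv_mem_rootsJ h2 h)
    (by simp) (by simp) (by simp)

theorem prod_inv_rootsK {N : ℕ} (h2 : 2 ≤ N) {β : Type*} [CommMonoid β] (g : ℂ → β) :
    ∏ θ ∈ rootsK N, g θ⁻¹ = ∏ θ ∈ rootsK N, g θ :=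
  Finset.prod_nbij' (·⁻¹) (·⁻¹) (fun _ h => inv_mem_rootsK h2 h) (fun _ h => inv_mem_rootsK h2 h)
    (by simp) (by simp) (by simp)

theorem rootsJ_union_rootsK {N : ℕ} (hN : Even N) (h2 : 2 ≤ N) :
    rootsJ N ∪ rootsK N = Polynomial.nthRootsFinset N (kappa N : ℂ) := by
  ext z
  rw [Finset.mem_union, mem_rootsJ h2, mem_rootsK h2, mem_nthRoots_kappa h2, ← and_or_left]
  refine ⟨fun h => h.1, fun h => ⟨h, ?_⟩⟩
  rcases lt_trichotomy z.re 0 with h' | h' | h'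
  · exact Or.inr h'
  · exact absurd h' (re_ne_zero_of_pow_eq_kappa hN h)
  · exact Or.inl h'

theorem disjoint_rootsJ_rootsK (N : ℕ) : Disjoint (rootsJ N) (rootsK N) := by
  rw [Finset.disjoint_left]
  intro z h1 h2
  have h1 := (Finset.mem_filter.1 h1).2
  have h2 := (Finset.mem_filter.1 h2).2
  linarith

theorem nthRoots_kappa_separable {N : ℕ} (h2 : 2 ≤ N) :
    (Polynomial.X ^ N - Polynomial.C (kappa N : ℂ)).Separable :=
  Polynomial.separable_X_pow_sub_C _ (by exact_mod_cast (by omega : N ≠ 0)) (kappa_ne_zero N)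

theorem nthRoots_kappa_eq_val {N : ℕ} (h2 : 2 ≤ N) :
    (Polynomial.nthRootsFinset N (kappa N : ℂ)).val = Polynomial.nthRoots N (kappa N : ℂ) := by
  classical
  rw [Polynomial.nthRootsFinset_def, Multiset.toFinset_val, Multiset.dedup_eq_self]
  exact Polynomial.nodup_roots (nthRoots_kappa_separable h2)

theorem prod_X_sub_nthRoots {N : ℕ} (h2 : 2 ≤ N) :
    ∏ θ ∈ Polynomial.nthRootsFinset N (kappa N : ℂ), (Polynomial.X - Polynomial.C θ) =
      Polynomial.X ^ N - Polynomial.C (kappa N : ℂ) := by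
  have hs := IsAlgClosed.splits (Polynomial.X ^ N - Polynomial.C (kappa N : ℂ))
  have := hs.eq_prod_roots_of_monic (Polynomial.monic_X_pow_sub_C _ (by omega))
  rw [this, Finset.prod_eq_multiset_prod, nthRoots_kappa_eq_val h2]
  rfl

theorem two_mul_card_rootsJ {N : ℕ} (hN : Even N) (h2 : 2 ≤ N) : 2 * (rootsJ N).card = N := by
  have h := congrArg Polynomial.natDegree (prod_X_sub_nthRoots h2)
  rw [Polynomial.natDegree_X_pow_sub_C, Polynomial.natDegree_prod_of_monic _ _
    (fun θ _ => Polynomial.monic_X_sub_C θ)] at h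
  simp only [Polynomial.natDegree_X_sub_C, Finset.sum_const, smul_eq_mul, mul_one] at h
  rw [← rootsJ_union_rootsK hN h2, Finset.card_union_of_disjoint (disjoint_rootsJ_rootsK N),
    card_rootsK hN h2] at h
  omega

theorem card_rootsJ_pos {N : ℕ} (hN : Even N) (h2 : 2 ≤ N) : 0 < (rootsJ N).card := by
  have := two_mul_card_rootsJ hN h2; omega

/-- Homogeneous form of the factorisation of `X^N - κ_N`. With `y = iμ` it is the Wiener–Hopf
factorisation, with `y = ωξ` it turns inverse factors over `J` into a polynomial over `a^N + ξ^N`.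
-/
theorem prod_sub_mul_roots {N : ℕ} (hN : Even N) (h2 : 2 ≤ N) (x y : ℂ) :
    (∏ θ ∈ rootsJ N, (x - y * θ)) * ∏ θ ∈ rootsK N, (x - y * θ) = x ^ N - kappa N * y ^ N := by
  rw [← Finset.prod_union (disjoint_rootsJ_rootsK N), rootsJ_union_rootsK hN h2]
  have hcard : (Polynomial.nthRootsFinset N (kappa N : ℂ)).card = N := by
    rw [← rootsJ_union_rootsK hN h2, Finset.card_union_of_disjoint (disjoint_rootsJ_rootsK N),
      card_rootsK hN h2]
    have := two_mul_card_rootsJ hN h2; omega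
  rcases eq_or_ne y 0 with rfl | hy
  · simp [hcard, zero_pow (show N ≠ 0 by omega)]
  · have h := congrArg (Polynomial.eval (x / y)) (prod_X_sub_nthRoots h2)
    rw [Polynomial.eval_prod] at h
    simp only [Polynomial.eval_sub, Polynomial.eval_X, Polynomial.eval_C, Polynomial.eval_pow] at h
    have h3 : ∀ θ ∈ Polynomial.nthRootsFinset N (kappa N : ℂ), x - y * θ = y * (x / y - θ) := by
      intro θ _; field_simp
    rw [Finset.prod_congr rfl h3, Finset.prod_mul_distrib, h, Finset.prod_const, hcard, div_pow]
    field_simp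

/-- The roots in the right half-plane stay in it when they are turned by at most `π / N`. -/
theorem re_rootsJ_mul_exp {N : ℕ} (hN : Even N) (h2 : 2 ≤ N) {θ : ℂ} (hθ : θ ∈ rootsJ N) {φ : ℝ}
    (hφ : |φ| ≤ Real.pi / N) : 0 ≤ (θ * Complex.exp (φ * Complex.I)).re := by
  obtain ⟨h1, hre⟩ := (mem_rootsJ h2).1 hθ
  have hn := norm_of_pow_eq_kappa h2 h1
  obtain ⟨M, hM⟩ := hN
  have hN0 : (0 : ℝ) < N := by exact_mod_cast (by omega : 0 < N)
  have hNM : (N : ℝ) = 2 * M := by rw [hM]; push_cast; ring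
  set α := θ.arg with hα
  have hθe : θ = Complex.exp (α * Complex.I) := by
    have := Complex.norm_mul_exp_arg_mul_I θ
    rw [hn] at this; simpa using this.symm
  have hαb : |α| < Real.pi / 2 := by
    rw [hα, Complex.abs_arg_lt_pi_div_two_iff]; exact Or.inl hre
  have hk : (kappa N : ℂ) = Complex.exp (((M : ℂ) + 1) * (Real.pi * Complex.I)) := by
    have : ((M : ℂ) + 1) = ((M + 1 : ℕ) : ℂ) := by push_cast; ring
    rw [this, Complex.exp_nat_mul, Complex.exp_pi_mul_I, kappa]
    have : N / 2 = M := by omega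
    rw [this]; push_cast; ring
  rw [hθe, ← Complex.exp_nat_mul, hk, Complex.exp_eq_exp_iff_exists_int] at h1
  obtain ⟨n, hn'⟩ := h1
  have hre' : (N : ℝ) * α = (M + 1) * Real.pi + n * (2 * Real.pi) := by
    have := congrArg Complex.im hn'
    simpa using this
  have hpi := Real.pi_pos
  rw [abs_lt] at hαb
  have hu : (N : ℝ) * α < M * Real.pi := by
    rw [hNM]; nlinarith
  have hl : -(M * Real.pi) < (N : ℝ) * α := by
    rw [hNM]; nlinarith
  rw [hre'] at hu hl
  have hu1 : ((M : ℝ) + 1 + 2 * n) < M := by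
    by_contra hc; push Not at hc; nlinarith
  have hl1 : (0 : ℝ) < (2 * M + 1 + 2 * n) := by
    by_contra hc; push Not at hc; nlinarith
  -- Integrality gives the room for the rotation: `N α / π` is the integer `M + 1 + 2n`, strictly
  -- between `-M` and `M`, hence at distance at least one from both ends, and one unit is the angle
  -- `π / N`.
  have hu2 : (1 : ℝ) + 2 * n ≤ -1 := by
    have : (1 : ℝ) + 2 * n < 0 := by linarith
    have h3 : (1 : ℤ) + 2 * n < 0 := by exact_mod_cast this
    have h4 : (1 : ℤ) + 2 * n ≤ -1 := by omega
    exact_mod_cast h4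
  have hl2 : (1 : ℝ) ≤ (2 * M + 1 + 2 * n) := by
    have h3 : (0 : ℤ) < (2 * M + 1 + 2 * n) := by exact_mod_cast hl1
    have h4 : (1 : ℤ) ≤ (2 * M + 1 + 2 * n) := by omega
    exact_mod_cast h4
  have hφ' : |(N : ℝ) * φ| ≤ Real.pi := by
    rw [abs_mul, abs_of_pos hN0]
    calc (N : ℝ) * |φ| ≤ N * (Real.pi / N) := by gcongr
      _ = Real.pi := by field_simp
  rw [abs_le] at hφ'
  rw [hθe, ← Complex.exp_add, ← add_mul, ← Complex.ofReal_add, Complex.exp_ofReal_mul_I_re]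
  apply Real.cos_nonneg_of_neg_pi_div_two_le_of_le
  · have : -(Real.pi * M) ≤ N * (α + φ) := by rw [mul_add, hre']; nlinarith
    rw [hNM] at this
    have hM0 : (0 : ℝ) < M := by linarith
    by_contra hc; push Not at hc; nlinarith
  · have : N * (α + φ) ≤ Real.pi * M := by rw [mul_add, hre']; nlinarith
    rw [hNM] at this
    have hM0 : (0 : ℝ) < M := by linarith
    by_contra hc; push Not at hc; nlinarith

/-! ### Partial fractions -/

/-- Lagrange interpolation of the constant `1` at the nodes `-θa`, evaluated at `ζ`: dividing by the
product of all `θa + ζ` turns it into a partial fraction expansion. It adds up the residues found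
for the single `θ`. -/
theorem sum_coeff_mul_div {S : Finset ℂ} (hS : S.Nonempty) {a ζ : ℂ} (ha : a ≠ 0)
    (h0 : ∀ θ ∈ S, θ * a + ζ ≠ 0) :
    ∑ θ ∈ S, coeff S θ * θ / (θ * a + ζ) = a ^ (S.card - 1) * ∏ θ ∈ S, (θ / (θ * a + ζ)) := by
  have hinj : Set.InjOn (fun θ : ℂ => -(θ * a)) S := by
    intro x _ y _ h; simpa [ha] using h
  have h := congrArg (Polynomial.eval ζ) (Lagrange.sum_basis hinj hS)
  rw [Polynomial.eval_finsetSum, Polynomial.eval_one] at h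
  rw [← mul_one (a ^ (S.card - 1) * _), ← h, Finset.mul_sum]
  refine Finset.sum_congr rfl fun θ hθ => ?_
  rw [Lagrange.basis, Polynomial.eval_prod, ← Finset.mul_prod_erase S _ hθ,
    ← Finset.card_erase_of_mem hθ, ← Finset.prod_const]
  rw [mul_comm (θ / _), ← mul_assoc, mul_right_comm, ← Finset.prod_mul_distrib,
    ← Finset.prod_mul_distrib, coeff, mul_div_assoc]
  congr 1
  refine Finset.prod_congr rfl fun η hη => ?_
  have hη' := Finset.mem_erase.1 hη
  have h1 := h0 η hη'.2
  have h3 : η - θ ≠ 0 := sub_ne_zero.2 hη'.1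
  have h4 : -(θ * a) - -(η * a) ≠ 0 := by
    have : -(θ * a) - -(η * a) = (η - θ) * a := by ring
    rw [this]; exact mul_ne_zero h3 ha
  simp only [Lagrange.basisDivisor, Polynomial.eval_mul, Polynomial.eval_C, Polynomial.eval_sub,
    Polynomial.eval_X]
  have h5 : -(θ * a) - -(η * a) = (η - θ) * a := by ring
  rw [h5]
  field_simp
  ring

/-- Dividing `θa + ζ` by `θ` replaces `θ` by `θ⁻¹`, which is harmless in a product over `J`. -/
theorem sum_rootsJ_coeff_mul_div {N : ℕ} (hN : Even N) (h2 : 2 ≤ N) {a ζ : ℂ} (ha : a ≠ 0)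
    (h0 : ∀ θ ∈ rootsJ N, θ * a + ζ ≠ 0) :
    ∑ θ ∈ rootsJ N, coeff (rootsJ N) θ * θ / (θ * a + ζ) =
      a ^ ((rootsJ N).card - 1) * ∏ θ ∈ rootsJ N, (a + ζ * θ)⁻¹ := by
  rw [sum_coeff_mul_div (Finset.card_pos.1 (card_rootsJ_pos hN h2)) ha h0]
  congr 1
  rw [← prod_inv_rootsJ h2 fun θ => (a + ζ * θ)⁻¹]
  refine Finset.prod_congr rfl fun θ hθ => ?_
  have hθ0 : θ ≠ 0 := by
    rintro rfl; have := ((mem_rootsJ h2).1 hθ).2; simp at this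
  have h1 := h0 θ hθ
  have h3 : a + ζ * θ⁻¹ = (θ * a + ζ) / θ := by field_simp
  rw [h3, inv_div]

/-- Interpolation of `1` again, now at the nodes `θ` themselves and as an identity of polynomials:
the partial fractions of `1 / ∏_K (1 - X/η)` with denominators cleared. -/
theorem prod_erase_rootsK_partial (N : ℕ) (h2 : 2 ≤ N) (hN : Even N) :
    ∑ θ ∈ rootsK N, Polynomial.C (coeff (rootsK N) θ) *
      ∏ η ∈ (rootsK N).erase θ, (1 - Polynomial.C η⁻¹ * Polynomial.X) = 1 := by
  have hne : (rootsK N).Nonempty := by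
    rw [← Finset.card_pos, card_rootsK hN h2]; exact card_rootsJ_pos hN h2
  refine Eq.trans ?_ (Lagrange.sum_basis (v := id) (Function.injective_id.injOn) hne)
  refine Finset.sum_congr rfl fun θ hθ => ?_
  rw [coeff, map_prod, ← Finset.prod_mul_distrib, Lagrange.basis]
  refine Finset.prod_congr rfl fun η hη => ?_
  have hη' := Finset.mem_erase.1 hη
  have hη0 : η ≠ 0 := by
    rintro rfl; have := ((mem_rootsK h2).1 hη'.2).2; simp at this
  have h3 : η - θ ≠ 0 := sub_ne_zero.2 hη'.1
  have h4 : θ - η ≠ 0 := sub_ne_zero.2 hη'.1.symm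
  apply Polynomial.funext
  intro x
  simp only [Lagrange.basisDivisor, Polynomial.eval_mul, Polynomial.eval_C, Polynomial.eval_sub,
    Polynomial.eval_X, Polynomial.eval_one, id]
  field_simp
  ring

/-- By partial fractions and the geometric series, the `β_{-m}` are the Taylor coefficients of `1 /
∏_K (1 - zθ)`. Since the products over `J` and `K` multiply to `1 - κ_N z^N`, this series agrees
below degree `N` with the polynomial `∏_J (1 - zθ)`, whose degree is at most `#J < N`. -/
theorem sum_beta_pow {N : ℕ} (hN : Even N) (h2 : 2 ≤ N) (z : ℂ) :
    ∑ m ∈ Finset.range ((rootsJ N).card + 1), beta N (-(m : ℤ)) * z ^ m =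
      ∏ θ ∈ rootsJ N, (1 - z * θ) := by
  set Q : Polynomial ℂ := ∏ θ ∈ rootsJ N, (1 - Polynomial.X * Polynomial.C θ) with hQ
  set R : Polynomial ℂ := ∏ θ ∈ rootsK N, (1 - Polynomial.X * Polynomial.C θ) with hR
  set B : PowerSeries ℂ := PowerSeries.mk fun m => beta N (-(m : ℤ)) with hB
  have hQR : Q * R = 1 - Polynomial.C (kappa N : ℂ) * Polynomial.X ^ N := by
    apply Polynomial.funext
    intro x
    simp only [hQ, hR, Polynomial.eval_mul, Polynomial.eval_prod, Polynomial.eval_sub,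
      Polynomial.eval_one, Polynomial.eval_X, Polynomial.eval_C, Polynomial.eval_pow]
    rw [prod_sub_mul_roots hN h2, one_pow]
  have hgeo : ∀ θ : ℂ, (PowerSeries.mk fun m => θ ^ (-(m : ℤ))) *
      ((1 - Polynomial.C θ⁻¹ * Polynomial.X : Polynomial ℂ) : PowerSeries ℂ) = 1 := by
    intro θ
    have := PowerSeries.mk_one_mul_one_sub_eq_one ℂ
    have h3 := congrArg (PowerSeries.rescale θ⁻¹) this
    rw [map_mul, map_sub, map_one, PowerSeries.rescale_X, PowerSeries.rescale_mk] at h3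
    rw [← h3]
    congr 1
    · ext m; simp
    · simp
  have hBR : B * (R : PowerSeries ℂ) = 1 := by
    have hR' : R = ∏ θ ∈ rootsK N, (1 - Polynomial.C θ⁻¹ * Polynomial.X) := by
      rw [hR, ← prod_inv_rootsK h2]
      refine Finset.prod_congr rfl fun θ _ => by ring
    have hB' : B = ∑ θ ∈ rootsK N, PowerSeries.C (coeff (rootsK N) θ) *
        PowerSeries.mk fun m => θ ^ (-(m : ℤ)) := by
      ext m; simp [hB, beta]
    have := congrArg (Polynomial.coeToPowerSeries.ringHom (R := ℂ))
      (prod_erase_rootsK_partial N h2 hN)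
    rw [map_sum, map_one] at this
    refine Eq.trans ?_ this
    rw [hB', Finset.sum_mul]
    refine Finset.sum_congr rfl fun θ hθ => ?_
    rw [hR', ← Finset.mul_prod_erase _ _ hθ]
    simp only [Polynomial.coeToPowerSeries.ringHom_apply, Polynomial.coe_mul, Polynomial.coe_C]
    rw [mul_assoc, ← mul_assoc (PowerSeries.mk _), hgeo, one_mul]
  have hBQ : (Q : PowerSeries ℂ) = B - PowerSeries.C (kappa N : ℂ) * PowerSeries.X ^ N * B := by
    have h3 := congrArg (fun p : Polynomial ℂ => (p : PowerSeries ℂ)) hQR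
    simp only [Polynomial.coe_mul, Polynomial.coe_sub, Polynomial.coe_one, Polynomial.coe_C,
      Polynomial.coe_pow, Polynomial.coe_X] at h3
    calc (Q : PowerSeries ℂ) = Q * (B * R) := by rw [hBR, mul_one]
      _ = (Q * R) * B := by ring
      _ = _ := by rw [h3]; ring
  have hM := two_mul_card_rootsJ hN h2
  have hM0 := card_rootsJ_pos hN h2
  have hc : ∀ m < (rootsJ N).card + 1, Q.coeff m = beta N (-(m : ℤ)) := by
    intro m hm
    rw [← Polynomial.coeff_coe, hBQ, map_sub, mul_assoc, PowerSeries.coeff_C_mul,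
      PowerSeries.coeff_X_pow_mul', if_neg (by omega)]
    simp [hB]
  have hdeg : Q.natDegree < (rootsJ N).card + 1 := by
    refine Nat.lt_succ_of_le ((Polynomial.natDegree_prod_le _ _).trans ?_)
    refine (Finset.sum_le_card_nsmul _ _ 1 fun θ _ => ?_).trans (by simp)
    refine (Polynomial.natDegree_sub_le _ _).trans ?_
    simp only [Polynomial.natDegree_one, zero_le, sup_of_le_right]
    exact (Polynomial.natDegree_mul_C_le _ _).trans (by simp)
  have h3 := Polynomial.eval_eq_sum_range' hdeg z
  rw [hQ, Polynomial.eval_prod] at h3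
  simp only [Polynomial.eval_mul, Polynomial.eval_sub,
      Polynomial.eval_one, Polynomial.eval_X, Polynomial.eval_C] at h3
  rw [h3]
  exact Finset.sum_congr rfl fun m hm => by rw [hc m (Finset.mem_range.1 hm)]


/-! ### The integrals `∫ ξ^k e^{-sξ^N} e^{-ω|y|ξ} dξ` -/

theorem integrableOn_pow_mul_exp (k : ℕ) {N : ℕ} (h2 : 2 ≤ N) {s : ℝ} (hs : 0 < s) :
    IntegrableOn (fun ξ : ℝ => ξ ^ k * Real.exp (-s * ξ ^ N)) (Set.Ioi 0) := by
  have := integrableOn_rpow_mul_exp_neg_mul_rpow (s := (k : ℝ)) (p := (N : ℝ)) (b := s)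
    (by have : (0 : ℝ) ≤ k := k.cast_nonneg
        linarith) (by exact_mod_cast (by omega : 1 ≤ N)) hs
  simpa only [Real.rpow_natCast] using this

theorem integrableOn_poly_mul_exp (q : Polynomial ℝ) {N : ℕ} (h2 : 2 ≤ N) :
    IntegrableOn (fun ξ : ℝ => q.eval ξ * Real.exp (-ξ ^ N)) (Set.Ioi 0) := by
  have h : (fun ξ : ℝ => q.eval ξ * Real.exp (-ξ ^ N)) = fun ξ : ℝ =>
      ∑ i ∈ Finset.range (q.natDegree + 1), q.coeff i * (ξ ^ i * Real.exp (-1 * ξ ^ N)) := by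
    ext ξ
    rw [Polynomial.eval_eq_sum_range, Finset.sum_mul]
    refine Finset.sum_congr rfl fun i _ => by rw [mul_assoc, neg_one_mul]
  rw [h]
  exact integrable_finsetSum _ fun i _ => (integrableOn_pow_mul_exp i h2 one_pos).const_mul _

theorem norm_exp_neg_mul_le_one {ω : ℂ} (hω : 0 ≤ ω.re) {r : ℝ} (hr : 0 ≤ r) :
    ‖Complex.exp (-ω * r)‖ ≤ 1 := by
  rw [Complex.norm_exp]
  simp only [neg_mul, Complex.neg_re, Complex.re_mul_ofReal, Real.exp_le_one_iff]
  nlinarith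

theorem ofReal_exp_pow (s ξ : ℝ) (N : ℕ) :
    Complex.exp (-(s : ℂ) * (ξ : ℂ) ^ N) = ((Real.exp (-s * ξ ^ N) : ℝ) : ℂ) := by
  push_cast; rfl

/-- The integral of `ξ^k e^{-sξ^N} e^{-ω|y|ξ}` over the positive half-line. -/
noncomputable def rayIntegral (N k : ℕ) (ω : ℂ) (s y : ℝ) : ℂ :=
  ∫ ξ in Set.Ioi (0 : ℝ), (ξ : ℂ) ^ k * Complex.exp (-s * ξ ^ N) * Complex.exp (-ω * (|y| * ξ : ℝ))

theorem norm_rayIntegrand_le {N k : ℕ} {ω : ℂ} (hω : 0 ≤ ω.re) (s y : ℝ) {ξ : ℝ} (hξ : 0 < ξ) :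
    ‖(ξ : ℂ) ^ k * Complex.exp (-s * ξ ^ N) * Complex.exp (-ω * (|y| * ξ : ℝ))‖ ≤
      ξ ^ k * Real.exp (-s * ξ ^ N) := by
  rw [norm_mul, ofReal_exp_pow, norm_mul, norm_pow, Complex.norm_real, Complex.norm_real,
    Real.norm_of_nonneg hξ.le, Real.norm_of_nonneg (Real.exp_nonneg _)]
  exact mul_le_of_le_one_right (by positivity) (norm_exp_neg_mul_le_one hω (by positivity))

theorem integrableOn_rayIntegrand {N k : ℕ} (h2 : 2 ≤ N) {ω : ℂ} (hω : 0 ≤ ω.re) {s : ℝ}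
    (hs : 0 < s) (y : ℝ) :
    IntegrableOn (fun ξ : ℝ => (ξ : ℂ) ^ k * Complex.exp (-s * ξ ^ N) *
      Complex.exp (-ω * (|y| * ξ : ℝ))) (Set.Ioi 0) := by
  refine Integrable.mono' (integrableOn_pow_mul_exp k h2 hs) ?_ ?_
  · exact Continuous.aestronglyMeasurable (by fun_prop)
  · exact (ae_restrict_mem measurableSet_Ioi).mono fun ξ hξ => norm_rayIntegrand_le hω s y hξ

theorem continuous_rayIntegral {N k : ℕ} (h2 : 2 ≤ N) {ω : ℂ} (hω : 0 ≤ ω.re) :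
    Continuous (rayIntegral N k ω 1) := by
  refine continuous_of_dominated (bound := fun ξ => ξ ^ k * Real.exp (-1 * ξ ^ N)) ?_ ?_
    (integrableOn_pow_mul_exp k h2 one_pos) ?_
  · intro y; exact Continuous.aestronglyMeasurable (by fun_prop)
  · intro y
    exact (ae_restrict_mem measurableSet_Ioi).mono fun ξ hξ => norm_rayIntegrand_le hω 1 y hξ
  · exact Eventually.of_forall fun ξ => by fun_prop

/-- The substitution `ξ ↦ s^{1/N} ξ`. It reduces continuity and decay to the case `s = 1`. -/
theorem rayIntegral_scaling {N k : ℕ} (h2 : 2 ≤ N) (ω : ℂ) {s : ℝ} (hs : 0 < s) (y : ℝ) :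
    rayIntegral N k ω s y =
      ((s ^ (-((k : ℝ) + 1) / N) : ℝ) : ℂ) * rayIntegral N k ω 1 (y * s ^ (-(1 : ℝ) / N)) := by
  set b : ℝ := s ^ ((1 : ℝ) / N) with hb
  have hb0 : 0 < b := Real.rpow_pos_of_pos hs _
  have hbi : s ^ (-(1 : ℝ) / N) = b⁻¹ := by rw [hb, neg_div, Real.rpow_neg hs.le]
  have hbN : b ^ N = s := by
    rw [hb, one_div, Real.rpow_inv_natCast_pow hs.le (by omega)]
  have hbk : s ^ (-((k : ℝ) + 1) / N) = (b ^ (k + 1))⁻¹ := by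
    rw [hb, ← Real.rpow_natCast, ← Real.rpow_mul hs.le, ← Real.rpow_neg hs.le]
    congr 1; push_cast; ring
  rw [hbi, hbk, rayIntegral, rayIntegral]
  have := integral_comp_mul_left_Ioi (fun ξ : ℝ => (ξ : ℂ) ^ k * Complex.exp (-(1 : ℝ) * ξ ^ N) *
      Complex.exp (-ω * (|y * b⁻¹| * ξ : ℝ))) 0 hb0
  rw [mul_zero] at this
  have h3 : ∫ ξ in Set.Ioi (0 : ℝ), (ξ : ℂ) ^ k * Complex.exp (-(1 : ℝ) * ξ ^ N) *
      Complex.exp (-ω * (|y * b⁻¹| * ξ : ℝ)) = b • ∫ ξ in Set.Ioi (0 : ℝ),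
      ((b * ξ : ℝ) : ℂ) ^ k * Complex.exp (-(1 : ℝ) * (b * ξ : ℝ) ^ N) *
      Complex.exp (-ω * (|y * b⁻¹| * (b * ξ) : ℝ)) := by
    rw [this, smul_smul, mul_inv_cancel₀ hb0.ne', one_smul]
  rw [h3, Complex.real_smul, ← mul_assoc, ← integral_const_mul]
  refine integral_congr_ae (Eventually.of_forall fun ξ => ?_)
  have h4 : |y * b⁻¹| * (b * ξ) = |y| * ξ := by
    rw [abs_mul, abs_of_pos (inv_pos.2 hb0)]; field_simp
  have h5 : -((1 : ℝ) : ℂ) * ((b * ξ : ℝ) : ℂ) ^ N = -s * ξ ^ N := by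
    rw [← hbN]; push_cast; ring
  have hbc : (b : ℂ) ≠ 0 := by exact_mod_cast hb0.ne'
  simp only [h4, h5]
  push_cast
  field_simp
  ring_nf

/-- One integration by parts. Polynomials times `exp (-ξ^N)` are stable under differentiation, so it
can be iterated, each time gaining a factor `1/y`. -/
theorem mul_integral_poly_mul_exp (q : Polynomial ℝ) {N : ℕ} (h2 : 2 ≤ N) {ω : ℂ}
    (hω : 0 ≤ ω.re) {y : ℝ} (hy : 0 ≤ y) :
    ω * y * ∫ ξ in Set.Ioi (0 : ℝ), ((q.eval ξ * Real.exp (-ξ ^ N) : ℝ) : ℂ) *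
        Complex.exp (-ω * (y * ξ : ℝ)) =
      (q.eval 0 : ℝ) + ∫ ξ in Set.Ioi (0 : ℝ),
        (((q.derivative - Polynomial.C (N : ℝ) * Polynomial.X ^ (N - 1) * q).eval ξ *
          Real.exp (-ξ ^ N) : ℝ) : ℂ) * Complex.exp (-ω * (y * ξ : ℝ)) := by
  set q' := q.derivative - Polynomial.C (N : ℝ) * Polynomial.X ^ (N - 1) * q with hq'
  have hint : ∀ p : Polynomial ℝ, IntegrableOn (fun ξ : ℝ =>
      ((p.eval ξ * Real.exp (-ξ ^ N) : ℝ) : ℂ) * Complex.exp (-ω * (y * ξ : ℝ))) (Set.Ioi 0) := by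
    intro p
    refine Integrable.mono' (integrableOn_poly_mul_exp p h2).norm ?_ ?_
    · exact Continuous.aestronglyMeasurable (by fun_prop)
    · refine (ae_restrict_mem measurableSet_Ioi).mono fun ξ hξ => ?_
      have hξ : 0 < ξ := hξ
      rw [norm_mul, Complex.norm_real]
      exact mul_le_of_le_one_right (norm_nonneg _) (norm_exp_neg_mul_le_one hω (by positivity))
  have hd1 : ∀ ξ : ℝ, HasDerivAt (fun ξ : ℝ => q.eval ξ * Real.exp (-ξ ^ N))
      (q'.eval ξ * Real.exp (-ξ ^ N)) ξ := by
    intro ξ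
    have h := (q.hasDerivAt ξ).mul ((hasDerivAt_pow N ξ).neg.exp)
    refine h.congr_deriv ?_
    simp only [hq', Polynomial.eval_sub, Polynomial.eval_mul, Polynomial.eval_C,
      Polynomial.eval_pow, Polynomial.eval_X, Pi.neg_apply]
    ring
  have hd : ∀ ξ : ℝ, HasDerivAt (fun ξ : ℝ => ((q.eval ξ * Real.exp (-ξ ^ N) : ℝ) : ℂ) *
      Complex.exp (-ω * (y * ξ : ℝ))) (((q'.eval ξ * Real.exp (-ξ ^ N) : ℝ) : ℂ) *
      Complex.exp (-ω * (y * ξ : ℝ)) - ω * y * (((q.eval ξ * Real.exp (-ξ ^ N) : ℝ) : ℂ) *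
      Complex.exp (-ω * (y * ξ : ℝ)))) ξ := by
    intro ξ
    have h3 : HasDerivAt (fun ξ : ℝ => -ω * ((y * ξ : ℝ) : ℂ)) (-ω * y) ξ := by
      have := (((hasDerivAt_id ξ).const_mul y).ofReal_comp).const_mul (-ω)
      simpa using this
    refine ((hd1 ξ).ofReal_comp.mul h3.cexp).congr_deriv ?_
    ring
  have hF' := (hint q').sub ((hint q).const_mul (ω * y))
  -- No boundary term at infinity: the function and its derivative are both integrable.
  have hlim := tendsto_zero_of_hasDerivAt_of_integrableOn_Ioi (fun ξ _ => hd ξ) hF' (hint q)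
  have h := integral_Ioi_of_hasDerivAt_of_tendsto (hd 0).continuousAt.continuousWithinAt
    (fun ξ _ => hd ξ) hF' hlim
  rw [integral_sub (hint q') ((hint q).const_mul _), integral_const_mul] at h
  have h0 : (0 : ℝ) ^ N = 0 := zero_pow (by omega)
  simp only [mul_zero, Complex.ofReal_zero, Complex.exp_zero, mul_one, zero_sub, h0, neg_zero,
    Real.exp_zero] at h
  linear_combination -h

/-- Two integrations by parts. As `ω` may be purely imaginary, the decay cannot be read off from
`exp (-ω|y|ξ)`; it comes from smoothness in `ξ`. The first boundary term `q(0)` vanishes because `k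
≠ 0`, the second is a constant. -/
theorem exists_norm_rayIntegral_le {N k : ℕ} (h2 : 2 ≤ N) (hk : k ≠ 0) :
    ∃ C : ℝ, 0 < C ∧ ∀ (ω : ℂ), 0 ≤ ω.re → ‖ω‖ = 1 → ∀ y : ℝ,
      ‖rayIntegral N k ω 1 y‖ ≤ C / (1 + y ^ 2) := by
  set q : Polynomial ℝ := Polynomial.X ^ k with hq
  set q1 := q.derivative - Polynomial.C (N : ℝ) * Polynomial.X ^ (N - 1) * q with hq1
  set q2 := q1.derivative - Polynomial.C (N : ℝ) * Polynomial.X ^ (N - 1) * q1 with hq2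
  set I : Polynomial ℝ → ℝ := fun p => ∫ ξ in Set.Ioi (0 : ℝ), ‖p.eval ξ * Real.exp (-ξ ^ N)‖
    with hI
  have hI0 : ∀ p, 0 ≤ I p := fun p => integral_nonneg fun _ => norm_nonneg _
  have hb : ∀ (p : Polynomial ℝ) (ω : ℂ), 0 ≤ ω.re → ∀ y : ℝ, 0 ≤ y →
      ‖∫ ξ in Set.Ioi (0 : ℝ), ((p.eval ξ * Real.exp (-ξ ^ N) : ℝ) : ℂ) *
        Complex.exp (-ω * (y * ξ : ℝ))‖ ≤ I p := by
    intro p ω hω y hy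
    refine norm_integral_le_of_norm_le (integrableOn_poly_mul_exp p h2).norm ?_
    refine (ae_restrict_mem measurableSet_Ioi).mono fun ξ hξ => ?_
    have hξ : 0 < ξ := hξ
    rw [norm_mul, Complex.norm_real]
    exact mul_le_of_le_one_right (norm_nonneg _) (norm_exp_neg_mul_le_one hω (by positivity))
  -- `I q` bounds the integral, the next two terms bound `y²` times it, and the `1` only makes the
  -- constant positive.
  refine ⟨I q + |q1.eval 0| + I q2 + 1, ?_, fun ω hω hn y => ?_⟩
  · have := hI0 q; have := hI0 q2; positivity
  have hr : rayIntegral N k ω 1 y = ∫ ξ in Set.Ioi (0 : ℝ),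
      ((q.eval ξ * Real.exp (-ξ ^ N) : ℝ) : ℂ) * Complex.exp (-ω * (|y| * ξ : ℝ)) := by
    rw [rayIntegral]
    refine integral_congr_ae (Eventually.of_forall fun ξ => ?_)
    simp [hq]
  have h1 := mul_integral_poly_mul_exp q h2 hω (abs_nonneg y)
  have h3 := mul_integral_poly_mul_exp q1 h2 hω (abs_nonneg y)
  have hq0 : q.eval 0 = 0 := by simp [hq, hk]
  rw [hq0, Complex.ofReal_zero, zero_add, ← hr] at h1
  rw [← h1] at h3
  have h4 : ‖rayIntegral N k ω 1 y‖ * y ^ 2 ≤ |q1.eval 0| + I q2 := by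
    have h5 := congrArg norm h3
    rw [norm_mul, norm_mul, norm_mul, norm_mul, hn, Complex.norm_real, Real.norm_eq_abs,
      abs_abs] at h5
    have h6 : ‖rayIntegral N k ω 1 y‖ * y ^ 2 =
        1 * |y| * (1 * |y| * ‖rayIntegral N k ω 1 y‖) := by
      rw [← sq_abs]; ring
    rw [h6, h5]
    refine (norm_add_le _ _).trans (add_le_add ?_ (hb q2 ω hω _ (abs_nonneg y)))
    rw [Complex.norm_real, Real.norm_eq_abs]
  have h7 : ‖rayIntegral N k ω 1 y‖ ≤ I q := by
    rw [hr]; exact hb q ω hω _ (abs_nonneg y)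
  rw [le_div_iff₀ (by positivity)]
  linarith

/-! ### Expansion of `𝒥_m` in exponentials -/

/-- The sign of a ray. -/
def raySign (b : Bool) : ℝ := if b then 1 else -1

/-- The direction `θ e^{± iπ/N}`. -/
noncomputable def rayDir (N : ℕ) (p : ℂ × Bool) : ℂ :=
  p.1 * Complex.exp ((raySign p.2 * (Real.pi / N) : ℝ) * Complex.I)

/-- The coefficient of `e^{-ωz}`, `ω = rayDir N p`, in `𝒥_0`. -/
noncomputable def rayCoeff (N : ℕ) (p : ℂ × Bool) : ℂ :=
  raySign p.2 * Complex.exp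
    ((-(raySign p.2 * (((rootsJ N).card - 1) * (Real.pi / N))) : ℝ) * Complex.I) *
    (coeff (rootsJ N) p.1 * p.1)

/-- The set of indices `(θ, ±)`. -/
noncomputable def rays (N : ℕ) : Finset (ℂ × Bool) := rootsJ N ×ˢ Finset.univ

/-- The factor `θ^m` and the `m`-dependent part of the phase combine into `(θ e^{±iπ/N})^m`, so that
`m` enters only through a power of the ray direction. This is how the powers `(ωξ)^m` of
`laplace_wave` are later absorbed into `𝒥_m`. -/
theorem calJ_eq_sum_rays (N m : ℕ) (z : ℂ) :
    calJ N m z = ∑ p ∈ rays N, rayCoeff N p * rayDir N p ^ m * Complex.exp (-rayDir N p * z) := by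
  rw [rays, Finset.sum_product]
  simp only [Fintype.sum_bool]
  rw [Finset.sum_add_distrib, calJ, Finset.mul_sum, Finset.mul_sum, sub_eq_add_neg,
    ← Finset.sum_neg_distrib]
  congr 1 <;> refine Finset.sum_congr rfl fun θ _ => ?_
  · simp only [rayCoeff, rayDir, raySign, if_true, one_mul, Complex.ofReal_one]
    have h1 : Complex.exp (Complex.I * (Real.pi / N)) =
        Complex.exp ((Real.pi / N : ℝ) * Complex.I) := by
      congr 1; push_cast; ring
    have h2 : Complex.exp (-Complex.I * ((((rootsJ N).card : ℂ) - m - 1) / N) * Real.pi) =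
        Complex.exp ((-(((rootsJ N).card - 1) * (Real.pi / N)) : ℝ) * Complex.I) *
          Complex.exp ((Real.pi / N : ℝ) * Complex.I) ^ m := by
      rw [← Complex.exp_nat_mul, ← Complex.exp_add]
      congr 1; push_cast; ring
    rw [h1, h2, mul_pow]
    ring_nf
  · simp only [rayCoeff, rayDir, raySign, Bool.false_eq_true, if_false]
    have h1 : Complex.exp (-Complex.I * (Real.pi / N)) =
        Complex.exp ((-1 * (Real.pi / N) : ℝ) * Complex.I) := by
      congr 1; push_cast; ring
    have h2 : Complex.exp (Complex.I * ((((rootsJ N).card : ℂ) - m - 1) / N) * Real.pi) =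
        Complex.exp ((-(-1 * (((rootsJ N).card - 1) * (Real.pi / N))) : ℝ) * Complex.I) *
          Complex.exp ((-1 * (Real.pi / N) : ℝ) * Complex.I) ^ m := by
      rw [← Complex.exp_nat_mul, ← Complex.exp_add]
      congr 1; push_cast; ring
    rw [h1, h2, mul_pow]
    push_cast
    ring_nf

theorem re_rayDir_nonneg {N : ℕ} (hN : Even N) (h2 : 2 ≤ N) {p : ℂ × Bool} (hp : p ∈ rays N) :
    0 ≤ (rayDir N p).re := by
  refine re_rootsJ_mul_exp hN h2 (Finset.mem_product.1 hp).1 ?_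
  have : 0 ≤ Real.pi / N := by positivity
  rcases p with ⟨θ, _ | _⟩ <;> simp [raySign, abs_of_nonneg this]

theorem norm_rayDir {N : ℕ} (h2 : 2 ≤ N) {p : ℂ × Bool} (hp : p ∈ rays N) :
    ‖rayDir N p‖ = 1 := by
  rw [rayDir, norm_mul, Complex.norm_exp_ofReal_mul_I, mul_one]
  exact norm_of_pow_eq_kappa h2 ((mem_rootsJ h2).1 (Finset.mem_product.1 hp).1).1

/-- The turn by `±π/N` flips the sign of the `N`-th power; it is responsible for the positive
denominator `a^N + ξ^N` in `prod_add_mul_rootsJ`. -/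
theorem rayDir_pow {N : ℕ} (h2 : 2 ≤ N) {p : ℂ × Bool} (hp : p ∈ rays N) :
    rayDir N p ^ N = -(kappa N : ℂ) := by
  have hN0 : (N : ℂ) ≠ 0 := by exact_mod_cast (by omega : N ≠ 0)
  rw [rayDir, mul_pow, ((mem_rootsJ h2).1 (Finset.mem_product.1 hp).1).1, ← Complex.exp_nat_mul]
  have : Complex.exp (N * ((raySign p.2 * (Real.pi / N) : ℝ) * Complex.I)) = -1 := by
    have h3 : (N : ℂ) * ((raySign p.2 * (Real.pi / N) : ℝ) * Complex.I) =
        raySign p.2 * (Real.pi * Complex.I) := by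
      push_cast; field_simp
    rw [h3]
    rcases p with ⟨θ, _ | _⟩
    · simp [raySign, Complex.exp_neg]
    · simp [raySign]
  rw [this]; ring

theorem coeff_conj_rootsJ {N : ℕ} (h2 : 2 ≤ N) (θ : ℂ) :
    coeff (rootsJ N) ((starRingEnd ℂ) θ) = (starRingEnd ℂ) (coeff (rootsJ N) θ) := by
  rw [coeff, coeff, map_prod]
  refine Finset.prod_nbij' (starRingEnd ℂ) (starRingEnd ℂ) ?_ ?_ (by simp) (by simp) (by simp)
  all_goals
    intro η hη
    rw [Finset.mem_erase] at hη ⊢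
    refine ⟨fun h => hη.1 ?_, conj_mem_rootsJ h2 hη.2⟩
    have := congrArg (starRingEnd ℂ) h
    simpa using this

/-- Conjugation permutes the rays, exchanging the two turns, and sends `rayCoeff` to minus its value
at the conjugate ray. So `𝒥_0` is imaginary on the real line and the prefactor `i` makes `wave`
real. -/
theorem conj_calJ_zero {N : ℕ} (h2 : 2 ≤ N) (r : ℝ) :
    (starRingEnd ℂ) (calJ N 0 r) = -calJ N 0 r := by
  rw [calJ_eq_sum_rays, map_sum, ← Finset.sum_neg_distrib]
  have hmem : ∀ p ∈ rays N, ((starRingEnd ℂ) p.1, !p.2) ∈ rays N := fun p hp =>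
    Finset.mem_product.2 ⟨conj_mem_rootsJ h2 (Finset.mem_product.1 hp).1, Finset.mem_univ _⟩
  refine Finset.sum_nbij' (fun p => ((starRingEnd ℂ) p.1, !p.2))
    (fun p => ((starRingEnd ℂ) p.1, !p.2)) hmem hmem (by simp) (by simp) ?_
  intro p _
  have hs : raySign (!p.2) = -raySign p.2 := by
    rcases p with ⟨θ, _ | _⟩ <;> simp [raySign]
  have hd : (starRingEnd ℂ) (rayDir N p) = rayDir N ((starRingEnd ℂ) p.1, !p.2) := by
    simp only [rayDir, hs, map_mul, ← Complex.exp_conj, Complex.conj_I, Complex.conj_ofReal]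
    congr 2; push_cast; ring
  have hc : (starRingEnd ℂ) (rayCoeff N p) = -rayCoeff N ((starRingEnd ℂ) p.1, !p.2) := by
    simp only [rayCoeff, hs, map_mul, ← Complex.exp_conj, Complex.conj_I, Complex.conj_ofReal,
      coeff_conj_rootsJ h2]
    rw [← neg_mul, ← neg_mul]
    congr 2
    · push_cast; ring_nf
  simp only [pow_zero, mul_one, map_mul, ← Complex.exp_conj, map_neg, hd, hc, Complex.conj_ofReal]
  ring

/-! ### The wave function -/

/-- The function `u(s; y) = Ni/(2π) ∫_0^∞ ξ^{#J} e^{-sξ^N} 𝒥_0(|y|ξ) dξ`. -/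
noncomputable def wave (N : ℕ) (s y : ℝ) : ℂ :=
  N * Complex.I / (2 * Real.pi) * ∫ ξ in Set.Ioi (0 : ℝ),
    (ξ : ℂ) ^ (rootsJ N).card * Complex.exp (-s * ξ ^ N) * calJ N 0 ((|y| * ξ : ℝ) : ℂ)

theorem wave_eq_sum {N : ℕ} (hN : Even N) (h2 : 2 ≤ N) {s : ℝ} (hs : 0 < s) (y : ℝ) :
    wave N s y = N * Complex.I / (2 * Real.pi) *
      ∑ p ∈ rays N, rayCoeff N p * rayIntegral N (rootsJ N).card (rayDir N p) s y := by
  rw [wave]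
  congr 1
  simp only [rayIntegral, ← integral_const_mul]
  rw [← integral_finsetSum]
  · refine integral_congr_ae (Eventually.of_forall fun ξ => ?_)
    simp only [calJ_eq_sum_rays, Finset.mul_sum, pow_zero, mul_one]
    exact Finset.sum_congr rfl fun p _ => by ring
  · intro p hp
    exact (integrableOn_rayIntegrand h2 (re_rayDir_nonneg hN h2 hp) hs y).const_mul _

theorem wave_scaling {N : ℕ} (hN : Even N) (h2 : 2 ≤ N) {s : ℝ} (hs : 0 < s) (y : ℝ) :
    wave N s y = ((s ^ (-(((rootsJ N).card : ℝ) + 1) / N) : ℝ) : ℂ) *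
      wave N 1 (y * s ^ (-(1 : ℝ) / N)) := by
  have h1 := wave_eq_sum hN h2 one_pos (y * s ^ (-(1 : ℝ) / N))
  have h3 : ∀ p ∈ rays N, rayCoeff N p * rayIntegral N (rootsJ N).card (rayDir N p) s y =
      ((s ^ (-(((rootsJ N).card : ℝ) + 1) / N) : ℝ) : ℂ) * (rayCoeff N p *
        rayIntegral N (rootsJ N).card (rayDir N p) 1 (y * s ^ (-(1 : ℝ) / N))) := by
    intro p _
    rw [rayIntegral_scaling h2 _ hs, mul_left_comm]
  rw [wave_eq_sum hN h2 hs, h1, mul_left_comm, Finset.sum_congr rfl h3, ← Finset.mul_sum]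

theorem continuous_wave_one {N : ℕ} (hN : Even N) (h2 : 2 ≤ N) : Continuous (wave N 1) := by
  have : wave N 1 = fun y => N * Complex.I / (2 * Real.pi) *
      ∑ p ∈ rays N, rayCoeff N p * rayIntegral N (rootsJ N).card (rayDir N p) 1 y :=
    funext fun y => wave_eq_sum hN h2 one_pos y
  rw [this]
  exact continuous_const.mul (continuous_finsetSum _ fun p hp =>
    continuous_const.mul (continuous_rayIntegral h2 (re_rayDir_nonneg hN h2 hp)))

theorem exists_norm_wave_le {N : ℕ} (hN : Even N) (h2 : 2 ≤ N) :
    ∃ C : ℝ, 0 < C ∧ ∀ y : ℝ, ‖wave N 1 y‖ ≤ C / (1 + y ^ 2) := by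
  obtain ⟨C, hC, h⟩ := exists_norm_rayIntegral_le (k := (rootsJ N).card) h2
    (card_rootsJ_pos hN h2).ne'
  set D := ‖(N : ℂ) * Complex.I / (2 * Real.pi)‖ * ∑ p ∈ rays N, ‖rayCoeff N p‖ * C with hD
  have hD0 : 0 ≤ D := mul_nonneg (norm_nonneg _)
    (Finset.sum_nonneg fun p _ => mul_nonneg (norm_nonneg _) hC.le)
  refine ⟨D + 1, by linarith, fun y => ?_⟩
  rw [wave_eq_sum hN h2 one_pos, norm_mul]
  calc _ ≤ ‖(N : ℂ) * Complex.I / (2 * Real.pi)‖ *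
        ∑ p ∈ rays N, ‖rayCoeff N p‖ * (C / (1 + y ^ 2)) := by
        gcongr
        refine (norm_sum_le _ _).trans (Finset.sum_le_sum fun p hp => ?_)
        rw [norm_mul]
        gcongr
        exact h _ (re_rayDir_nonneg hN h2 hp) (norm_rayDir h2 hp) y
    _ = D / (1 + y ^ 2) := by
        rw [hD, ← Finset.sum_mul, ← Finset.sum_mul]; ring
    _ ≤ _ := by gcongr; linarith

theorem conj_wave {N : ℕ} (h2 : 2 ≤ N) (s y : ℝ) :
    (starRingEnd ℂ) (wave N s y) = wave N s y := by
  rw [wave, map_mul, ← integral_conj]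
  have h : ∀ ξ : ℝ, (starRingEnd ℂ) ((ξ : ℂ) ^ (rootsJ N).card * Complex.exp (-s * ξ ^ N) *
      calJ N 0 ((|y| * ξ : ℝ) : ℂ)) = -((ξ : ℂ) ^ (rootsJ N).card * Complex.exp (-s * ξ ^ N) *
      calJ N 0 ((|y| * ξ : ℝ) : ℂ)) := by
    intro ξ
    rw [map_mul, conj_calJ_zero h2, ofReal_exp_pow]
    simp only [map_mul, map_pow, Complex.conj_ofReal]
    ring
  simp only [h, integral_neg]
  simp only [map_div₀, map_mul, Complex.conj_I, Complex.conj_ofReal, map_natCast, map_ofNat]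
  ring


/-! ### A contour integral over the boundary of a strip -/

theorem integrable_exp_div_add_exp {M : ℕ} (hM : 0 < M) {p : ℝ} (hp : 0 < p) :
    Integrable fun x : ℝ => Real.exp (M * x) / (p + Real.exp (2 * M * x)) := by
  set d := min p 1 with hd
  have hd0 : 0 < d := lt_min hp one_pos
  refine Integrable.mono' (integrable_inv_one_add_sq.const_mul (2 * d⁻¹)) ?_ ?_
  · refine Continuous.aestronglyMeasurable (Continuous.div (by fun_prop) (by fun_prop) fun x => ?_)
    positivity
  · refine Eventually.of_forall fun x => ?_
    have e1 := Real.exp_pos (M * x)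
    have h1 : Real.exp (2 * M * x) = Real.exp (M * x) * Real.exp (M * x) := by
      rw [← Real.exp_add]; ring_nf
    have h2 : Real.exp (M * x) * Real.exp (-(M * x)) = 1 := by
      rw [← Real.exp_add, add_neg_cancel, Real.exp_zero]
    have h3 : 1 + x ^ 2 ≤ 2 * (Real.exp (M * x) + Real.exp (-(M * x))) := by
      have hM1 : (1 : ℝ) ≤ M ^ 2 := one_le_pow₀ (by exact_mod_cast hM)
      have h4 : x ^ 2 ≤ (M * x) ^ 2 := by
        rw [mul_pow]; exact le_mul_of_one_le_left (sq_nonneg x) hM1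
      have h5 : ∀ y : ℝ, 0 ≤ y → 1 + y ^ 2 ≤ 2 * (Real.exp y + Real.exp (-y)) := by
        intro y hy
        have h6 := Real.quadratic_le_exp_of_nonneg hy
        have h7 := Real.exp_pos (-y)
        linarith
      have h8 := h5 |M * x| (abs_nonneg _)
      rw [sq_abs] at h8
      refine (by linarith : 1 + x ^ 2 ≤ 1 + (M * x) ^ 2).trans (h8.trans_eq ?_)
      rcases abs_cases (M * x) with h | h <;> rw [h.1]
      rw [neg_neg, add_comm]
    have h7 : d ≤ p := min_le_left _ _
    have h8 : d ≤ 1 := min_le_right _ _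
    rw [Real.norm_of_nonneg (by positivity), h1, ← div_eq_mul_inv, div_le_div_iff₀ (by positivity)
      (by positivity)]
    calc Real.exp (M * x) * (1 + x ^ 2)
        ≤ Real.exp (M * x) * (2 * (Real.exp (M * x) + Real.exp (-(M * x)))) := by gcongr
      _ = 2 * d⁻¹ * (d * (Real.exp (M * x) * Real.exp (-(M * x))) +
          d * (Real.exp (M * x) * Real.exp (M * x))) := by field_simp; ring
      _ ≤ 2 * d⁻¹ * (p * 1 + 1 * (Real.exp (M * x) * Real.exp (M * x))) := by
          rw [h2]; gcongr
      _ = _ := by ring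

/-- In the variable `v = e^{Mx} / a^M` the integrand is a multiple of `dv / (1 + v²)`. -/
theorem integral_exp_div_add_exp {M : ℕ} (hM : 0 < M) {a : ℝ} (ha : 0 < a) :
    ∫ x : ℝ, Real.exp (M * x) / (a ^ (2 * M) + Real.exp (2 * M * x)) =
      Real.pi / (2 * M * a ^ M) := by
  have hM0 : (0 : ℝ) < M := by exact_mod_cast hM
  have hq : 0 < a ^ M := by positivity
  have hd : ∀ x : ℝ, HasDerivAt
      (fun x : ℝ => (M * a ^ M)⁻¹ * Real.arctan (Real.exp (M * x) / a ^ M))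
      (Real.exp (M * x) / (a ^ (2 * M) + Real.exp (2 * M * x))) x := by
    intro x
    have h1 : HasDerivAt (fun x : ℝ => Real.exp (M * x)) (Real.exp (M * x) * M) x := by
      simpa using ((hasDerivAt_id x).const_mul (M : ℝ)).exp
    refine (((h1.div_const (a ^ M)).arctan).const_mul (M * a ^ M)⁻¹).congr_deriv ?_
    have h3 : Real.exp (2 * M * x) = Real.exp (M * x) ^ 2 := by
      rw [← Real.exp_nat_mul]; congr 1; push_cast; ring
    have h4 : a ^ (2 * M) = (a ^ M) ^ 2 := by rw [← pow_mul, mul_comm]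
    rw [h3, h4]
    have := Real.exp_pos (M * x)
    field_simp
  have hMx : Tendsto (fun x : ℝ => (M : ℝ) * x) atTop atTop := tendsto_id.const_mul_atTop hM0
  have hMb : Tendsto (fun x : ℝ => (M : ℝ) * x) atBot atBot := tendsto_id.const_mul_atBot hM0
  have hbot : Tendsto (fun x : ℝ => (M * a ^ M)⁻¹ * Real.arctan (Real.exp (M * x) / a ^ M))
      atBot (𝓝 ((M * a ^ M)⁻¹ * Real.arctan (0 / a ^ M))) :=
    (((Real.continuous_arctan.tendsto _).comp
      ((Real.tendsto_exp_atBot.comp hMb).div_const _))).const_mul _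
  have htop : Tendsto (fun x : ℝ => (M * a ^ M)⁻¹ * Real.arctan (Real.exp (M * x) / a ^ M))
      atTop (𝓝 ((M * a ^ M)⁻¹ * (Real.pi / 2))) :=
    (((tendsto_nhds_of_tendsto_nhdsWithin Real.tendsto_arctan_atTop).comp
      ((Real.tendsto_exp_atTop.comp hMx).atTop_div_const hq))).const_mul _
  rw [integral_of_hasDerivAt_of_tendsto hd (integrable_exp_div_add_exp hM (by positivity)) hbot
    htop]
  simp
  field_simp

theorem cexp_two_mul_line {M : ℕ} (hM : 0 < M) (x : ℝ) (b : Bool) :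
    Complex.exp (2 * M * (x + (raySign b * (Real.pi / (2 * M)) : ℝ) * Complex.I)) =
      -((Real.exp (2 * M * x) : ℝ) : ℂ) := by
  have hM0 : (M : ℂ) ≠ 0 := by exact_mod_cast hM.ne'
  have : (2 : ℂ) * M * (x + (raySign b * (Real.pi / (2 * M)) : ℝ) * Complex.I) =
      ((2 * M * x : ℝ) : ℂ) + raySign b * (Real.pi * Complex.I) := by
    push_cast; field_simp
  rw [this, Complex.exp_add, ← Complex.ofReal_exp]
  cases b <;> simp [raySign, Complex.exp_neg]

/-- The residue theorem for `G(w) / (a^{2M} - e^{2Mw})` on the strip, where `log a` is the only pole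
of the denominator; on the edges `e^{2Mw} = -e^{2Mx}`. Instead of a residue, one subtracts from `G`
the function `G(log a) e^{M(w - log a)}`, which has the same value at the pole and the same growth.
The remainder is holomorphic, so by Cauchy its integrals over both edges agree; the subtracted term
is explicit by `integral_exp_div_add_exp`, because `e^{Mw}` takes the factors `±i` on the edges. -/
theorem integral_strip_boundary {M : ℕ} (hM : 0 < M) {a : ℝ} (ha : 0 < a) {G : ℂ → ℂ}
    (hG : DifferentiableOn ℂ G {w | |w.im| ≤ Real.pi / (2 * M)}) {C : ℝ}
    (hC : ∀ w : ℂ, |w.im| ≤ Real.pi / (2 * M) → ‖G w‖ ≤ C * Real.exp (M * w.re)) :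
    ∫ x : ℝ, (G (x + (raySign true * (Real.pi / (2 * M)) : ℝ) * Complex.I) -
        G (x + (raySign false * (Real.pi / (2 * M)) : ℝ) * Complex.I)) /
        ((a ^ (2 * M) + Real.exp (2 * M * x) : ℝ) : ℂ) =
      2 * Real.pi * Complex.I / (2 * M * a ^ (2 * M)) * G (Real.log a) := by
  have hM0 : (0 : ℝ) < M := by exact_mod_cast hM
  have hMc : (M : ℂ) ≠ 0 := by exact_mod_cast hM.ne'
  have hpi := Real.pi_pos
  set c : ℝ := Real.pi / (2 * M) with hc
  have hc0 : 0 < c := by positivity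
  set S : Set ℂ := {w | |w.im| ≤ c} with hS
  set p : ℝ := a ^ (2 * M) with hp
  have hp0 : 0 < p := by positivity
  set w0 : ℂ := (Real.log a : ℂ) with hw0
  have hw0S : S ∈ 𝓝 w0 := by
    refine (isOpen_lt (continuous_abs.comp Complex.continuous_im) continuous_const).mem_nhds
      (show |w0.im| < c by simpa [hw0] using hc0) |> fun h => mem_of_superset h fun w hw => ?_
    exact (show |w.im| < c from hw).le
  have hEw0 : Complex.exp (2 * M * w0) = p := by
    rw [hw0, hp, ← Complex.ofReal_natCast, ← Complex.ofReal_ofNat, ← Complex.ofReal_mul,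
      ← Complex.ofReal_mul, ← Complex.ofReal_exp]
    congr 1
    have : (2 : ℝ) * M * Real.log a = ((2 * M : ℕ) : ℝ) * Real.log a := by push_cast; ring
    rw [this, Real.exp_nat_mul, Real.exp_log ha]
  set num : ℂ → ℂ := fun w => G w - G w0 * Complex.exp (M * (w - w0)) with hnum
  set den : ℂ → ℂ := fun w => p - Complex.exp (2 * M * w) with hden
  have hnum0 : num w0 = 0 := by simp [hnum]
  have hden0 : den w0 = 0 := by simp [hden, hEw0]
  have hdenne : ∀ w ∈ S, w ≠ w0 → den w ≠ 0 := by
    intro w hw hne h0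
    have h1 : Complex.exp (2 * M * w) = Complex.exp (2 * M * w0) := by
      rw [hEw0]; simp only [hden] at h0; linear_combination -h0
    rw [Complex.exp_eq_exp_iff_exists_int] at h1
    obtain ⟨n, hn⟩ := h1
    have h3 : 2 * M * w.im = n * (2 * Real.pi) := by
      have := congrArg Complex.im hn
      simpa [hw0] using this
    have h4 : |2 * M * w.im| ≤ Real.pi := by
      rw [abs_mul, abs_of_pos (by positivity)]
      calc 2 * M * |w.im| ≤ 2 * M * c := by
            have : |w.im| ≤ c := hw
            gcongr
        _ = Real.pi := by rw [hc]; field_simp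
    rw [h3, abs_mul, abs_of_pos (by positivity : 0 < 2 * Real.pi)] at h4
    have h5 : |(n : ℝ)| < 1 := by
      by_contra hcon; push Not at hcon; nlinarith
    have h6 : n = 0 := by
      have : |n| < 1 := by exact_mod_cast h5
      exact Int.abs_lt_one_iff.1 this
    rw [h6] at hn
    apply hne
    have h7 : (2 * M : ℂ) * w = 2 * M * w0 := by simpa using hn
    exact mul_left_cancel₀ (by simpa using hMc) h7
  -- The quotient with its removable singularity filled in: `num / den` away from `w0`, the quotient
  -- of the derivatives at `w0`.
  set Q : ℂ → ℂ := fun w => dslope num w0 w / dslope den w0 w with hQ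
  have hQne : ∀ w, w ≠ w0 → Q w = num w / den w := by
    intro w hne
    have : w - w0 ≠ 0 := sub_ne_zero.2 hne
    simp only [hQ]
    rw [dslope_of_ne _ hne, dslope_of_ne _ hne, slope, slope, vsub_eq_sub, vsub_eq_sub, hnum0,
      hden0, sub_zero, sub_zero, smul_eq_mul, smul_eq_mul, mul_div_mul_left _ _ (inv_ne_zero this)]
  have hdden : HasDerivAt den (-(2 * M * p)) w0 := by
    have h1 : HasDerivAt (fun w : ℂ => (2 * M : ℂ) * w) (2 * M) w0 := by
      simpa using (hasDerivAt_id w0).const_mul (2 * M : ℂ)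
    refine (h1.cexp.const_sub (p : ℂ)).congr_deriv ?_
    rw [hEw0]; ring
  have hQdiff : DifferentiableOn ℂ Q S := by
    have hn : DifferentiableOn ℂ num S := hG.sub (by fun_prop)
    have hd : DifferentiableOn ℂ den S := by fun_prop
    refine ((Complex.differentiableOn_dslope hw0S).2 hn).div
      ((Complex.differentiableOn_dslope hw0S).2 hd) ?_
    intro w hw
    rcases eq_or_ne w w0 with rfl | hne
    · rw [dslope_same, hdden.deriv]
      have : (p : ℂ) ≠ 0 := by exact_mod_cast hp0.ne'
      simp [hMc, this]
    · rw [dslope_of_ne _ hne, slope, vsub_eq_sub, hden0, sub_zero, smul_eq_mul]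
      exact mul_ne_zero (inv_ne_zero (sub_ne_zero.2 hne)) (hdenne w hw hne)
  set C' : ℝ := |C| + ‖G w0‖ * Real.exp (-(M * Real.log a)) with hC'
  have hC'0 : 0 ≤ C' := by positivity
  have hnumle : ∀ w ∈ S, ‖num w‖ ≤ C' * Real.exp (M * w.re) := by
    intro w hw
    refine (norm_sub_le _ _).trans ?_
    rw [norm_mul, Complex.norm_exp, hC', add_mul, mul_assoc, ← Real.exp_add]
    have h1 : (M * (w - w0) : ℂ).re = -(M * Real.log a) + M * w.re := by
      simp [hw0]; ring
    rw [h1]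
    gcongr
    exact (hC w hw).trans (by gcongr; exact le_abs_self C)
  have hlineS : ∀ (x : ℝ) (b : Bool), (x + (raySign b * c : ℝ) * Complex.I : ℂ) ∈ S := by
    intro x b
    cases b <;> simp [hS, raySign, abs_of_pos hc0]
  have hlinene : ∀ (x : ℝ) (b : Bool), (x + (raySign b * c : ℝ) * Complex.I : ℂ) ≠ w0 := by
    intro x b h
    have := congrArg Complex.im h
    cases b <;> simp [hw0, raySign] at this <;> exact hc0.ne' this
  have hQline : ∀ (x : ℝ) (b : Bool), Q (x + (raySign b * c : ℝ) * Complex.I) =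
      num (x + (raySign b * c : ℝ) * Complex.I) / ((p + Real.exp (2 * M * x) : ℝ) : ℂ) := by
    intro x b
    rw [hQne _ (hlinene x b)]
    simp only [hden, hc]
    rw [cexp_two_mul_line hM x b]
    push_cast; ring
  have hlinecont : ∀ {F : ℂ → ℂ}, DifferentiableOn ℂ F S → ∀ b : Bool,
      Continuous fun x : ℝ => F (x + (raySign b * c : ℝ) * Complex.I) := by
    intro F hF b
    exact hF.continuousOn.comp_continuous (by fun_prop) (fun x => hlineS x b)
  have hposden : ∀ x : ℝ, (0 : ℝ) < p + Real.exp (2 * M * x) := fun x => by positivity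
  have hint : ∀ {F : ℂ → ℂ}, DifferentiableOn ℂ F S → ∀ D : ℝ,
      (∀ w ∈ S, ‖F w‖ ≤ D * Real.exp (M * w.re)) → ∀ b : Bool, Integrable fun x : ℝ =>
        F (x + (raySign b * c : ℝ) * Complex.I) / ((p + Real.exp (2 * M * x) : ℝ) : ℂ) := by
    intro F hF D hD b
    refine Integrable.mono' ((integrable_exp_div_add_exp hM hp0).const_mul D) ?_ ?_
    · exact ((hlinecont hF b).div (by fun_prop) fun x => by
        exact_mod_cast (hposden x).ne').aestronglyMeasurable
    · refine Eventually.of_forall fun x => ?_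
      rw [norm_div, Complex.norm_real, Real.norm_of_nonneg (hposden x).le]
      refine (div_le_div_of_nonneg_right (c := p + Real.exp (2 * M * x)) ?_
        (hposden x).le).trans_eq (mul_div_assoc _ _ _)
      simpa using hD _ (hlineS x b)
  have hrect : ∀ R : ℝ, (((∫ x : ℝ in -R..R, Q (x + (raySign false * c : ℝ) * Complex.I)) -
      ∫ x : ℝ in -R..R, Q (x + (raySign true * c : ℝ) * Complex.I)) +
      Complex.I • ∫ y : ℝ in -c..c, Q (R + y * Complex.I)) -
      Complex.I • ∫ y : ℝ in -c..c, Q ((-R : ℝ) + y * Complex.I) = 0 := by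
    intro R
    have := Complex.integral_boundary_rect_eq_zero_of_differentiableOn Q ⟨-R, -c⟩ ⟨R, c⟩
      (hQdiff.mono ?_)
    · simpa [raySign] using this
    · intro w hw
      have := (Complex.mem_reProdIm.1 hw).2
      simp only [Set.uIcc_of_le (by linarith : -c ≤ c), Set.mem_Icc] at this
      exact abs_le.2 this
  have hr0 : Tendsto (fun R : ℝ => Real.exp (-(M * R))) atTop (𝓝 0) :=
    Real.tendsto_exp_neg_atTop_nhds_zero.comp (tendsto_id.const_mul_atTop hM0)
  have hvert : ∀ (F : ℝ → ℂ) (B : ℝ → ℝ), Tendsto (fun R => B (Real.exp (-(M * R)))) atTop (𝓝 0) →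
      (∀ᶠ R in atTop, ‖F R‖ ≤ B (Real.exp (-(M * R))) * |c - -c|) → Tendsto F atTop (𝓝 0) := by
    intro F B hB hF
    refine squeeze_zero_norm' hF ?_
    simpa using hB.mul_const |c - -c|
  have hyS : ∀ y ∈ Set.uIoc (-c) c, |y| ≤ c := by
    intro y hy
    rw [Set.uIoc_of_le (by linarith)] at hy
    exact abs_le.2 ⟨hy.1.le, hy.2⟩
  have hnormE : ∀ w : ℂ, ‖Complex.exp (2 * M * w)‖ = Real.exp (M * w.re) ^ 2 := by
    intro w
    rw [Complex.norm_exp, ← Real.exp_nat_mul]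
    congr 1; simp; ring
  -- With `r = e^{-MR}`, on the right side `|num| ≤ C'/r` and `|den| ≥ r⁻² - p`; on the left side
  -- `|num| ≤ C' r` and `|den| ≥ p - r²`. Both quotients are `O(r)`.
  have hright : Tendsto (fun R : ℝ => ∫ y : ℝ in -c..c, Q (R + y * Complex.I)) atTop (𝓝 0) := by
    refine hvert _ (fun r => C' * (r / (1 - p * r ^ 2))) ?_ ?_
    · have : ContinuousAt (fun r : ℝ => C' * (r / (1 - p * r ^ 2))) 0 := by
        refine continuousAt_const.mul (ContinuousAt.div (by fun_prop) (by fun_prop) (by simp))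
      have h := this.tendsto.comp hr0
      simpa [Function.comp_def] using h
    · have hev : ∀ᶠ R : ℝ in atTop, 0 < 1 - p * Real.exp (-(M * R)) ^ 2 := by
        have : Tendsto (fun R : ℝ => 1 - p * Real.exp (-(M * R)) ^ 2) atTop (𝓝 (1 - p * 0 ^ 2)) :=
          ((hr0.pow 2).const_mul p).const_sub 1
        exact this.eventually (lt_mem_nhds (by norm_num))
      filter_upwards [hev] with R hR
      refine intervalIntegral.norm_integral_le_of_norm_le_const fun y hy => ?_
      set w : ℂ := R + y * Complex.I with hw
      have hwre : w.re = R := by simp [hw]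
      have hwS : w ∈ S := by simpa [hS, hw] using hyS y hy
      have e1 := Real.exp_pos (M * R)
      have e2 : Real.exp (-(M * R)) = (Real.exp (M * R))⁻¹ := Real.exp_neg _
      have hlow : Real.exp (M * R) ^ 2 - p ≤ ‖den w‖ := by
        have := norm_sub_norm_le (Complex.exp (2 * M * w)) (p : ℂ)
        rw [hnormE, hwre, Complex.norm_real, Real.norm_of_nonneg hp0.le] at this
        rw [norm_sub_rev] at this
        exact this
      rw [e2] at hR ⊢
      have hpos : 0 < Real.exp (M * R) ^ 2 - p := by
        have : Real.exp (M * R) ^ 2 - p = Real.exp (M * R) ^ 2 *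
          (1 - p * (Real.exp (M * R))⁻¹ ^ 2) := by field_simp
        rw [this]; positivity
      have hne : w ≠ w0 := by
        rintro h
        rw [h, hden0, norm_zero] at hlow
        linarith
      rw [hQne w hne, norm_div]
      calc ‖num w‖ / ‖den w‖ ≤ C' * Real.exp (M * R) / (Real.exp (M * R) ^ 2 - p) := by
            have := hnumle w hwS
            rw [hwre] at this
            gcongr
        _ = _ := by
            have hR' := hR.ne'
            have hpos' := hpos.ne'
            field_simp
  have hleft : Tendsto (fun R : ℝ => ∫ y : ℝ in -c..c, Q ((-R : ℝ) + y * Complex.I)) atTop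
      (𝓝 0) := by
    refine hvert _ (fun r => C' * (r / (p - r ^ 2))) ?_ ?_
    · have : ContinuousAt (fun r : ℝ => C' * (r / (p - r ^ 2))) 0 := by
        refine continuousAt_const.mul (ContinuousAt.div (by fun_prop) (by fun_prop) ?_)
        simpa using hp0.ne'
      have h := this.tendsto.comp hr0
      simpa [Function.comp_def] using h
    · have hev : ∀ᶠ R : ℝ in atTop, 0 < p - Real.exp (-(M * R)) ^ 2 := by
        have : Tendsto (fun R : ℝ => p - Real.exp (-(M * R)) ^ 2) atTop (𝓝 (p - 0 ^ 2)) :=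
          (hr0.pow 2).const_sub p
        exact this.eventually (lt_mem_nhds (by simpa using hp0))
      filter_upwards [hev] with R hR
      refine intervalIntegral.norm_integral_le_of_norm_le_const fun y hy => ?_
      set w : ℂ := (-R : ℝ) + y * Complex.I with hw
      have hwre : w.re = -R := by simp [hw]
      have hwS : w ∈ S := by simpa [hS, hw] using hyS y hy
      have hlow : p - Real.exp (-(M * R)) ^ 2 ≤ ‖den w‖ := by
        have := norm_sub_norm_le (p : ℂ) (Complex.exp (2 * M * w))
        rw [hnormE, hwre, Complex.norm_real, Real.norm_of_nonneg hp0.le, mul_neg] at this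
        exact this
      have hne : w ≠ w0 := by
        rintro h
        rw [h, hden0, norm_zero] at hlow
        linarith
      rw [hQne w hne, norm_div]
      calc ‖num w‖ / ‖den w‖ ≤ C' * Real.exp (-(M * R)) / (p - Real.exp (-(M * R)) ^ 2) := by
            have := hnumle w hwS
            rw [hwre, mul_neg] at this
            gcongr
        _ = _ := by ring
  have hnumd : DifferentiableOn ℂ num S := hG.sub (by fun_prop)
  have hQint : ∀ b : Bool, Integrable fun x : ℝ => Q (x + (raySign b * c : ℝ) * Complex.I) := by
    intro b
    simp only [hQline]
    exact hint hnumd C' hnumle b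
  have hlimline : ∀ b : Bool, Tendsto (fun R : ℝ => ∫ x : ℝ in -R..R,
      Q (x + (raySign b * c : ℝ) * Complex.I)) atTop
      (𝓝 (∫ x : ℝ, Q (x + (raySign b * c : ℝ) * Complex.I))) := fun b =>
    intervalIntegral_tendsto_integral (hQint b) tendsto_neg_atTop_atBot tendsto_id
  have hzero : (∫ x : ℝ, Q (x + (raySign true * c : ℝ) * Complex.I)) =
      ∫ x : ℝ, Q (x + (raySign false * c : ℝ) * Complex.I) := by
    have h1 := ((((hlimline false).sub (hlimline true)).add (hright.const_smul Complex.I)).sub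
      (hleft.const_smul Complex.I))
    have h3 := tendsto_nhds_unique (h1.congr hrect) tendsto_const_nhds
    rw [smul_zero, add_zero, sub_zero] at h3
    exact (sub_eq_zero.1 h3).symm
  have hCp : ∀ w ∈ S, ‖G w‖ ≤ C * Real.exp (M * w.re) := hC
  have hcomp : ∀ b : Bool, (∫ x : ℝ, Q (x + (raySign b * c : ℝ) * Complex.I)) =
      (∫ x : ℝ, G (x + (raySign b * c : ℝ) * Complex.I) / ((p + Real.exp (2 * M * x) : ℝ) : ℂ)) -
      G w0 * Complex.exp (-(M * w0)) * (raySign b * Complex.I) *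
        ((Real.pi / (2 * M * a ^ M) : ℝ) : ℂ) := by
    intro b
    have he : ∀ x : ℝ, Q (x + (raySign b * c : ℝ) * Complex.I) =
        G (x + (raySign b * c : ℝ) * Complex.I) / ((p + Real.exp (2 * M * x) : ℝ) : ℂ) -
        G w0 * Complex.exp (-(M * w0)) * (raySign b * Complex.I) *
          ((Real.exp (M * x) / (p + Real.exp (2 * M * x)) : ℝ) : ℂ) := by
      intro x
      rw [hQline]
      simp only [hnum]
      have h1 : (M : ℂ) * (x + (raySign b * c : ℝ) * Complex.I - w0) =
          -(M * w0) + (raySign b * (Real.pi / 2) : ℝ) * Complex.I + (M * x : ℝ) := by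
        rw [hc]; push_cast; field_simp; ring
      have h3 : Complex.exp ((raySign b * (Real.pi / 2) : ℝ) * Complex.I) =
          raySign b * Complex.I := by
        cases b
        · simp only [raySign, Bool.false_eq_true, if_false]
          push_cast
          rw [neg_one_mul, neg_mul, Complex.exp_neg, Complex.exp_pi_div_two_mul_I, Complex.inv_I]
          simp
        · simp only [raySign, if_true]
          push_cast
          rw [one_mul, Complex.exp_pi_div_two_mul_I, one_mul]
      rw [h1, Complex.exp_add, Complex.exp_add, h3, ← Complex.ofReal_exp, sub_div]
      push_cast; ring
    simp only [he]
    have hE : Integrable fun x : ℝ =>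
        ((Real.exp (M * x) / (p + Real.exp (2 * M * x)) : ℝ) : ℂ) :=
      (integrable_exp_div_add_exp hM hp0).ofReal
    rw [integral_sub (hint hG C hCp b) (hE.const_mul _),
      integral_const_mul, integral_complex_ofReal, hp, integral_exp_div_add_exp hM ha]
  have h := hzero
  rw [hcomp true, hcomp false] at h
  simp only [sub_div]
  rw [integral_sub (hint hG C hCp true) (hint hG C hCp false)]
  have hexp : Complex.exp (-(M * w0)) = ((a ^ M : ℝ) : ℂ)⁻¹ := by
    rw [Complex.exp_neg, Complex.exp_nat_mul, hw0, ← Complex.ofReal_exp, Real.exp_log ha]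
    push_cast; rfl
  rw [hexp] at h
  have hac : (a : ℂ) ≠ 0 := by exact_mod_cast ha.ne'
  simp only [raySign, if_true, Bool.false_eq_true, if_false] at h ⊢
  push_cast at h ⊢
  have h5 : (a : ℂ) ^ (2 * M) = a ^ M * a ^ M := by rw [two_mul, pow_add]
  rw [h5]
  linear_combination h


/-! ### The Laplace transform of the wave function -/

theorem image_exp_univ : Real.exp '' Set.univ = Set.Ioi 0 := by
  rw [Set.image_univ, Real.range_exp]

theorem integral_Ioi_eq_integral_exp {E : Type*} [NormedAddCommGroup E] [NormedSpace ℝ E]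
    (g : ℝ → E) : ∫ ξ in Set.Ioi (0 : ℝ), g ξ = ∫ x : ℝ, Real.exp x • g (Real.exp x) := by
  rw [← image_exp_univ, integral_image_eq_integral_abs_deriv_smul MeasurableSet.univ
    (fun x _ => (Real.hasDerivAt_exp x).hasDerivWithinAt) Real.exp_injective.injOn]
  simp [abs_of_pos (Real.exp_pos _)]

theorem integrableOn_Ioi_iff_integrable_exp {E : Type*} [NormedAddCommGroup E] [NormedSpace ℝ E]
    (g : ℝ → E) : IntegrableOn g (Set.Ioi 0) ↔ Integrable fun x : ℝ => Real.exp x • g (Real.exp x) := by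
  rw [← image_exp_univ, integrableOn_image_iff_integrableOn_abs_deriv_smul MeasurableSet.univ
    (fun x _ => (Real.hasDerivAt_exp x).hasDerivWithinAt) Real.exp_injective.injOn]
  simp [abs_of_pos (Real.exp_pos _), integrableOn_univ]

theorem integrableOn_pow_div_add_pow {M : ℕ} (hM : 0 < M) {p : ℝ} (hp : 0 < p) :
    IntegrableOn (fun ξ : ℝ => ξ ^ (M - 1) / (p + ξ ^ (2 * M))) (Set.Ioi 0) := by
  rw [integrableOn_Ioi_iff_integrable_exp]
  refine (integrable_exp_div_add_exp hM hp).congr (Eventually.of_forall fun x => ?_)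
  simp only [smul_eq_mul]
  rw [← mul_div_assoc, ← pow_succ', Nat.sub_add_cancel hM, ← Real.exp_nat_mul, ← Real.exp_nat_mul]
  push_cast; rfl

section

variable {ω ζ : ℂ}

theorem re_le_norm_mul_add (hω : 0 ≤ ω.re) {ξ : ℝ} (hξ : 0 ≤ ξ) : ζ.re ≤ ‖ω * ξ + ζ‖ := by
  refine le_trans ?_ (Complex.re_le_norm _)
  simp only [Complex.add_re, Complex.re_mul_ofReal]
  nlinarith

/-- `ξ = |ωξ|` is at most `|ωξ + ζ| + |ζ|`, and `|ωξ + ζ| ≥ Re ζ`. The power of `ξ` gained over the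
bound `1 / Re ζ` is what makes `ξ^M / ((p + ξ^{2M})(ωξ + ζ))` integrable at infinity when `M = 1`.
-/
theorem norm_div_mul_add_le (hω : 0 ≤ ω.re) (hn : ‖ω‖ = 1) (hζ : 0 < ζ.re) {ξ : ℝ} (hξ : 0 ≤ ξ) :
    ξ / ‖ω * ξ + ζ‖ ≤ 1 + ‖ζ‖ / ζ.re := by
  have h1 := re_le_norm_mul_add (ζ := ζ) hω hξ
  have h0 : 0 < ‖ω * ξ + ζ‖ := hζ.trans_le h1
  rw [div_le_iff₀ h0]
  have h3 : ξ ≤ ‖ω * ξ + ζ‖ + ‖ζ‖ := by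
    have := norm_sub_le (ω * ξ + ζ) ζ
    rw [add_sub_cancel_right, norm_mul, hn, one_mul, Complex.norm_real,
      Real.norm_of_nonneg hξ] at this
    exact this
  have h4 : ‖ζ‖ ≤ ‖ζ‖ / ζ.re * ‖ω * ξ + ζ‖ := by
    rw [div_mul_eq_mul_div, le_div_iff₀ hζ]
    gcongr
  linarith

/-- Fubini. Since `exp (-ωyξ)` may have modulus one, the integrability in `y` comes from `Re ζ > 0`.
-/
theorem laplace_rayIntegral {N k : ℕ} (h2 : 2 ≤ N) (hω : 0 ≤ ω.re) (hζ : 0 < ζ.re) {s : ℝ}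
    (hs : 0 < s) :
    IntegrableOn (fun y : ℝ => Complex.exp (-ζ * y) * rayIntegral N k ω s y) (Set.Ioi 0) ∧
    ∫ y in Set.Ioi (0 : ℝ), Complex.exp (-ζ * y) * rayIntegral N k ω s y =
      ∫ ξ in Set.Ioi (0 : ℝ), (ξ : ℂ) ^ k * Complex.exp (-s * ξ ^ N) / (ω * ξ + ζ) := by
  set F : ℝ → ℝ → ℂ := fun y ξ => Complex.exp (-ζ * y) * ((ξ : ℂ) ^ k *
    Complex.exp (-s * ξ ^ N) * Complex.exp (-ω * (|y| * ξ : ℝ))) with hF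
  have hint : Integrable (Function.uncurry F)
      ((volume.restrict (Set.Ioi 0)).prod (volume.restrict (Set.Ioi 0))) := by
    have h1 : IntegrableOn (fun y : ℝ => Real.exp (-ζ.re * y)) (Set.Ioi 0) :=
      integrableOn_exp_mul_Ioi (by linarith) 0
    refine Integrable.mono' (h1.mul_prod (integrableOn_pow_mul_exp k h2 hs)) ?_ ?_
    · refine Continuous.aestronglyMeasurable ?_
      simp only [hF, Function.uncurry_def]; fun_prop
    · rw [Measure.prod_restrict]
      refine (ae_restrict_mem (measurableSet_Ioi.prod measurableSet_Ioi)).mono fun q hq => ?_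
      simp only [hF, Function.uncurry_def, norm_mul (Complex.exp _)]
      have := norm_rayIntegrand_le (k := k) (N := N) hω s q.1 hq.2
      have h3 : ‖Complex.exp (-ζ * q.1)‖ = Real.exp (-ζ.re * q.1) := by
        rw [Complex.norm_exp]; simp
      rw [h3]
      gcongr
  have hL : ∀ y : ℝ, Complex.exp (-ζ * y) * rayIntegral N k ω s y =
      ∫ ξ in Set.Ioi (0 : ℝ), F y ξ := fun y => by
    rw [rayIntegral, ← integral_const_mul]
  refine ⟨?_, ?_⟩
  · simp only [hL]
    exact hint.integral_prod_left
  · simp only [hL]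
    rw [integral_integral_swap hint]
    refine setIntegral_congr_fun measurableSet_Ioi fun ξ hξ => ?_
    have hξ : 0 < ξ := hξ
    have hre : (-(ω * ξ + ζ)).re < 0 := by
      simp only [Complex.neg_re, Complex.add_re, Complex.re_mul_ofReal]
      nlinarith
    have h4 : ∀ y ∈ Set.Ioi (0 : ℝ), F y ξ = (ξ : ℂ) ^ k * Complex.exp (-s * ξ ^ N) *
        Complex.exp (-(ω * ξ + ζ) * y) := by
      intro y hy
      have hy : 0 < y := hy
      have : Complex.exp (-(ω * ξ + ζ) * y) = Complex.exp (-ζ * y) *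
          Complex.exp (-ω * (|y| * ξ : ℝ)) := by
        rw [← Complex.exp_add, abs_of_pos hy]; congr 1; push_cast; ring
      simp only [hF]
      rw [this]; ring
    rw [setIntegral_congr_fun measurableSet_Ioi h4, integral_const_mul,
      integral_exp_mul_complex_Ioi hre]
    rw [Complex.ofReal_zero, mul_zero, Complex.exp_zero, neg_div_neg_eq, mul_one_div]

/-- Fubini again: integrating `s` first produces `1 / (p + ξ^{2M})`, and `norm_div_mul_add_le`
supplies the absolute integrability. -/
theorem laplace_laplace_rayIntegral {M : ℕ} (hM : 0 < M) (hω : 0 ≤ ω.re) (hn : ‖ω‖ = 1)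
    (hζ : 0 < ζ.re) {p : ℝ} (hp : 0 < p) :
    IntegrableOn (fun s : ℝ => Complex.exp (-p * s) * ∫ ξ in Set.Ioi (0 : ℝ),
      (ξ : ℂ) ^ M * Complex.exp (-s * ξ ^ (2 * M)) / (ω * ξ + ζ)) (Set.Ioi 0) ∧
    IntegrableOn (fun ξ : ℝ => (ξ : ℂ) ^ M / (((p + ξ ^ (2 * M) : ℝ) : ℂ) * (ω * ξ + ζ)))
      (Set.Ioi 0) ∧
    ∫ s in Set.Ioi (0 : ℝ), Complex.exp (-p * s) * ∫ ξ in Set.Ioi (0 : ℝ),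
      (ξ : ℂ) ^ M * Complex.exp (-s * ξ ^ (2 * M)) / (ω * ξ + ζ) =
    ∫ ξ in Set.Ioi (0 : ℝ), (ξ : ℂ) ^ M / (((p + ξ ^ (2 * M) : ℝ) : ℂ) * (ω * ξ + ζ)) := by
  set F : ℝ → ℝ → ℂ := fun s ξ => Complex.exp (-p * s) * ((ξ : ℂ) ^ M *
    Complex.exp (-s * ξ ^ (2 * M)) / (ω * ξ + ζ)) with hF
  set K := 1 + ‖ζ‖ / ζ.re with hK
  have hne : ∀ ξ ∈ Set.Ioi (0 : ℝ), ω * ξ + ζ ≠ 0 := fun ξ hξ => by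
    rw [← norm_pos_iff]; exact hζ.trans_le (re_le_norm_mul_add hω (le_of_lt hξ))
  have hFe : ∀ s ξ : ℝ, F s ξ = ((Real.exp (-(p + ξ ^ (2 * M)) * s) : ℝ) : ℂ) *
      ((ξ : ℂ) ^ M / (ω * ξ + ζ)) := by
    intro s ξ
    have : ((Real.exp (-(p + ξ ^ (2 * M)) * s) : ℝ) : ℂ) = Complex.exp (-p * s) *
        Complex.exp (-s * ξ ^ (2 * M)) := by
      rw [← Complex.exp_add]; push_cast; congr 1; ring
    rw [this]; simp only [hF]; ring
  have hbd : ∀ ξ ∈ Set.Ioi (0 : ℝ), ‖(ξ : ℂ) ^ M / (ω * ξ + ζ)‖ ≤ K * ξ ^ (M - 1) := by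
    intro ξ hξ
    have hξ' : 0 < ξ := hξ
    rw [norm_div, norm_pow, Complex.norm_real, Real.norm_of_nonneg hξ'.le]
    have h1 := norm_div_mul_add_le hω hn hζ hξ'.le
    have h3 : ξ ^ M = ξ * ξ ^ (M - 1) := by rw [← pow_succ', Nat.sub_add_cancel hM]
    rw [h3, mul_div_right_comm]
    gcongr
  have hpos : ∀ ξ : ℝ, 0 < ξ → 0 < p + ξ ^ (2 * M) := fun ξ hξ => by positivity
  have hmeas : AEStronglyMeasurable (Function.uncurry F)
      ((volume.restrict (Set.Ioi 0)).prod (volume.restrict (Set.Ioi 0))) := by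
    rw [Measure.prod_restrict]
    refine ContinuousOn.aestronglyMeasurable ?_ (measurableSet_Ioi.prod measurableSet_Ioi)
    simp only [hF, Function.uncurry_def]
    refine ContinuousOn.mul (by fun_prop) (ContinuousOn.div (by fun_prop) (by fun_prop) ?_)
    intro q hq; exact hne _ hq.2
  have hnormint : ∀ ξ ∈ Set.Ioi (0 : ℝ), ∫ s in Set.Ioi (0 : ℝ), ‖F s ξ‖ =
      (p + ξ ^ (2 * M))⁻¹ * ‖(ξ : ℂ) ^ M / (ω * ξ + ζ)‖ := by
    intro ξ hξ
    simp only [hFe, norm_mul, Complex.norm_real, Real.norm_of_nonneg (Real.exp_nonneg _)]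
    rw [integral_mul_const, integral_exp_mul_Ioi (by linarith [hpos ξ hξ])]
    rw [mul_zero, Real.exp_zero, neg_div_neg_eq, one_div]
  have hint : Integrable (Function.uncurry F)
      ((volume.restrict (Set.Ioi 0)).prod (volume.restrict (Set.Ioi 0))) := by
    rw [integrable_prod_iff' hmeas]
    refine ⟨(ae_restrict_mem measurableSet_Ioi).mono fun ξ hξ => ?_, ?_⟩
    · simp only [Function.uncurry_apply_pair, hFe]
      exact (Integrable.ofReal (integrableOn_exp_mul_Ioi
        (by linarith [hpos ξ hξ]) 0)).mul_const _
    · refine Integrable.mono' ((integrableOn_pow_div_add_pow hM hp).const_mul K)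
        hmeas.norm.prod_swap.integral_prod_right' ?_
      refine (ae_restrict_mem measurableSet_Ioi).mono fun ξ hξ => ?_
      have h1 := hnormint ξ hξ
      have h3 := hpos ξ hξ
      simp only [Function.uncurry_apply_pair]
      rw [h1, Real.norm_of_nonneg (by positivity)]
      calc (p + ξ ^ (2 * M))⁻¹ * ‖(ξ : ℂ) ^ M / (ω * ξ + ζ)‖
          ≤ (p + ξ ^ (2 * M))⁻¹ * (K * ξ ^ (M - 1)) :=
            mul_le_mul_of_nonneg_left (hbd ξ hξ) (inv_nonneg.2 h3.le)
        _ = _ := by ring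
  have hL : ∀ s : ℝ, Complex.exp (-p * s) * ∫ ξ in Set.Ioi (0 : ℝ),
      (ξ : ℂ) ^ M * Complex.exp (-s * ξ ^ (2 * M)) / (ω * ξ + ζ) =
      ∫ ξ in Set.Ioi (0 : ℝ), F s ξ := fun s => by rw [← integral_const_mul]
  have hR : ∀ ξ ∈ Set.Ioi (0 : ℝ), ∫ s in Set.Ioi (0 : ℝ), F s ξ =
      (ξ : ℂ) ^ M / (((p + ξ ^ (2 * M) : ℝ) : ℂ) * (ω * ξ + ζ)) := by
    intro ξ hξ
    simp only [hFe]
    rw [integral_mul_const, integral_complex_ofReal, integral_exp_mul_Ioi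
      (by linarith [hpos ξ hξ])]
    have h3 : ((p + ξ ^ (2 * M) : ℝ) : ℂ) ≠ 0 := by exact_mod_cast (hpos ξ hξ).ne'
    have h4 := hne ξ hξ
    rw [mul_zero, Real.exp_zero, neg_div_neg_eq, one_div, Complex.ofReal_inv]
    field_simp
  refine ⟨?_, ?_, ?_⟩
  · simp only [hL]; exact hint.integral_prod_left
  · have := hint.integral_prod_right
    exact (integrableOn_congr_fun (fun ξ hξ => hR ξ hξ) measurableSet_Ioi).1 this
  · simp only [hL]
    rw [integral_integral_swap hint]
    exact setIntegral_congr_fun measurableSet_Ioi hR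

end

/-- The substitution `ξ = e^x` places the rays `θ e^{±iπ/N}` on the two edges of the strip `|Im w| ≤
π/N`, with `G(w) = e^{(M+1)w} / (θ e^w + ζ)`. This `G` is holomorphic on the strip, because `θ e^w`
stays in the closed right half-plane while `Re ζ > 0`. The phases in `rayCoeff` are exactly those
that turn the sum over the two rays into a difference of edge integrals. -/
theorem sum_raySign_integral {N : ℕ} (hN : Even N) (h2 : 2 ≤ N) {a : ℝ} (ha : 0 < a) {ζ : ℂ}
    (hζ : 0 < ζ.re) {θ : ℂ} (hθ : θ ∈ rootsJ N) :
    ∑ b : Bool, rayCoeff N (θ, b) * ∫ ξ in Set.Ioi (0 : ℝ), (ξ : ℂ) ^ (rootsJ N).card /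
        (((a ^ N + ξ ^ N : ℝ) : ℂ) * (rayDir N (θ, b) * ξ + ζ)) =
      -(2 * Real.pi * Complex.I / N) * (coeff (rootsJ N) θ * θ / (θ * a + ζ)) *
        (a ^ (rootsJ N).card * a / a ^ N) := by
  obtain ⟨M, hMdef⟩ : ∃ M, M = (rootsJ N).card := ⟨_, rfl⟩
  have hNM : N = 2 * M := by rw [hMdef, two_mul_card_rootsJ hN h2]
  have hM : 0 < M := by omega
  have hMc : (M : ℂ) ≠ 0 := by exact_mod_cast hM.ne'
  set c : ℝ := Real.pi / (2 * M) with hc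
  have hcN : Real.pi / N = c := by rw [hc, hNM]; push_cast; ring
  set G : ℂ → ℂ := fun w => Complex.exp ((M + 1) * w) / (θ * Complex.exp w + ζ) with hG
  have hre : ∀ w : ℂ, |w.im| ≤ c → 0 ≤ (θ * Complex.exp (w.im * Complex.I)).re := fun w hw =>
    re_rootsJ_mul_exp hN h2 hθ (by rwa [hcN])
  have hexp : ∀ w : ℂ, θ * Complex.exp w = θ * Complex.exp (w.im * Complex.I) *
      ((Real.exp w.re : ℝ) : ℂ) := by
    intro w
    rw [mul_assoc, Complex.ofReal_exp, ← Complex.exp_add, add_comm, Complex.re_add_im]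
  have hnorm : ∀ w : ℂ, ‖θ * Complex.exp (w.im * Complex.I)‖ = 1 := by
    intro w
    rw [norm_mul, Complex.norm_exp_ofReal_mul_I, mul_one]
    exact norm_of_pow_eq_kappa h2 ((mem_rootsJ h2).1 hθ).1
  have hGd : DifferentiableOn ℂ G {w | |w.im| ≤ Real.pi / (2 * M)} := by
    refine DifferentiableOn.div (by fun_prop) (by fun_prop) fun w hw => ?_
    rw [hexp, ← norm_pos_iff]
    exact hζ.trans_le (re_le_norm_mul_add (hre w hw) (Real.exp_nonneg _))
  have hGb : ∀ w : ℂ, |w.im| ≤ Real.pi / (2 * M) →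
      ‖G w‖ ≤ (1 + ‖ζ‖ / ζ.re) * Real.exp (M * w.re) := by
    intro w hw
    have h1 := norm_div_mul_add_le (hre w hw) (hnorm w) hζ (Real.exp_nonneg w.re)
    simp only [hG]
    rw [norm_div, hexp, Complex.norm_exp]
    have h3 : ((M + 1 : ℂ) * w).re = w.re + M * w.re := by
      have : (M + 1 : ℂ) = ((M + 1 : ℝ) : ℂ) := by push_cast; rfl
      rw [this, Complex.re_ofReal_mul]; ring
    rw [h3, Real.exp_add, mul_div_right_comm]
    gcongr
  have hc0 : 0 ≤ c := by positivity
  have hline : ∀ (x : ℝ) (b : Bool), |(x + (raySign b * c : ℝ) * Complex.I : ℂ).im| ≤ c := by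
    intro x b
    cases b <;> simp [raySign, abs_of_nonneg hc0]
  have key := integral_strip_boundary hM ha hGd hGb
  have hI : ∀ b : Bool, rayCoeff N (θ, b) * ∫ ξ in Set.Ioi (0 : ℝ), (ξ : ℂ) ^ (rootsJ N).card /
        (((a ^ N + ξ ^ N : ℝ) : ℂ) * (rayDir N (θ, b) * ξ + ζ)) =
      -(coeff (rootsJ N) θ * θ) * raySign b * ∫ x : ℝ, G (x + (raySign b * c : ℝ) * Complex.I) /
        ((a ^ (2 * M) + Real.exp (2 * M * x) : ℝ) : ℂ) := by
    intro b
    rw [integral_Ioi_eq_integral_exp, ← integral_const_mul, ← integral_const_mul]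
    refine integral_congr_ae (Eventually.of_forall fun x => ?_)
    have e1 : Complex.exp ((raySign b * (Real.pi / 2) : ℝ) * Complex.I) =
        raySign b * Complex.I := by
      cases b
      · simp only [raySign, Bool.false_eq_true, if_false]
        push_cast
        rw [neg_one_mul, neg_mul, Complex.exp_neg, Complex.exp_pi_div_two_mul_I, Complex.inv_I]
        simp
      · simp only [raySign, if_true]
        push_cast
        rw [one_mul, Complex.exp_pi_div_two_mul_I, one_mul]
    have e2 : (raySign b : ℂ) * raySign b = 1 := by cases b <;> simp [raySign]
    set v : ℂ := Complex.exp ((raySign b * c : ℝ) * Complex.I) with hv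
    have e3 : Complex.exp ((-(raySign b * (((M : ℝ) - 1) * c)) : ℝ) * Complex.I) *
        (raySign b * Complex.I) = v := by
      rw [← e1, hv, ← Complex.exp_add]
      congr 1
      rw [hc]; push_cast; field_simp; ring
    have e4 : Complex.exp ((M + 1) * (x + (raySign b * c : ℝ) * Complex.I)) =
        ((Real.exp x : ℝ) : ℂ) ^ (M + 1) * (raySign b * Complex.I) * v := by
      rw [← e1, hv, Complex.ofReal_exp, ← Complex.exp_nat_mul, ← Complex.exp_add,
        ← Complex.exp_add]
      congr 1
      rw [hc]; push_cast; field_simp; ring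
    have e5 : Complex.exp (x + (raySign b * c : ℝ) * Complex.I) = Real.exp x * v := by
      rw [hv, Complex.ofReal_exp, ← Complex.exp_add]
    have e6 : Real.exp (2 * M * x) = Real.exp x ^ N := by
      rw [← Real.exp_nat_mul, hNM]; push_cast; rfl
    have e7 : Complex.exp ((-(raySign b * (((M : ℝ) - 1) * c)) : ℝ) * Complex.I) =
        -(raySign b * Complex.I) * v := by
      rw [← e3]
      linear_combination (-(Complex.exp ((-(raySign b * (((M : ℝ) - 1) * c)) : ℝ) * Complex.I))) *
        e2 + (Complex.exp ((-(raySign b * (((M : ℝ) - 1) * c)) : ℝ) * Complex.I)) *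
          (raySign b * raySign b) * (Complex.I_mul_I)
    simp only [hG, rayCoeff, rayDir, ← hMdef, hcN, e4, e5, e6, e7, ← hNM, ← hv,
      Complex.real_smul]
    rw [pow_succ]
    have e8 : θ * v * (Real.exp x : ℝ) + ζ = θ * ((Real.exp x : ℝ) * v) + ζ := by ring
    rw [e8]
    generalize θ * ((Real.exp x : ℝ) * v) + ζ = D
    generalize ((a ^ N + Real.exp x ^ N : ℝ) : ℂ) = E
    generalize ((Real.exp x : ℝ) : ℂ) = X
    rw [mul_comm E D, ← div_div]
    ring_nf
    try simp only [Complex.I_sq]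
    try ring_nf
  rw [Fintype.sum_bool, hI, hI]
  have hs1 : raySign true = 1 := by simp [raySign]
  have hs2 : raySign false = -1 := by simp [raySign]
  have hint : ∀ b : Bool, Integrable fun x : ℝ => G (x + (raySign b * c : ℝ) * Complex.I) /
        ((a ^ (2 * M) + Real.exp (2 * M * x) : ℝ) : ℂ) := by
    intro b
    refine Integrable.mono' ((integrable_exp_div_add_exp hM (p := a ^ (2 * M))
      (by positivity)).const_mul (1 + ‖ζ‖ / ζ.re)) ?_ ?_
    · refine (Continuous.div ?_ (by fun_prop) fun x => ?_).aestronglyMeasurable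
      · refine hGd.continuousOn.comp_continuous (by fun_prop) fun x => ?_
        exact hline x b
      · have : 0 < a ^ (2 * M) + Real.exp (2 * M * x) := by positivity
        exact_mod_cast this.ne'
    · refine Eventually.of_forall fun x => ?_
      have h3 : 0 < a ^ (2 * M) + Real.exp (2 * M * x) := by positivity
      rw [norm_div, Complex.norm_real, Real.norm_of_nonneg h3.le]
      refine (div_le_div_of_nonneg_right (c := a ^ (2 * M) + Real.exp (2 * M * x)) ?_
        h3.le).trans_eq (mul_div_assoc _ _ _)
      have h4 := hGb (x + (raySign b * c : ℝ) * Complex.I) (hline x b)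
      simpa using h4
  simp only [sub_div] at key
  rw [integral_sub (hint true) (hint false)] at key
  have hGa : G (Real.log a) = a ^ M * a / (θ * a + ζ) := by
    simp only [hG]
    have : Complex.exp (Real.log a) = a := by rw [← Complex.ofReal_exp, Real.exp_log ha]
    rw [add_mul, one_mul, Complex.exp_add, Complex.exp_nat_mul, this]
  rw [hGa] at key
  rw [← hMdef]
  have hNc : (N : ℂ) = 2 * M := by rw [hNM]; push_cast; rfl
  rw [hNc, hs1, hs2]
  rw [hs1, hs2] at key
  have hpow : (a : ℂ) ^ N = a ^ (2 * M) := by rw [← hNM]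
  rw [hpow]
  push_cast at key ⊢
  linear_combination (-(coeff (rootsJ N) θ * θ)) * key


/-- The quadrant `s > 0`, `y > 0`. -/
def quadrant : Set (ℝ × ℝ) := Set.Ioi 0 ×ˢ Set.Ioi 0

/-! ### Continuity, integrability and double Laplace transform of the wave function on the quadrant.
-/

theorem measurableSet_quadrant : MeasurableSet quadrant := measurableSet_Ioi.prod measurableSet_Ioi

theorem continuousOn_wave {N : ℕ} (hN : Even N) (h2 : 2 ≤ N) :
    ContinuousOn (fun q : ℝ × ℝ => wave N q.1 q.2) (Set.Ioi 0 ×ˢ Set.univ) := by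
  have h : ContinuousOn (fun q : ℝ × ℝ => ((q.1 ^ (-(((rootsJ N).card : ℝ) + 1) / N) : ℝ) : ℂ) *
      wave N 1 (q.2 * q.1 ^ (-(1 : ℝ) / N))) (Set.Ioi 0 ×ˢ Set.univ) := by
    have hp : ∀ r : ℝ, ContinuousOn (fun q : ℝ × ℝ => q.1 ^ r) (Set.Ioi 0 ×ˢ Set.univ) := by
      intro r q hq
      have hq1 : 0 < q.1 := hq.1
      exact (continuousAt_fst.rpow_const (Or.inl hq1.ne')).continuousWithinAt
    refine (Complex.continuous_ofReal.comp_continuousOn (hp _)).mul ?_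
    exact (continuous_wave_one hN h2).comp_continuousOn (continuousOn_snd.mul (hp _))
  exact h.congr fun q hq => wave_scaling hN h2 hq.1 q.2

theorem integrable_wave_one {N : ℕ} (hN : Even N) (h2 : 2 ≤ N) : Integrable (wave N 1) := by
  obtain ⟨C, -, h⟩ := exists_norm_wave_le hN h2
  refine Integrable.mono' (integrable_inv_one_add_sq.const_mul C)
    (continuous_wave_one hN h2).aestronglyMeasurable (Eventually.of_forall fun y => ?_)
  rw [← div_eq_mul_inv]; exact h y

theorem card_div_eq_half {N : ℕ} (hN : Even N) (h2 : 2 ≤ N) :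
    ((rootsJ N).card : ℝ) / N = 1 / 2 := by
  have h : (2 : ℝ) * (rootsJ N).card = N := by exact_mod_cast two_mul_card_rootsJ hN h2
  have hN0 : (0 : ℝ) < N := by exact_mod_cast (by omega : 0 < N)
  rw [div_eq_div_iff hN0.ne' (by norm_num)]; linarith

/-- By scaling the exponent of `s` is `-(M+1)/N + 1/N = -1/2`, which is integrable at `0`. -/
theorem integral_norm_wave {N : ℕ} (hN : Even N) (h2 : 2 ≤ N) {s : ℝ} (hs : 0 < s) :
    IntegrableOn (wave N s) (Set.Ioi 0) ∧
    ∫ y in Set.Ioi (0 : ℝ), ‖wave N s y‖ =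
      s ^ (-(1 : ℝ) / 2) * ∫ y in Set.Ioi (0 : ℝ), ‖wave N 1 y‖ := by
  have hb : 0 < s ^ (-(1 : ℝ) / N) := Real.rpow_pos_of_pos hs _
  have he : wave N s = fun y => ((s ^ (-(((rootsJ N).card : ℝ) + 1) / N) : ℝ) : ℂ) *
      wave N 1 (y * s ^ (-(1 : ℝ) / N)) := funext fun y => wave_scaling hN h2 hs y
  constructor
  · rw [he]
    exact (((integrable_wave_one hN h2).comp_mul_right' hb.ne').const_mul _).integrableOn
  · rw [he]
    simp only [norm_mul, Complex.norm_real]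
    rw [integral_const_mul, integral_comp_mul_right_Ioi (fun y => ‖wave N 1 y‖) 0 hb, zero_mul,
      smul_eq_mul, ← mul_assoc, Real.norm_of_nonneg (Real.rpow_nonneg hs.le _),
      ← Real.rpow_neg hs.le, ← Real.rpow_add hs]
    congr 2
    have := card_div_eq_half hN h2
    rw [neg_div, add_div, this, neg_div]; ring

theorem integrableOn_exp_mul_wave {N : ℕ} (hN : Even N) (h2 : 2 ≤ N) {p : ℝ} (hp : 0 < p) :
    IntegrableOn (fun q : ℝ × ℝ => ((Real.exp (-p * q.1) : ℝ) : ℂ) * wave N q.1 q.2)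
      quadrant := by
  have hm : AEStronglyMeasurable (fun q : ℝ × ℝ => ((Real.exp (-p * q.1) : ℝ) : ℂ) *
      wave N q.1 q.2) ((volume.restrict (Set.Ioi 0)).prod (volume.restrict (Set.Ioi 0))) := by
    rw [Measure.prod_restrict]
    refine ContinuousOn.aestronglyMeasurable ?_ measurableSet_quadrant
    refine ContinuousOn.mul (by fun_prop) ((continuousOn_wave hN h2).mono ?_)
    exact Set.prod_mono_right (Set.subset_univ _)
  rw [IntegrableOn, quadrant, Measure.volume_eq_prod, ← Measure.prod_restrict,
    integrable_prod_iff hm]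
  constructor
  · refine (ae_restrict_mem measurableSet_Ioi).mono fun s hs => ?_
    exact (integral_norm_wave hN h2 hs).1.const_mul ((Real.exp (-p * s) : ℝ) : ℂ)
  · have h1 := integrableOn_rpow_mul_exp_neg_mul_rpow (s := -(1 : ℝ) / 2) (p := 1) (b := p)
      (by norm_num) one_pos hp
    refine (integrableOn_congr_fun (fun s hs => ?_) measurableSet_Ioi).1
      (h1.mul_const (∫ y in Set.Ioi (0 : ℝ), ‖wave N 1 y‖))
    simp only [norm_mul, Complex.norm_real, Real.norm_of_nonneg (Real.exp_nonneg _)]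
    rw [integral_const_mul, (integral_norm_wave hN h2 hs).2, Real.rpow_one]
    ring

theorem integrableOn_cexp_mul_wave {N : ℕ} (hN : Even N) (h2 : 2 ≤ N) {p : ℝ} (hp : 0 < p) {ζ : ℂ}
    (hζ : 0 ≤ ζ.re) :
    IntegrableOn (fun q : ℝ × ℝ => Complex.exp (-p * q.1 - ζ * q.2) * wave N q.1 q.2)
      quadrant := by
  have h := integrableOn_exp_mul_wave hN h2 hp
  have he : (fun q : ℝ × ℝ => Complex.exp (-p * q.1 - ζ * q.2) * wave N q.1 q.2) = fun q =>
      Complex.exp (-ζ * q.2) * (((Real.exp (-p * q.1) : ℝ) : ℂ) * wave N q.1 q.2) := by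
    ext q
    rw [← mul_assoc, Complex.ofReal_exp, ← Complex.exp_add]
    congr 2; push_cast; ring
  rw [he]
  refine h.bdd_mul (c := 1) (Continuous.aestronglyMeasurable (by fun_prop)) ?_
  exact (ae_restrict_mem measurableSet_quadrant).mono fun q hq =>
    norm_exp_neg_mul_le_one hζ (le_of_lt hq.2)

/-- The rays are summed in pairs: each `θ` contributes a residue, and `sum_rootsJ_coeff_mul_div`
adds these up. The constant `Ni/(2π)` in `wave` cancels the factor `-2πi/N` of the residue. -/
theorem wave_transform_of_re_pos {N : ℕ} (hN : Even N) (h2 : 2 ≤ N) {a : ℝ} (ha : 0 < a) {ζ : ℂ}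
    (hζ : 0 < ζ.re) :
    ∫ q in quadrant, Complex.exp (-(a ^ N : ℝ) * q.1 - ζ * q.2) * wave N q.1 q.2 =
      ∏ θ ∈ rootsJ N, (a + ζ * θ)⁻¹ := by
  have hp : 0 < a ^ N := by positivity
  have hint := integrableOn_cexp_mul_wave hN h2 hp hζ.le
  rw [quadrant] at hint ⊢
  rw [Measure.volume_eq_prod] at hint ⊢
  rw [setIntegral_prod _ hint]
  set M := (rootsJ N).card with hM
  have hNM : 2 * M = N := two_mul_card_rootsJ hN h2
  have hM0 : 0 < M := card_rootsJ_pos hN h2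
  set c0 : ℂ := N * Complex.I / (2 * Real.pi) with hc0
  set L : ℂ × Bool → ℝ → ℂ := fun p s => ∫ ξ in Set.Ioi (0 : ℝ), (ξ : ℂ) ^ M *
    Complex.exp (-s * ξ ^ N) / (rayDir N p * ξ + ζ) with hL
  have h1 : ∀ s ∈ Set.Ioi (0 : ℝ), ∫ y in Set.Ioi (0 : ℝ),
      Complex.exp (-(a ^ N : ℝ) * s - ζ * y) * wave N s y =
      c0 * ∑ p ∈ rays N, rayCoeff N p * (Complex.exp (-(a ^ N : ℝ) * s) * L p s) := by
    intro s hs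
    have h3 : ∀ y : ℝ, Complex.exp (-(a ^ N : ℝ) * s - ζ * y) * wave N s y =
        c0 * ∑ p ∈ rays N, (rayCoeff N p * Complex.exp (-(a ^ N : ℝ) * s)) *
          (Complex.exp (-ζ * y) * rayIntegral N M (rayDir N p) s y) := by
      intro y
      rw [wave_eq_sum hN h2 hs, sub_eq_add_neg, Complex.exp_add, ← neg_mul, mul_left_comm,
        Finset.mul_sum]
      congr 1
      exact Finset.sum_congr rfl fun p _ => by ring
    simp only [h3]
    rw [integral_const_mul, integral_finsetSum]
    · congr 1
      refine Finset.sum_congr rfl fun p hp => ?_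
      rw [integral_const_mul, (laplace_rayIntegral h2 (re_rayDir_nonneg hN h2 hp) hζ hs).2,
        mul_assoc]
    · intro p hp
      exact (laplace_rayIntegral h2 (re_rayDir_nonneg hN h2 hp) hζ hs).1.const_mul _
  have hLL := fun p (hp' : p ∈ rays N) => laplace_laplace_rayIntegral hM0
    (re_rayDir_nonneg hN h2 hp') (norm_rayDir h2 hp') hζ hp
  rw [hNM] at hLL
  rw [setIntegral_congr_fun measurableSet_Ioi h1, integral_const_mul, integral_finsetSum]
  · have h4 : ∀ p ∈ rays N, ∫ s in Set.Ioi (0 : ℝ), rayCoeff N p *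
        (Complex.exp (-(a ^ N : ℝ) * s) * L p s) = rayCoeff N p * ∫ ξ in Set.Ioi (0 : ℝ),
        (ξ : ℂ) ^ M / (((a ^ N + ξ ^ N : ℝ) : ℂ) * (rayDir N p * ξ + ζ)) := by
      intro p hp'
      rw [integral_const_mul, ← (hLL p hp').2.2]
    rw [Finset.sum_congr rfl h4, rays, Finset.sum_product,
      Finset.sum_congr rfl fun θ hθ => sum_raySign_integral hN h2 ha hζ hθ, ← Finset.sum_mul,
      ← Finset.mul_sum]
    have hac : (a : ℂ) ≠ 0 := by exact_mod_cast ha.ne'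
    rw [sum_rootsJ_coeff_mul_div hN h2 hac]
    · have hNc : (N : ℂ) ≠ 0 := by exact_mod_cast (by omega : N ≠ 0)
      have hpi : (Real.pi : ℂ) ≠ 0 := by exact_mod_cast Real.pi_ne_zero
      have h5 : (a : ℂ) ^ N = a ^ (M - 1) * (a ^ M * a) := by
        rw [← pow_succ, ← pow_add]; congr 1; omega
      rw [← hM, h5, hc0]
      generalize ∏ θ ∈ rootsJ N, ((a : ℂ) + ζ * θ)⁻¹ = P
      field_simp
      rw [Complex.I_sq]; ring
    · intro θ hθ
      have hre := ((mem_rootsJ h2).1 hθ).2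
      rw [← norm_pos_iff]
      exact hζ.trans_le (re_le_norm_mul_add hre.le ha.le)
  · intro p hp'
    exact (hLL p hp').1.const_mul _

/-- The Laplace transform of `u`. -/
theorem wave_transform {N : ℕ} (hN : Even N) (h2 : 2 ≤ N) {a : ℝ} (ha : 0 < a) {ζ : ℂ}
    (hζ : 0 ≤ ζ.re) :
    ∫ q in quadrant, Complex.exp (-(a ^ N : ℝ) * q.1 - ζ * q.2) * wave N q.1 q.2 =
      ∏ θ ∈ rootsJ N, (a + ζ * θ)⁻¹ := by
  have hp : 0 < a ^ N := by positivity
  -- The boundary case `Re ζ = 0`, the one needed for Fourier transforms, is reached from inside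
  -- through `ζ + 1/(n+1)`.
  set e : ℕ → ℂ := fun n => ((1 / ((n : ℝ) + 1) : ℝ) : ℂ) with he
  have he0 : Tendsto e atTop (𝓝 0) := by
    have := (Complex.continuous_ofReal.tendsto 0).comp tendsto_one_div_add_atTop_nhds_zero_nat
    simpa [Function.comp_def, he] using this
  have hze : Tendsto (fun n => ζ + e n) atTop (𝓝 ζ) := by simpa using he0.const_add ζ
  have hre : ∀ n, 0 < (ζ + e n).re := fun n => by
    simp only [he, Complex.add_re, Complex.ofReal_re]; positivity
  have hR : Tendsto (fun n => ∏ θ ∈ rootsJ N, (a + (ζ + e n) * θ)⁻¹) atTop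
      (𝓝 (∏ θ ∈ rootsJ N, (a + ζ * θ)⁻¹)) := by
    refine tendsto_finsetProd _ fun θ hθ => ?_
    refine Tendsto.inv₀ ((hze.mul_const θ).const_add _) ?_
    have hθ' := (mem_rootsJ h2).1 (inv_mem_rootsJ h2 hθ)
    have hθ0 : θ ≠ 0 := by
      rintro rfl; have := ((mem_rootsJ h2).1 hθ).2; simp at this
    -- A zero of `a + ζθ` would force `Re ζ = -a Re θ⁻¹ < 0`.
    intro h0
    have h3 : a * θ⁻¹ + ζ = 0 := by
      have : a * θ⁻¹ + ζ = (a + ζ * θ) * θ⁻¹ := by field_simp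
      rw [this, h0, zero_mul]
    have h4 := congrArg Complex.re h3
    simp only [Complex.add_re, Complex.re_ofReal_mul, Complex.zero_re] at h4
    have := mul_pos ha hθ'.2
    linarith
  have hLt : Tendsto (fun n => ∫ q in quadrant, Complex.exp (-(a ^ N : ℝ) * q.1 - (ζ + e n) * q.2) *
      wave N q.1 q.2) atTop (𝓝 (∫ q in quadrant, Complex.exp (-(a ^ N : ℝ) * q.1 - ζ * q.2) *
      wave N q.1 q.2)) := by
    refine tendsto_integral_of_dominated_convergence
      (fun q => ‖((Real.exp (-(a ^ N) * q.1) : ℝ) : ℂ) * wave N q.1 q.2‖)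
      (fun n => (integrableOn_cexp_mul_wave hN h2 hp (hre n).le).aestronglyMeasurable)
      (integrableOn_exp_mul_wave hN h2 hp).norm (fun n => ?_) ?_
    · refine (ae_restrict_mem measurableSet_quadrant).mono fun q hq => ?_
      rw [norm_mul, norm_mul]
      refine mul_le_mul_of_nonneg_right ?_ (norm_nonneg _)
      rw [Complex.norm_real, Real.norm_of_nonneg (Real.exp_nonneg _), Complex.norm_exp,
        Real.exp_le_exp]
      have hq2 : 0 < q.2 := hq.2
      have := hre n
      simp only [Complex.sub_re, Complex.re_mul_ofReal, ← Complex.ofReal_neg, Complex.ofReal_re]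
      nlinarith
    · refine Eventually.of_forall fun q => ?_
      refine Tendsto.mul_const _ ((Complex.continuous_exp.tendsto _).comp ?_)
      exact (hze.mul_const _).const_sub _
  refine tendsto_nhds_unique hLt (hR.congr fun n => ?_)
  rw [wave_transform_of_re_pos hN h2 ha (hre n)]


/-! ### Functions are determined by their integrals against a separating algebra -/

/-- The star subalgebra spanned by a submonoid which is stable under `star`. -/
def spanStarSubalgebra {F : Type*} [Semiring F] [StarRing F] [Algebra ℂ F] [StarModule ℂ F]
    (S : Submonoid F) (hS : ∀ f ∈ S, star f ∈ S) : StarSubalgebra ℂ F where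
  carrier := Submodule.span ℂ (S : Set F)
  mul_mem' {a b} ha hb := by
    have h := Submodule.mul_mem_mul (SetLike.mem_coe.1 ha) (SetLike.mem_coe.1 hb)
    rwa [Submodule.span_mul_span, Submonoid.coe_mul_self_eq] at h
  add_mem' ha hb := Submodule.add_mem _ ha hb
  algebraMap_mem' r := by
    rw [Algebra.algebraMap_eq_smul_one]
    exact Submodule.smul_mem _ _ (Submodule.subset_span S.one_mem)
  star_mem' {a} ha := by
    induction ha using Submodule.span_induction with
    | mem x hx => exact Submodule.subset_span (hS x hx)
    | zero => rw [star_zero]; exact Submodule.zero_mem _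
    | add x y _ _ hx hy => rw [star_add]; exact Submodule.add_mem _ hx hy
    | smul c x _ hx => rw [star_smul]; exact Submodule.smul_mem _ _ hx

-- The positive and negative parts of `D` are densities of two finite measures. These agree on the
-- star algebra spanned by `S`, which separates points, hence they coincide, and so do the two parts
-- almost everywhere.
open scoped BoundedContinuousFunction in
theorem ae_eq_zero_of_forall_integral_eq_zero {E : Type*} [MeasurableSpace E]
    [PseudoEMetricSpace E] [BorelSpace E] [CompleteSpace E] [SecondCountableTopology E]
    {μ : Measure E} {D : E → ℝ} (hD : Integrable D μ) (S : Submonoid (E →ᵇ ℂ))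
    (hS : ∀ f ∈ S, star f ∈ S) (hsep : ∀ x y : E, x ≠ y → ∃ f ∈ S, f x ≠ f y)
    (h0 : ∀ f ∈ S, ∫ x, f x * (D x : ℂ) ∂μ = 0) : D =ᵐ[μ] 0 := by
  set A := spanStarSubalgebra S hS with hA
  have hpos := hD.pos_part
  have hneg := hD.neg_part
  have hpl : ∫⁻ x, ENNReal.ofReal (max (D x) 0) ∂μ ≠ ⊤ := hpos.lintegral_lt_top.ne
  have hnl : ∫⁻ x, ENNReal.ofReal (max (-D x) 0) ∂μ ≠ ⊤ := hneg.lintegral_lt_top.ne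
  have hpm : AEMeasurable (fun x => ENNReal.ofReal (max (D x) 0)) μ := hpos.aemeasurable.ennreal_ofReal
  have hnm : AEMeasurable (fun x => ENNReal.ofReal (max (-D x) 0)) μ :=
    hneg.aemeasurable.ennreal_ofReal
  have : IsFiniteMeasure (μ.withDensity fun x => ENNReal.ofReal (max (D x) 0)) :=
    isFiniteMeasure_withDensity hpl
  have : IsFiniteMeasure (μ.withDensity fun x => ENNReal.ofReal (max (-D x) 0)) :=
    isFiniteMeasure_withDensity hnl
  have hspan : ∀ g ∈ A, ∫ x, g x * (D x : ℂ) ∂μ = 0 := by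
    intro g hg
    have hg' : g ∈ Submodule.span ℂ (S : Set (E →ᵇ ℂ)) := hg
    have hi : ∀ f : E →ᵇ ℂ, Integrable (fun x => f x * (D x : ℂ)) μ := fun f =>
      hD.ofReal.bdd_mul (c := ‖f‖) f.continuous.aestronglyMeasurable
        (Eventually.of_forall f.norm_coe_le_norm)
    induction hg' using Submodule.span_induction with
    | mem x hx => exact h0 x hx
    | zero => simp
    | add x y hx hy hx' hy' =>
      simp only [BoundedContinuousFunction.add_apply, add_mul]
      rw [integral_add (hi x) (hi y), hx' hx, hy' hy, add_zero]
    | smul c x hx hx' =>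
      simp only [BoundedContinuousFunction.coe_smul, smul_eq_mul, mul_assoc]
      rw [integral_const_mul, hx' hx, mul_zero]
  have hPP : (μ.withDensity fun x => ENNReal.ofReal (max (D x) 0)) =
      μ.withDensity fun x => ENNReal.ofReal (max (-D x) 0) := by
    refine ext_of_forall_mem_subalgebra_integral_eq_of_pseudoEMetric_complete_countable (A := A)
      ?_ ?_
    · intro x y hxy
      obtain ⟨f, hf, hne⟩ := hsep x y hxy
      refine ⟨f, ⟨BoundedContinuousFunction.toContinuousMapStarₐ ℂ f, ?_, rfl⟩, hne⟩
      exact ⟨f, Submodule.subset_span hf, rfl⟩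
    · intro g hg
      rw [integral_withDensity_eq_integral_toReal_smul₀ hpm
        (Eventually.of_forall fun _ => ENNReal.ofReal_lt_top),
        integral_withDensity_eq_integral_toReal_smul₀ hnm
        (Eventually.of_forall fun _ => ENNReal.ofReal_lt_top)]
      have hb : ∀ {D' : E → ℝ}, Integrable D' μ → Integrable (fun x => D' x • g x) μ := by
        intro D' hD'
        refine (hD'.ofReal.bdd_mul (c := ‖g‖) g.continuous.aestronglyMeasurable
          (Eventually.of_forall g.norm_coe_le_norm)).congr (Eventually.of_forall fun x => ?_)
        simp [mul_comm]
      have h3 : ∀ r : ℝ, (ENNReal.ofReal (max r 0)).toReal = max r 0 := fun r =>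
        ENNReal.toReal_ofReal (le_max_right _ _)
      simp only [h3]
      rw [← sub_eq_zero, ← integral_sub (hb hpos) (hb hneg), ← hspan g hg]
      refine integral_congr_ae (Eventually.of_forall fun x => ?_)
      simp only
      rw [← sub_smul, Complex.real_smul, mul_comm]
      congr 2
      rcases le_total (D x) 0 with h | h
      · rw [max_eq_right h, max_eq_left (by linarith)]; ring
      · rw [max_eq_left h, max_eq_right (by linarith)]; ring
  have hae := (withDensity_eq_iff hpm hnm hpl).1 hPP
  filter_upwards [hae] with x hx
  have h4 : max (D x) 0 = max (-D x) 0 :=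
    (ENNReal.ofReal_eq_ofReal_iff (le_max_right _ _) (le_max_right _ _)).1 hx
  rcases le_total (D x) 0 with h | h
  · rw [max_eq_right h, max_eq_left (by linarith)] at h4; simp; linarith
  · rw [max_eq_left h, max_eq_right (by linarith)] at h4; simpa using h4

/-- The real exponentials used as test functions are bounded only on part of the space, so one works
on the subtype `C`; closedness keeps it complete. -/
theorem ae_eq_zero_on_of_forall_setIntegral_eq_zero {X : Type*} [MeasurableSpace X] [MetricSpace X]
    [BorelSpace X] [CompleteSpace X] [SecondCountableTopology X] {μ : Measure X} {C : Set X}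
    (hC : IsClosed C) {D : X → ℝ} (hD : IntegrableOn D C μ) (S : Set (X → ℂ))
    (hcont : ∀ f ∈ S, Continuous f) (hb : ∀ f ∈ S, ∀ x ∈ C, ‖f x‖ ≤ 1)
    (hone : (fun _ => 1) ∈ S) (hmul : ∀ f ∈ S, ∀ g ∈ S, (fun x => f x * g x) ∈ S)
    (hstar : ∀ f ∈ S, (fun x => (starRingEnd ℂ) (f x)) ∈ S)
    (hsep : ∀ x ∈ C, ∀ y ∈ C, x ≠ y → ∃ f ∈ S, f x ≠ f y)
    (h0 : ∀ f ∈ S, ∫ x in C, f x * (D x : ℂ) ∂μ = 0) : ∀ᵐ x ∂(μ.restrict C), D x = 0 := by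
  have : CompleteSpace C := hC.completeSpace_coe
  have hmap : (μ.comap ((↑) : C → X)).map (↑) = μ.restrict C := map_comap_subtype_coe hC.measurableSet μ
  have hemb : MeasurableEmbedding ((↑) : C → X) := MeasurableEmbedding.subtype_coe hC.measurableSet
  have hDi : Integrable (fun x : C => D x) (μ.comap (↑)) := by
    have h : Integrable D ((μ.comap ((↑) : C → X)).map (↑)) := by rw [hmap]; exact hD
    exact hemb.integrable_map_iff.1 h
  let T : Submonoid (BoundedContinuousFunction C ℂ) :=
    { carrier := {g | ∃ f ∈ S, ∀ x : C, g x = f x}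
      one_mem' := ⟨_, hone, fun _ => rfl⟩
      mul_mem' := by
        rintro g g' ⟨f, hf, h⟩ ⟨f', hf', h'⟩
        exact ⟨_, hmul f hf f' hf', fun x => by simp [h, h']⟩ }
  have key := ae_eq_zero_of_forall_integral_eq_zero hDi T ?_ ?_ ?_
  · have h3 : ∀ᵐ x ∂((μ.comap ((↑) : C → X)).map (↑)), D x = 0 := hemb.ae_map_iff.2 key
    rwa [hmap] at h3
  · rintro g ⟨f, hf, h⟩
    exact ⟨_, hstar f hf, fun x => by simp [h]⟩
  · intro x y hxy
    obtain ⟨f, hf, hne⟩ := hsep x x.2 y y.2 (fun h => hxy (Subtype.ext h))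
    refine ⟨BoundedContinuousFunction.ofNormedAddCommGroup (fun z : C => f z)
      ((hcont f hf).comp continuous_subtype_val) 1 fun z => hb f hf z z.2, ⟨f, hf, fun _ => rfl⟩, hne⟩
  · rintro g ⟨f, hf, h⟩
    rw [← h0 f hf, ← hmap, hemb.integral_map]
    simp only [h]

/-- A function on the positive half-line is determined by its Laplace transform. -/
theorem eqOn_of_laplace_eq {h₁ h₂ : ℝ → ℂ} (hc₁ : ContinuousOn h₁ (Set.Ioi 0))
    (hc₂ : ContinuousOn h₂ (Set.Ioi 0)) {p₀ : ℝ}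
    (hi₁ : ∀ p ≥ p₀, IntegrableOn (fun t : ℝ => Complex.exp (-p * t) * h₁ t) (Set.Ioi 0))
    (hi₂ : ∀ p ≥ p₀, IntegrableOn (fun t : ℝ => Complex.exp (-p * t) * h₂ t) (Set.Ioi 0))
    (h : ∀ p : ℝ, p ≥ p₀ → ∫ t in Set.Ioi (0 : ℝ), Complex.exp (-p * t) * h₁ t =
      ∫ t in Set.Ioi (0 : ℝ), Complex.exp (-p * t) * h₂ t) : Set.EqOn h₁ h₂ (Set.Ioi 0) := by
  -- Only the values `p = p₀ + n` are used: the functions `e^{-nt}` are already closed under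
  -- products and separate points.
  set H : ℝ → ℂ := fun t => Complex.exp (-p₀ * t) * (h₁ t - h₂ t) with hH
  have hHi : ∀ n : ℕ, IntegrableOn (fun t : ℝ => Complex.exp (-n * t) * H t) (Set.Ioi 0) ∧
      ∫ t in Set.Ioi (0 : ℝ), Complex.exp (-n * t) * H t = 0 := by
    intro n
    have hp : p₀ + n ≥ p₀ := by simp
    have he : (fun t : ℝ => Complex.exp (-n * t) * H t) = fun t : ℝ =>
        Complex.exp (-(p₀ + n : ℝ) * t) * h₁ t - Complex.exp (-(p₀ + n : ℝ) * t) * h₂ t := by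
      ext t
      simp only [hH]
      rw [← mul_assoc, ← Complex.exp_add, ← mul_sub]
      congr 2; push_cast; ring
    rw [he]
    refine ⟨(hi₁ _ hp).sub (hi₂ _ hp), ?_⟩
    rw [integral_sub (hi₁ _ hp) (hi₂ _ hp), h _ hp, sub_self]
  have hreal : ∀ L : ℂ →L[ℝ] ℝ, ∀ᵐ t ∂(volume.restrict (Set.Ici (0 : ℝ))), L (H t) = 0 := by
    intro L
    have hexp : ∀ (n : ℕ) (t : ℝ), Complex.exp (-n * t) = ((Real.exp (-n * t) : ℝ) : ℂ) := by
      intro n t; push_cast; rfl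
    have hH0 : IntegrableOn H (Set.Ioi 0) := by simpa using (hHi 0).1
    refine ae_eq_zero_on_of_forall_setIntegral_eq_zero isClosed_Ici (D := fun t => L (H t)) ?_
      (Set.range fun (n : ℕ) (t : ℝ) => Complex.exp (-n * t)) ?_ ?_ ?_ ?_ ?_ ?_ ?_
    · rw [integrableOn_Ici_iff_integrableOn_Ioi]
      exact L.integrable_comp hH0
    · rintro _ ⟨n, rfl⟩; fun_prop
    · rintro _ ⟨n, rfl⟩ t ht
      have ht : 0 ≤ t := ht
      exact norm_exp_neg_mul_le_one (by simp) ht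
    · exact ⟨0, by ext; simp⟩
    · rintro _ ⟨n, rfl⟩ _ ⟨m, rfl⟩
      refine ⟨n + m, ?_⟩
      ext t
      simp only
      rw [← Complex.exp_add]; congr 1; push_cast; ring
    · rintro _ ⟨n, rfl⟩
      refine ⟨n, ?_⟩
      ext t
      simp only [hexp, Complex.conj_ofReal]
    · intro x _ y _ hxy
      refine ⟨_, ⟨1, rfl⟩, fun hc => hxy ?_⟩
      simp only [hexp] at hc
      have := Real.exp_injective (Complex.ofReal_injective hc)
      simpa using this
    · rintro _ ⟨n, rfl⟩
      rw [integral_Ici_eq_integral_Ioi]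
      have h3 : ∀ t : ℝ, Complex.exp (-n * t) * ((L (H t) : ℝ) : ℂ) =
          ((L (Complex.exp (-n * t) * H t) : ℝ) : ℂ) := by
        intro t
        have h4 : ((Real.exp (-n * t) : ℝ) : ℂ) * H t = Real.exp (-n * t) • H t :=
          Complex.real_smul.symm
        rw [hexp, h4, map_smul, smul_eq_mul, Complex.ofReal_mul]
      simp only [h3]
      rw [integral_complex_ofReal, L.integral_comp_comm (hHi n).1, (hHi n).2]
      simp
  have hae : ∀ᵐ t ∂(volume.restrict (Set.Ioi (0 : ℝ))), h₁ t = h₂ t := by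
    have hre := hreal Complex.reCLM
    have him := hreal Complex.imCLM
    rw [Measure.restrict_congr_set Ioi_ae_eq_Ici]
    filter_upwards [hre, him] with t h3 h4
    have h5 : H t = 0 := Complex.ext h3 h4
    simp only [hH] at h5
    exact sub_eq_zero.1 ((mul_eq_zero.1 h5).resolve_left (Complex.exp_ne_zero _))
  exact Measure.eqOn_open_of_ae_eq hae isOpen_Ioi hc₁ hc₂

/-- A function on `t, s ≥ 0` is determined by its Laplace–Fourier transform. -/
theorem ae_eq_zero_of_transform_eq_zero {D : ℝ × ℝ × ℝ → ℝ}
    (hD : IntegrableOn D {q | 0 ≤ q.1 ∧ 0 ≤ q.2.1})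
    (h0 : ∀ (l m : ℕ) (μ : ℝ), ∫ q in {q : ℝ × ℝ × ℝ | 0 ≤ q.1 ∧ 0 ≤ q.2.1},
      Complex.exp (-l * q.1 - m * q.2.1 + Complex.I * μ * q.2.2) * (D q : ℂ) = 0) :
    ∀ᵐ q ∂(volume.restrict {q : ℝ × ℝ × ℝ | 0 ≤ q.1 ∧ 0 ≤ q.2.1}), D q = 0 := by
  have hclosed : IsClosed {q : ℝ × ℝ × ℝ | 0 ≤ q.1 ∧ 0 ≤ q.2.1} :=
    (isClosed_le continuous_const continuous_fst).inter
      (isClosed_le continuous_const (continuous_fst.comp continuous_snd))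
  refine ae_eq_zero_on_of_forall_setIntegral_eq_zero hclosed hD
    (Set.range fun (k : ℕ × ℕ × ℝ) (q : ℝ × ℝ × ℝ) =>
      Complex.exp (-k.1 * q.1 - k.2.1 * q.2.1 + Complex.I * k.2.2 * q.2.2)) ?_ ?_ ?_ ?_ ?_ ?_ ?_
  · rintro _ ⟨k, rfl⟩; fun_prop
  · rintro _ ⟨k, rfl⟩ q ⟨h1, h2⟩
    simp only
    rw [Complex.norm_exp, Real.exp_le_one_iff]
    have h3 : (0 : ℝ) ≤ k.1 := Nat.cast_nonneg _
    have h4 : (0 : ℝ) ≤ k.2.1 := Nat.cast_nonneg _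
    simp
    nlinarith [mul_nonneg h3 h1, mul_nonneg h4 h2]
  · exact ⟨0, by ext; simp⟩
  · rintro _ ⟨k, rfl⟩ _ ⟨k', rfl⟩
    refine ⟨k + k', ?_⟩
    ext q
    simp only
    rw [← Complex.exp_add]; congr 1; push_cast [Prod.fst_add, Prod.snd_add]; ring
  · rintro _ ⟨k, rfl⟩
    refine ⟨(k.1, k.2.1, -k.2.2), ?_⟩
    ext q
    simp only
    rw [← Complex.exp_conj]
    simp
  · rintro ⟨t, s, x⟩ _ ⟨t', s', x'⟩ _ hne
    by_cases ht : t = t'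
    · by_cases hs : s = s'
      · have hx : x - x' ≠ 0 := fun h => hne (by rw [ht, hs, sub_eq_zero.1 h])
        -- This frequency makes the two exponentials differ by the factor `e^{iπ} = -1`.
        refine ⟨_, ⟨(0, 0, Real.pi / (x - x')), rfl⟩, fun hc => ?_⟩
        have hxc : (x : ℂ) - x' ≠ 0 := by exact_mod_cast hx
        have h3 := congrArg (· * Complex.exp (-(Complex.I * ((Real.pi / (x - x') : ℝ) : ℂ) * x'))) hc
        simp only [Nat.cast_zero, neg_zero, zero_mul, sub_zero, zero_add, ← Complex.exp_add,
          add_neg_cancel, Complex.exp_zero] at h3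
        have h4 : Complex.I * ((Real.pi / (x - x') : ℝ) : ℂ) * x +
            -(Complex.I * ((Real.pi / (x - x') : ℝ) : ℂ) * x') = Real.pi * Complex.I := by
          push_cast; field_simp; ring
        rw [h4, Complex.exp_pi_mul_I] at h3
        norm_num at h3
      · refine ⟨_, ⟨(0, 1, 0), rfl⟩, fun hc => hs ?_⟩
        have := congrArg norm hc
        simp only [Complex.norm_exp, Real.exp_eq_exp] at this
        simpa using this
    · refine ⟨_, ⟨(1, 0, 0), rfl⟩, fun hc => ht ?_⟩
      have := congrArg norm hc
      simp only [Complex.norm_exp, Real.exp_eq_exp] at this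
      simpa using this
  · rintro _ ⟨k, rfl⟩; exact h0 _ _ _


/-! ### The Mittag-Leffler function `E_{1,b}` -/

theorem summable_norm_mittagLeffler {b : ℝ} (hb : 0 < b) (R : ℝ) :
    Summable fun r : ℕ => R ^ r / Real.Gamma (1 * r + b) := by
  rcases eq_or_ne R 0 with rfl | hR
  · refine summable_of_ne_finset_zero (s := {0}) fun n hn => ?_
    rw [zero_pow (by simpa using hn), zero_div]
  have hG : ∀ r : ℕ, Real.Gamma (1 * r + b) ≠ 0 := fun r =>
    (Real.Gamma_pos_of_pos (by positivity)).ne'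
  refine summable_of_ratio_test_tendsto_lt_one (l := 0) zero_lt_one
    (Eventually.of_forall fun r => div_ne_zero (pow_ne_zero _ hR) (hG r)) ?_
  have h : ∀ r : ℕ, ‖R ^ (r + 1) / Real.Gamma (1 * (r + 1 : ℕ) + b)‖ /
      ‖R ^ r / Real.Gamma (1 * r + b)‖ = |R| / (r + b) := by
    intro r
    have hrb : (0 : ℝ) < r + b := by positivity
    have h1 : (1 : ℝ) * (r + 1 : ℕ) + b = (r + b) + 1 := by push_cast; ring
    rw [h1, Real.Gamma_add_one hrb.ne', ← norm_div, Real.norm_eq_abs]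
    have h3 := hG r
    rw [one_mul] at h3 ⊢
    have h4 : R ^ (r + 1) / ((r + b) * Real.Gamma (r + b)) / (R ^ r / Real.Gamma (r + b)) =
        R / (r + b) := by
      rw [pow_succ]; field_simp
    rw [h4, abs_div, abs_of_pos hrb]
  simp only [h]
  exact tendsto_const_nhds.div_atTop (tendsto_atTop_add_const_right _ _ tendsto_natCast_atTop_atTop)

theorem summable_mittagLeffler {b : ℝ} (hb : 0 < b) (z : ℂ) :
    Summable fun r : ℕ => z ^ r / (Real.Gamma (1 * r + b) : ℂ) := by
  refine Summable.of_norm ((summable_norm_mittagLeffler hb ‖z‖).congr fun r => ?_)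
  rw [norm_div, norm_pow, Complex.norm_real, Real.norm_of_nonneg
    (Real.Gamma_pos_of_pos (by positivity)).le]

theorem continuous_mittagLeffler {b : ℝ} (hb : 0 < b) : Continuous (mittagLeffler 1 b) := by
  rw [continuous_iff_continuousAt]
  intro z
  have h : ContinuousOn (mittagLeffler 1 b) (Metric.ball 0 (‖z‖ + 1)) := by
    refine continuousOn_tsum (fun r => by fun_prop) (summable_norm_mittagLeffler hb (‖z‖ + 1)) ?_
    intro r w hw
    rw [norm_div, norm_pow, Complex.norm_real, Real.norm_of_nonneg
      (Real.Gamma_pos_of_pos (by positivity)).le]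
    have : ‖w‖ ≤ ‖z‖ + 1 := by simpa using (mem_ball_zero_iff.1 hw).le
    have hG := Real.Gamma_pos_of_pos (show (0 : ℝ) < 1 * r + b by positivity)
    gcongr
  exact h.continuousAt (Metric.isOpen_ball.mem_nhds (by simp))

theorem mittagLeffler_eq_add {b : ℝ} (hb : 0 < b) (z : ℂ) :
    mittagLeffler 1 b z = (Real.Gamma b : ℂ)⁻¹ + z * mittagLeffler 1 (b + 1) z := by
  rw [mittagLeffler, (summable_mittagLeffler hb z).tsum_eq_zero_add, mittagLeffler, ← tsum_mul_left]
  congr 1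
  · simp
  · refine tsum_congr fun r => ?_
    have : (1 : ℝ) * (r + 1 : ℕ) + b = 1 * r + (b + 1) := by push_cast; ring
    rw [this, pow_succ']; ring

/-- Expanding the exponential and integrating termwise gives the Beta integrals `r! Γ(b) /
Γ(r+1+b)`. Unlike the series, the integral displays the behaviour for large positive `u`. -/
theorem Gamma_mul_mittagLeffler {b : ℝ} (hb : 0 < b) {u : ℝ} :
    (Real.Gamma b : ℂ) * mittagLeffler 1 (b + 1) (-u) =
      ∫ v in (0 : ℝ)..1, Complex.exp (-u * v) * (1 - v : ℂ) ^ ((b : ℂ) - 1) := by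
  have hbre : 0 < (b : ℂ).re := by simpa using hb
  set F : ℕ → ℝ → ℂ := fun r v => (-u : ℂ) ^ r / (r.factorial : ℂ) *
    ((v : ℂ) ^ (((r : ℂ) + 1) - 1) * (1 - v : ℂ) ^ ((b : ℂ) - 1)) with hF
  have hr : ∀ r : ℕ, 0 < ((r : ℂ) + 1).re := fun r => by
    simp only [Complex.add_re, Complex.natCast_re, Complex.one_re]; positivity
  have hFi : ∀ r, IntegrableOn (F r) (Set.Ioc 0 1) := fun r => by
    have := Complex.betaIntegral_convergent (hr r) hbre
    rw [intervalIntegrable_iff_integrableOn_Ioc_of_le zero_le_one] at this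
    exact this.const_mul _
  have hg : IntegrableOn (fun v : ℝ => (1 - v : ℂ) ^ ((b : ℂ) - 1)) (Set.Ioc 0 1) := by
    have := Complex.betaIntegral_convergent (u := 1) (v := b) (by simp) hbre
    rw [intervalIntegrable_iff_integrableOn_Ioc_of_le zero_le_one] at this
    simpa using this
  have hpow : ∀ (r : ℕ) (v : ℝ), (v : ℂ) ^ (((r : ℂ) + 1) - 1) = (v : ℂ) ^ r := fun r v => by
    rw [add_sub_cancel_right, Complex.cpow_natCast]
  have hbd : ∀ (r : ℕ), ∀ v ∈ Set.Ioc (0 : ℝ) 1, ‖F r v‖ ≤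
      |u| ^ r / r.factorial * ‖(1 - v : ℂ) ^ ((b : ℂ) - 1)‖ := by
    intro r v hv
    simp only [hF, hpow]
    rw [norm_mul, norm_mul, norm_div, norm_pow, norm_neg, Complex.norm_real, Real.norm_eq_abs,
      norm_pow, Complex.norm_real, Complex.norm_natCast, Real.norm_of_nonneg hv.1.le]
    have : v ^ r ≤ 1 := pow_le_one₀ hv.1.le hv.2
    gcongr
    exact mul_le_of_le_one_left (norm_nonneg _) this
  have hsum : Summable fun r => ∫ v in Set.Ioc (0 : ℝ) 1, ‖F r v‖ := by
    refine Summable.of_nonneg_of_le (fun r => integral_nonneg fun _ => norm_nonneg _) (fun r => ?_)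
      ((Real.summable_pow_div_factorial |u|).mul_right
        (∫ v in Set.Ioc (0 : ℝ) 1, ‖(1 - v : ℂ) ^ ((b : ℂ) - 1)‖))
    rw [← integral_const_mul]
    exact setIntegral_mono_on (hFi r).norm (hg.norm.const_mul _) measurableSet_Ioc (hbd r)
  have hint : ∀ r, ∫ v in Set.Ioc (0 : ℝ) 1, F r v =
      (Real.Gamma b : ℂ) * ((-u : ℂ) ^ r / (Real.Gamma (1 * r + (b + 1)) : ℂ)) := by
    intro r
    simp only [hF]
    rw [integral_const_mul, ← intervalIntegral.integral_of_le zero_le_one]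
    have h1 := Complex.Gamma_mul_Gamma_eq_betaIntegral (hr r) hbre
    rw [Complex.betaIntegral] at h1
    have h3 : Complex.Gamma ((r : ℂ) + 1 + b) ≠ 0 := Complex.Gamma_ne_zero_of_re_pos (by
      simp only [Complex.add_re, Complex.natCast_re, Complex.one_re, Complex.ofReal_re]; positivity)
    have h4 : (r.factorial : ℂ) ≠ 0 := by exact_mod_cast r.factorial_ne_zero
    have h5 : (Real.Gamma (1 * r + (b + 1)) : ℂ) = Complex.Gamma ((r : ℂ) + 1 + b) := by
      rw [← Complex.Gamma_ofReal]; congr 1; push_cast; ring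
    rw [h5, ← Complex.Gamma_ofReal]
    rw [Complex.Gamma_nat_eq_factorial] at h1
    field_simp
    linear_combination (-(u : ℂ)) ^ r * (-1 : ℂ) * h1
  have hts : ∀ v ∈ Set.Ioc (0 : ℝ) 1, ∑' r, F r v =
      Complex.exp (-u * v) * (1 - v : ℂ) ^ ((b : ℂ) - 1) := by
    intro v _
    have h1 : ∀ r, F r v = (-u * v : ℂ) ^ r / (r.factorial : ℂ) * (1 - v : ℂ) ^ ((b : ℂ) - 1) := by
      intro r
      simp only [hF, hpow]; rw [mul_pow]; ring
    simp only [h1]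
    rw [tsum_mul_right, Complex.exp_eq_exp_ℂ, NormedSpace.exp_eq_tsum_div]
  rw [intervalIntegral.integral_of_le zero_le_one, ← setIntegral_congr_fun measurableSet_Ioc hts,
    ← integral_tsum_of_summable_integral_norm hFi hsum]
  simp only [hint]
  rw [tsum_mul_left, mittagLeffler]

/-- The integral representation and `|e^{-uv}| ≤ 1` bound `E_{1,b+1}`; the recurrence
`mittagLeffler_eq_add` passes to `E_{1,b}`. Bounding the series by absolute values would give growth
like `e^u`, and `exp (-sξ^N)` need not beat `exp ((t-s)ξ^N)`. -/
theorem norm_mittagLeffler_le {b : ℝ} (hb : 0 < b) {u : ℝ} (hu : 0 ≤ u) :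
    ‖mittagLeffler 1 b (-u)‖ ≤ (Real.Gamma b)⁻¹ + u * (Real.Gamma (b + 1))⁻¹ := by
  have hG := Real.Gamma_pos_of_pos hb
  have h1 : ‖mittagLeffler 1 (b + 1) (-u)‖ ≤ (Real.Gamma (b + 1))⁻¹ := by
    have h := congrArg norm (Gamma_mul_mittagLeffler hb (u := u))
    have h3 : ‖∫ v in (0 : ℝ)..1, Complex.exp (-u * v) * (1 - v : ℂ) ^ ((b : ℂ) - 1)‖ ≤
        ∫ v in (0 : ℝ)..1, (1 - v) ^ (b - 1) := by
      refine intervalIntegral.norm_integral_le_of_norm_le zero_le_one ?_ ?_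
      · refine Eventually.of_forall fun v hv => ?_
        have hv' : 0 ≤ 1 - v := by linarith [hv.2]
        have e1 : ((1 - v : ℂ) ^ ((b : ℂ) - 1)) = (((1 - v) ^ (b - 1) : ℝ) : ℂ) := by
          rw [Complex.ofReal_cpow hv']; push_cast; rfl
        rw [norm_mul, e1, Complex.norm_real, Real.norm_of_nonneg (Real.rpow_nonneg hv' _)]
        refine mul_le_of_le_one_left (Real.rpow_nonneg hv' _) ?_
        exact norm_exp_neg_mul_le_one (ω := u) (by simpa using hu) hv.1.le
      · have := (intervalIntegral.intervalIntegrable_rpow' (a := 0) (b := 1) (r := b - 1)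
          (by linarith)).comp_sub_left 1
        simpa using this.symm
    have h4 : ∫ v in (0 : ℝ)..1, (1 - v) ^ (b - 1) = 1 / b := by
      rw [intervalIntegral.integral_comp_sub_left (fun v => v ^ (b - 1)) 1]
      rw [sub_self, sub_zero, integral_rpow (Or.inl (by linarith))]
      simp [Real.zero_rpow hb.ne']
    rw [norm_mul, Complex.norm_real, Real.norm_of_nonneg hG.le] at h
    rw [Real.Gamma_add_one hb.ne', ← one_div, le_div_iff₀ (by positivity)]
    rw [← h, h4, le_div_iff₀ hb] at h3
    linarith
  rw [mittagLeffler_eq_add hb]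
  refine (norm_add_le _ _).trans ?_
  rw [norm_inv, Complex.norm_real, Real.norm_of_nonneg hG.le, norm_mul, norm_neg, Complex.norm_real,
    Real.norm_of_nonneg hu]
  gcongr

/-- The Laplace transform of `τ^{b-1} E_{1,b}(-rτ)`. -/
theorem laplace_mittagLeffler {b : ℝ} (hb : 0 < b) {r : ℝ} (hr : 0 ≤ r) {p : ℝ} (hp : r < p) :
    IntegrableOn (fun t : ℝ => Complex.exp (-p * t) *
      (((t ^ (b - 1) : ℝ) : ℂ) * mittagLeffler 1 b (-t * r))) (Set.Ioi 0) ∧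
    ∫ t in Set.Ioi (0 : ℝ), Complex.exp (-p * t) *
      (((t ^ (b - 1) : ℝ) : ℂ) * mittagLeffler 1 b (-t * r)) = ((p ^ (1 - b) / (p + r) : ℝ) : ℂ) := by
  have hp0 : 0 < p := hr.trans_lt hp
  set F : ℕ → ℝ → ℂ := fun k t => (((-r) ^ k / Real.Gamma (1 * k + b) : ℝ) : ℂ) *
    ((t ^ (k + b - 1) * Real.exp (-(p * t)) : ℝ) : ℂ) with hF
  have hG : ∀ k : ℕ, 0 < Real.Gamma (1 * k + b) := fun k => Real.Gamma_pos_of_pos (by positivity)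
  have hgi : ∀ k : ℕ, IntegrableOn (fun t : ℝ => t ^ (k + b - 1) * Real.exp (-(p * t)))
      (Set.Ioi 0) := by
    intro k
    have hk : (0 : ℝ) ≤ k := Nat.cast_nonneg k
    have := integrableOn_rpow_mul_exp_neg_mul_rpow (s := k + b - 1) (p := 1) (b := p)
      (by linarith) one_pos hp0
    simpa only [Real.rpow_one, neg_mul] using this
  have hgv : ∀ k : ℕ, ∫ t in Set.Ioi (0 : ℝ), t ^ (k + b - 1) * Real.exp (-(p * t)) =
      (1 / p) ^ (k + b) * Real.Gamma (1 * k + b) := by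
    intro k
    rw [one_mul]
    exact Real.integral_rpow_mul_exp_neg_mul_Ioi (by positivity) hp0
  have hFi : ∀ k, IntegrableOn (F k) (Set.Ioi 0) := fun k => ((hgi k).ofReal).const_mul _
  have hFv : ∀ k, ∫ t in Set.Ioi (0 : ℝ), F k t =
      (((1 / p) ^ b * (-r / p) ^ k : ℝ) : ℂ) := by
    intro k
    simp only [hF]
    rw [integral_const_mul, integral_complex_ofReal, hgv, ← Complex.ofReal_mul]
    congr 1
    have h3 := (hG k).ne'
    rw [Real.rpow_add (by positivity), Real.rpow_natCast, div_pow, div_pow, one_pow]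
    field_simp
  have hFn : ∀ k, ∫ t in Set.Ioi (0 : ℝ), ‖F k t‖ = (1 / p) ^ b * (r / p) ^ k := by
    intro k
    have h1 : ∀ t ∈ Set.Ioi (0 : ℝ), ‖F k t‖ = r ^ k / Real.Gamma (1 * k + b) *
        (t ^ (k + b - 1) * Real.exp (-(p * t))) := by
      intro t ht
      have ht : 0 < t := ht
      simp only [hF]
      rw [norm_mul, Complex.norm_real, Complex.norm_real, norm_div, norm_pow, norm_neg,
        Real.norm_of_nonneg hr, Real.norm_of_nonneg (hG k).le, Real.norm_of_nonneg (by positivity)]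
    rw [setIntegral_congr_fun measurableSet_Ioi h1, integral_const_mul, hgv]
    have h3 := (hG k).ne'
    rw [Real.rpow_add (by positivity), Real.rpow_natCast, div_pow, div_pow, one_pow]
    field_simp
  -- Here `r < p` matters: termwise integration leads to a geometric series of ratio `r / p`.
  have hsum : Summable fun k => ∫ t in Set.Ioi (0 : ℝ), ‖F k t‖ := by
    simp only [hFn]
    exact (summable_geometric_of_lt_one (by positivity) ((div_lt_one hp0).2 hp)).mul_left _
  have hts : ∀ t ∈ Set.Ioi (0 : ℝ), ∑' k, F k t = Complex.exp (-p * t) *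
      (((t ^ (b - 1) : ℝ) : ℂ) * mittagLeffler 1 b (-t * r)) := by
    intro t ht
    have ht : 0 < t := ht
    rw [mittagLeffler, ← tsum_mul_left, ← tsum_mul_left]
    refine tsum_congr fun k => ?_
    have h1 : Complex.exp (-p * t) = ((Real.exp (-(p * t)) : ℝ) : ℂ) := by push_cast; ring_nf
    have h3 : t ^ ((k : ℝ) + b - 1) = t ^ k * t ^ (b - 1) := by
      rw [add_sub_assoc, Real.rpow_add ht, Real.rpow_natCast]
    simp only [hF]
    rw [h1, h3]
    push_cast
    rw [neg_mul, neg_pow (t * r : ℂ), neg_pow (r : ℂ), mul_pow]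
    ring
  refine ⟨?_, ?_⟩
  · have hm : ContinuousOn (fun t : ℝ => Complex.exp (-p * t) *
        (((t ^ (b - 1) : ℝ) : ℂ) * mittagLeffler 1 b (-t * r))) (Set.Ioi 0) := by
      refine ContinuousOn.mul (by fun_prop) (ContinuousOn.mul ?_ ?_)
      · refine Complex.continuous_ofReal.comp_continuousOn fun t ht => ?_
        have ht : 0 < t := ht
        exact (Real.continuousAt_rpow_const t (b - 1) (Or.inl ht.ne')).continuousWithinAt
      · exact ((continuous_mittagLeffler hb).comp (by fun_prop)).continuousOn
    refine Integrable.mono' (((hgi 0).const_mul (Real.Gamma b)⁻¹).add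
      ((hgi 1).const_mul (r * (Real.Gamma (b + 1))⁻¹)))
      (hm.aestronglyMeasurable measurableSet_Ioi) ?_
    refine (ae_restrict_mem measurableSet_Ioi).mono fun t ht => ?_
    have ht : 0 < t := ht
    have h1 : Complex.exp (-p * t) = ((Real.exp (-(p * t)) : ℝ) : ℂ) := by push_cast; ring_nf
    have h3 := norm_mittagLeffler_le hb (u := t * r) (by positivity)
    have h4 : (-t * r : ℂ) = -((t * r : ℝ) : ℂ) := by push_cast; ring
    rw [h1, h4, norm_mul, norm_mul, Complex.norm_real, Complex.norm_real,
      Real.norm_of_nonneg (Real.exp_nonneg _), Real.norm_of_nonneg (Real.rpow_nonneg ht.le _)]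
    have h5 : t ^ (((1 : ℕ) : ℝ) + b - 1) = t * t ^ (b - 1) := by
      rw [add_sub_assoc, Real.rpow_add ht, Real.rpow_natCast, pow_one]
    have h6 : t ^ (((0 : ℕ) : ℝ) + b - 1) = t ^ (b - 1) := by simp
    simp only [Pi.add_apply]
    rw [h5, h6]
    calc _ ≤ Real.exp (-(p * t)) * (t ^ (b - 1) *
          ((Real.Gamma b)⁻¹ + t * r * (Real.Gamma (b + 1))⁻¹)) := by gcongr
      _ = _ := by ring
  · rw [← setIntegral_congr_fun measurableSet_Ioi hts,
      ← integral_tsum_of_summable_integral_norm hFi hsum]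
    simp only [hFv]
    rw [← Complex.ofReal_tsum, tsum_mul_left, tsum_geometric_of_norm_lt_one]
    · congr 1
      have h3 : p + r ≠ 0 := by positivity
      have h4 : (1 : ℝ) - -r / p = (p + r) / p := by field_simp; ring
      rw [h4, inv_div, Real.rpow_sub hp0, Real.rpow_one, one_div, Real.inv_rpow hp0.le]
      field_simp
    · rw [norm_div, norm_neg, Real.norm_of_nonneg hr, Real.norm_of_nonneg hp0.le]
      exact (div_lt_one hp0).2 hp


/-! ### The Laplace transform of `u(τ; ·)` along the rays -/

/-- Scaling and the decay at `s = 1`, with the worst prefactor taken at `δ` and the slowest decay at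
`R`. It provides the dominating functions for continuity in `s`. -/
theorem exists_norm_wave_le_of_mem {N : ℕ} (hN : Even N) (h2 : 2 ≤ N) {δ R : ℝ} (hδ : 0 < δ) :
    ∃ C c : ℝ, 0 < C ∧ 0 < c ∧ ∀ s ∈ Set.Icc δ R, ∀ y : ℝ, ‖wave N s y‖ ≤ C / (1 + c * y ^ 2) := by
  obtain ⟨C, hC, h⟩ := exists_norm_wave_le hN h2
  rcases lt_or_ge R δ with hR | hR
  · exact ⟨1, 1, one_pos, one_pos, fun s hs => absurd (hs.1.trans hs.2) (not_le.2 hR)⟩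
  have hR0 : 0 < R := hδ.trans_le hR
  refine ⟨δ ^ (-(((rootsJ N).card : ℝ) + 1) / N) * C, (R ^ (-(1 : ℝ) / N)) ^ 2, by positivity,
    by positivity, fun s hs y => ?_⟩
  have hs0 : 0 < s := hδ.trans_le hs.1
  have hN0 : (0 : ℝ) < N := by exact_mod_cast (by omega : 0 < N)
  rw [wave_scaling hN h2 hs0, norm_mul, Complex.norm_real,
    Real.norm_of_nonneg (Real.rpow_nonneg hs0.le _), mul_div_assoc]
  have h1 : s ^ (-(((rootsJ N).card : ℝ) + 1) / N) ≤ δ ^ (-(((rootsJ N).card : ℝ) + 1) / N) := by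
    refine Real.rpow_le_rpow_of_nonpos hδ hs.1 ?_
    rw [neg_div]; exact neg_nonpos.2 (by positivity)
  have h3 : R ^ (-(1 : ℝ) / N) ≤ s ^ (-(1 : ℝ) / N) := by
    refine Real.rpow_le_rpow_of_nonpos hs0 hs.2 ?_
    rw [neg_div]; exact neg_nonpos.2 (by positivity)
  refine mul_le_mul h1 ((h _).trans ?_) (norm_nonneg _) (by positivity)
  rw [mul_pow, mul_comm (y ^ 2)]
  gcongr

theorem integrable_div_one_add_mul_sq (C : ℝ) {c : ℝ} (hc : 0 < c) :
    Integrable fun y : ℝ => C / (1 + c * y ^ 2) := by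
  have h := (integrable_inv_one_add_sq.comp_mul_left' (Real.sqrt_pos.2 hc).ne').const_mul C
  refine h.congr (Eventually.of_forall fun y => ?_)
  simp only
  rw [mul_pow, Real.sq_sqrt hc.le, div_eq_mul_inv]

theorem continuousOn_laplace_wave {N : ℕ} (hN : Even N) (h2 : 2 ≤ N) {ζ : ℂ} (hζ : 0 ≤ ζ.re) :
    ContinuousOn (fun s : ℝ => ∫ y in Set.Ioi (0 : ℝ), Complex.exp (-ζ * y) * wave N s y)
      (Set.Ioi 0) := by
  intro s hs
  have hs : 0 < s := hs
  refine ContinuousAt.continuousWithinAt ?_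
  obtain ⟨C, c, hC, hc, hb⟩ := exists_norm_wave_le_of_mem hN h2 (δ := s / 2) (R := 2 * s)
    (by positivity)
  have hnhds : ∀ᶠ s' in 𝓝 s, s' ∈ Set.Icc (s / 2) (2 * s) :=
    Icc_mem_nhds (by linarith) (by linarith)
  refine continuousAt_of_dominated (bound := fun y => C / (1 + c * y ^ 2)) ?_ ?_
    (integrable_div_one_add_mul_sq C hc).integrableOn ?_
  · filter_upwards [hnhds] with s' hs'
    have hs0 : 0 < s' := by linarith [hs'.1]
    exact (Continuous.aestronglyMeasurable (by fun_prop)).mul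
      (integral_norm_wave hN h2 hs0).1.aestronglyMeasurable
  · filter_upwards [hnhds] with s' hs'
    refine (ae_restrict_mem measurableSet_Ioi).mono fun y hy => ?_
    rw [norm_mul]
    exact (mul_le_of_le_one_left (norm_nonneg _) (norm_exp_neg_mul_le_one hζ (le_of_lt hy))).trans
      (hb s' hs' y)
  · refine Eventually.of_forall fun y => ContinuousAt.mul continuousAt_const ?_
    have h := (continuousOn_wave hN h2).continuousAt
      ((isOpen_Ioi.prod isOpen_univ).mem_nhds (show (s, y) ∈ Set.Ioi (0 : ℝ) ×ˢ Set.univ from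
        ⟨hs, trivial⟩))
    exact h.comp (f := fun s' => (s', y)) (by fun_prop)

/-- As `K = -J`, the plus signs turn the product into one over `K`. Multiplied by the product over
`J`, it is `a^N - κ_N (ωξ)^N`, which is `a^N + ξ^N` by `rayDir_pow`. -/
theorem prod_add_mul_rootsJ {N : ℕ} (hN : Even N) (h2 : 2 ≤ N) {p : ℂ × Bool} (hp : p ∈ rays N)
    {a ξ : ℝ} (ha : 0 < a) (hξ : 0 < ξ) :
    ∏ θ ∈ rootsJ N, (a + rayDir N p * ξ * θ)⁻¹ =
      (∏ θ ∈ rootsJ N, (a - rayDir N p * ξ * θ)) / ((a ^ N + ξ ^ N : ℝ) : ℂ) := by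
  have h := prod_sub_mul_roots hN h2 a (rayDir N p * ξ)
  rw [prod_rootsK hN h2, mul_pow, rayDir_pow h2 hp] at h
  simp only [mul_neg, sub_neg_eq_add] at h
  have hk : (kappa N : ℂ) * kappa N = 1 := by
    have := kappa_sq N
    rw [← Complex.ofReal_mul, ← sq, this, Complex.ofReal_one]
  have h1 : (a : ℂ) ^ N - kappa N * (-(kappa N : ℂ) * (ξ : ℂ) ^ N) = ((a ^ N + ξ ^ N : ℝ) : ℂ) := by
    push_cast; linear_combination (ξ : ℂ) ^ N * hk
  have h3 : ((a ^ N + ξ ^ N : ℝ) : ℂ) ≠ 0 := by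
    have : 0 < a ^ N + ξ ^ N := by positivity
    exact_mod_cast this.ne'
  rw [neg_mul, mul_neg, sub_neg_eq_add] at h
  rw [neg_mul, mul_neg, sub_neg_eq_add] at h1
  rw [h1] at h
  have h4 : ∏ θ ∈ rootsJ N, (a + rayDir N p * ξ * θ) ≠ 0 := by
    intro h0; rw [h0, mul_zero] at h; exact h3 h.symm
  rw [Finset.prod_inv_distrib, eq_div_iff h3, ← h]
  field_simp

/-- Both sides are continuous in `τ`, so it suffices to compare their Laplace transforms in `τ`. On
the left this is `wave_transform` at `ζ = ωξ`, rewritten by `prod_add_mul_rootsJ`; `sum_beta_pow`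
expands the numerator in the terms `a^{M-m} (ωξ)^m`. Since `N = 2M`, the quotient `a^{M-m} / (a^N +
ξ^N)` is the transform of the Mittag-Leffler term of index `(m + M)/N`. -/
theorem laplace_wave {N : ℕ} (hN : Even N) (h2 : 2 ≤ N) {p : ℂ × Bool} (hp : p ∈ rays N)
    {ξ τ : ℝ} (hξ : 0 < ξ) (hτ : 0 < τ) :
    ∫ y in Set.Ioi (0 : ℝ), Complex.exp (-(rayDir N p * ξ) * y) * wave N τ y =
      ∑ m ∈ Finset.range ((rootsJ N).card + 1), beta N (-(m : ℤ)) * (rayDir N p * ξ) ^ m *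
        (((τ ^ (((m : ℝ) - (rootsJ N).card) / N) : ℝ) : ℂ) *
          mittagLeffler 1 (((m : ℝ) + (rootsJ N).card) / N) (-τ * (ξ ^ N : ℝ))) := by
  set M := (rootsJ N).card with hM
  have hNM : 2 * M = N := two_mul_card_rootsJ hN h2
  have hM0 : 0 < M := card_rootsJ_pos hN h2
  have hN0 : (0 : ℝ) < N := by exact_mod_cast (by omega : 0 < N)
  have hNMr : (N : ℝ) = 2 * M := by rw [← hNM]; push_cast; rfl
  set ζ : ℂ := rayDir N p * ξ with hζdef
  have hζ : 0 ≤ ζ.re := by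
    rw [hζdef, Complex.re_mul_ofReal]
    exact mul_nonneg (re_rayDir_nonneg hN h2 hp) hξ.le
  have hbpos : ∀ m : ℕ, 0 < ((m : ℝ) + M) / N := fun m => by
    have : (0 : ℝ) < M := by exact_mod_cast hM0
    positivity
  have hbsub : ∀ m : ℕ, ((m : ℝ) - M) / N = ((m : ℝ) + M) / N - 1 := fun m => by
    rw [hNMr]; have : (0 : ℝ) < M := by exact_mod_cast hM0
    field_simp; ring
  have hpow : 0 ≤ ξ ^ N := by positivity
  have hML := fun (m : ℕ) {q : ℝ} (hq : ξ ^ N < q) => laplace_mittagLeffler (hbpos m) hpow hq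
  have hw := fun {q : ℝ} (hq : 0 < q) => integrableOn_cexp_mul_wave hN h2 hq hζ
  have hsplit : ∀ q s y : ℝ, Complex.exp (-q * s - ζ * y) * wave N s y =
      Complex.exp (-q * s) * (Complex.exp (-ζ * y) * wave N s y) := by
    intro q s y
    rw [← mul_assoc, ← Complex.exp_add]; congr 2; ring
  -- `laplace_mittagLeffler` requires the Laplace variable to exceed `ξ^N`.
  refine eqOn_of_laplace_eq (continuousOn_laplace_wave hN h2 hζ) (p₀ := ξ ^ N + 1)
    (h₂ := fun τ : ℝ => ∑ m ∈ Finset.range (M + 1), beta N (-(m : ℤ)) * ζ ^ m *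
        (((τ ^ (((m : ℝ) - M) / N) : ℝ) : ℂ) *
          mittagLeffler 1 (((m : ℝ) + M) / N) (-τ * (ξ ^ N : ℝ)))) ?_ ?_ ?_ ?_ hτ
  · refine continuousOn_finsetSum _ fun m _ => ContinuousOn.mul (by fun_prop)
      (ContinuousOn.mul ?_ ?_)
    · refine Complex.continuous_ofReal.comp_continuousOn fun t ht => ?_
      have ht : 0 < t := ht
      exact (Real.continuousAt_rpow_const t _ (Or.inl ht.ne')).continuousWithinAt
    · exact ((continuous_mittagLeffler (hbpos m)).comp (by fun_prop)).continuousOn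
  · intro q hq
    have hq0 : 0 < q := by linarith
    have h := hw hq0
    rw [IntegrableOn, quadrant, Measure.volume_eq_prod, ← Measure.prod_restrict] at h
    refine h.integral_prod_left.congr (Eventually.of_forall fun s => ?_)
    simp only [hsplit]
    rw [integral_const_mul]
  · intro q hq
    have hq' : ξ ^ N < q := by linarith
    simp only [Finset.mul_sum]
    refine integrable_finsetSum _ fun m _ => ?_
    refine ((hML m hq').1.const_mul (beta N (-(m : ℤ)) * ζ ^ m)).congr
      (Eventually.of_forall fun s => ?_)
    simp only [hbsub]
    ring
  · intro q hq
    have hq' : ξ ^ N < q := by linarith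
    have hq0 : 0 < q := by linarith
    set a : ℝ := q ^ ((1 : ℝ) / N) with ha
    have ha0 : 0 < a := Real.rpow_pos_of_pos hq0 _
    have haN : a ^ N = q := by rw [ha, one_div, Real.rpow_inv_natCast_pow hq0.le (by omega)]
    have hL : ∫ s in Set.Ioi (0 : ℝ), Complex.exp (-q * s) *
        ∫ y in Set.Ioi (0 : ℝ), Complex.exp (-ζ * y) * wave N s y =
        ∏ θ ∈ rootsJ N, (a + ζ * θ)⁻¹ := by
      rw [← wave_transform hN h2 ha0 hζ, haN]
      have h := hw hq0
      rw [quadrant, Measure.volume_eq_prod] at h ⊢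
      rw [setIntegral_prod _ h]
      simp only [hsplit]
      simp only [integral_const_mul]
    rw [hL]
    simp only [Finset.mul_sum]
    rw [integral_finsetSum]
    · have h1 : ∀ m ∈ Finset.range (M + 1), ∫ s in Set.Ioi (0 : ℝ), Complex.exp (-q * s) *
          (beta N (-(m : ℤ)) * ζ ^ m * (((s ^ (((m : ℝ) - M) / N) : ℝ) : ℂ) *
          mittagLeffler 1 (((m : ℝ) + M) / N) (-s * (ξ ^ N : ℝ)))) =
          (((a ^ N + ξ ^ N : ℝ) : ℂ))⁻¹ * (a ^ M * (beta N (-(m : ℤ)) * (ζ / a) ^ m)) := by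
        intro m hm
        have hmM : m ≤ M := Nat.lt_succ_iff.1 (Finset.mem_range.1 hm)
        have h3 : ∀ s : ℝ, Complex.exp (-q * s) *
          (beta N (-(m : ℤ)) * ζ ^ m * (((s ^ (((m : ℝ) - M) / N) : ℝ) : ℂ) *
          mittagLeffler 1 (((m : ℝ) + M) / N) (-s * (ξ ^ N : ℝ)))) =
          (beta N (-(m : ℤ)) * ζ ^ m) * (Complex.exp (-q * s) *
          (((s ^ (((m : ℝ) + M) / N - 1) : ℝ) : ℂ) *
          mittagLeffler 1 (((m : ℝ) + M) / N) (-s * (ξ ^ N : ℝ)))) := by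
          intro s; rw [hbsub]; ring
        simp only [h3]
        rw [integral_const_mul, (hML m hq').2]
        have h4 : q ^ (1 - ((m : ℝ) + M) / N) = a ^ (M - m) := by
          rw [ha, ← Real.rpow_natCast, ← Real.rpow_mul hq0.le, Nat.cast_sub hmM]
          congr 1
          have : (0 : ℝ) < M := by exact_mod_cast hM0
          rw [hNMr]; field_simp; ring
        have hac : (a : ℂ) ≠ 0 := by exact_mod_cast ha0.ne'
        have h5 : (a : ℂ) ^ M = a ^ (M - m) * a ^ m := by rw [← pow_add, Nat.sub_add_cancel hmM]
        rw [h4, haN, div_pow, h5]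
        push_cast
        field_simp
      rw [Finset.sum_congr rfl h1, ← Finset.mul_sum, ← Finset.mul_sum, sum_beta_pow hN h2,
        prod_add_mul_rootsJ hN h2 hp ha0 hξ, div_eq_inv_mul]
      congr 1
      rw [hM, ← Finset.prod_const, ← Finset.prod_mul_distrib]
      refine Finset.prod_congr rfl fun θ _ => ?_
      have hac : (a : ℂ) ≠ 0 := by exact_mod_cast ha0.ne'
      rw [hζdef]; field_simp
    · intro m _
      refine ((hML m hq').1.const_mul (beta N (-(m : ℤ)) * ζ ^ m)).congr
        (Eventually.of_forall fun s => ?_)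
      simp only [hbsub]
      ring


/-! ### The joint density -/

/-- `u(s; y)` for `s, y > 0`, continued by zero. -/
noncomputable def halfWave (N : ℕ) (q : ℝ × ℝ) : ℂ :=
  quadrant.indicator (fun q => wave N q.1 q.2) q

/-- The joint density of the sojourn time and the position. -/
noncomputable def density (N : ℕ) (t s x : ℝ) : ℝ :=
  (∫ y : ℝ, halfWave N (s, y) * halfWave N (t - s, y - x)).re

theorem conj_halfWave {N : ℕ} (h2 : 2 ≤ N) (q : ℝ × ℝ) :
    (starRingEnd ℂ) (halfWave N q) = halfWave N q := by
  by_cases h : q ∈ quadrant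
  · simp only [halfWave, Set.indicator_of_mem h, conj_wave h2]
  · simp only [halfWave, Set.indicator_of_notMem h, map_zero]

theorem ofReal_density {N : ℕ} (h2 : 2 ≤ N) (t s x : ℝ) :
    (density N t s x : ℂ) = ∫ y : ℝ, halfWave N (s, y) * halfWave N (t - s, y - x) := by
  rw [density, ← Complex.conj_eq_iff_re, ← integral_conj]
  simp only [map_mul, conj_halfWave h2]

theorem halfWave_of_nonpos {N : ℕ} {s : ℝ} (hs : s ≤ 0) (y : ℝ) : halfWave N (s, y) = 0 :=
  Set.indicator_of_notMem (fun h => absurd h.1 (not_lt.2 hs)) _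

/-- The change of variables that decouples the two factors of `density`. After regrouping, for fixed
`(s, y)` it is a translation in `t` and a reflection in `x`. -/
theorem measurePreserving_shear :
    MeasurePreserving (fun z : (ℝ × ℝ × ℝ) × ℝ =>
      ((z.1.2.1, z.2), (z.1.1 - z.1.2.1, z.2 - z.1.2.2))) := by
  have h1 : MeasurePreserving (fun z : (ℝ × ℝ × ℝ) × ℝ => (z.1.1, ((z.1.2.1, z.1.2.2), z.2)))
      volume volume := measurePreserving_prodAssoc volume volume volume
  have h2 : MeasurePreserving (fun z : ℝ × (ℝ × ℝ) × ℝ => (z.1, (z.2.1.1, (z.2.1.2, z.2.2))))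
      volume volume :=
    (MeasurePreserving.id volume).prod (measurePreserving_prodAssoc volume volume volume)
  have h3 : MeasurePreserving (fun z : ℝ × ℝ × ℝ × ℝ => (z.1, (z.2.1, (z.2.2.2, z.2.2.1))))
      volume volume :=
    (MeasurePreserving.id volume).prod
      ((MeasurePreserving.id volume).prod Measure.measurePreserving_swap)
  have h4 : MeasurePreserving (fun z : ℝ × ℝ × ℝ × ℝ => (z.1, ((z.2.1, z.2.2.1), z.2.2.2)))
      volume volume :=
    (MeasurePreserving.id volume).prod
      ((measurePreserving_prodAssoc volume volume volume).symm _)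
  have h5 : MeasurePreserving (fun z : ℝ × (ℝ × ℝ) × ℝ => ((z.1, z.2.1), z.2.2))
      volume volume := (measurePreserving_prodAssoc volume volume volume).symm _
  have h6 : MeasurePreserving (fun z : (ℝ × ℝ × ℝ) × ℝ => ((z.1.2, z.1.1), z.2))
      volume volume := Measure.measurePreserving_swap.prod (MeasurePreserving.id volume)
  have h7 : MeasurePreserving (fun z : ((ℝ × ℝ) × ℝ) × ℝ => (z.1.1, (z.1.2, z.2)))
      volume volume := measurePreserving_prodAssoc volume volume volume
  have h8 : MeasurePreserving (fun z : (ℝ × ℝ) × ℝ × ℝ =>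
      (z.1, (z.2.1 - z.1.1, z.1.2 - z.2.2))) volume volume := by
    refine (MeasurePreserving.id volume).skew_product
      (g := fun p q : ℝ × ℝ => (q.1 - p.1, p.2 - q.2)) (by fun_prop)
      (Eventually.of_forall fun p => ?_)
    exact ((measurePreserving_sub_right volume p.1).prod
      (Measure.measurePreserving_sub_left volume p.2)).map_eq
  exact h8.comp (h7.comp (h6.comp (h5.comp (h4.comp (h3.comp (h2.comp h1))))))

theorem integrable_exp_mul_halfWave {N : ℕ} (hN : Even N) (h2 : 2 ≤ N) {p : ℝ} (hp : 0 < p)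
    {ζ : ℂ} (hζ : 0 ≤ ζ.re) :
    Integrable fun q : ℝ × ℝ => Complex.exp (-p * q.1 - ζ * q.2) * halfWave N q := by
  have h := (integrable_indicator_iff measurableSet_quadrant).2
    (integrableOn_cexp_mul_wave hN h2 hp hζ)
  refine h.congr (Eventually.of_forall fun q => ?_)
  by_cases hq : q ∈ quadrant
  · simp only [halfWave, Set.indicator_of_mem hq]
  · simp only [halfWave, Set.indicator_of_notMem hq, mul_zero]

theorem integral_exp_mul_halfWave {N : ℕ} (hN : Even N) (h2 : 2 ≤ N) {a : ℝ} (ha : 0 < a)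
    {ζ : ℂ} (hζ : 0 ≤ ζ.re) :
    ∫ q : ℝ × ℝ, Complex.exp (-(a ^ N : ℝ) * q.1 - ζ * q.2) * halfWave N q =
      ∏ θ ∈ rootsJ N, (a + ζ * θ)⁻¹ := by
  rw [← wave_transform hN h2 ha hζ, ← integral_indicator measurableSet_quadrant]
  refine integral_congr_ae (Eventually.of_forall fun q => ?_)
  by_cases hq : q ∈ quadrant
  · simp only [halfWave, Set.indicator_of_mem hq]
  · simp only [halfWave, Set.indicator_of_notMem hq, mul_zero]

theorem density_of_notMem_region {N : ℕ} {q : ℝ × ℝ × ℝ} (hq : q ∉ region) :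
    density N q.1 q.2.1 q.2.2 = 0 := by
  have h : ∀ y, halfWave N (q.2.1, y) * halfWave N (q.1 - q.2.1, y - q.2.2) = 0 := by
    intro y
    rcases le_or_gt q.2.1 0 with h | h
    · rw [halfWave_of_nonpos h, zero_mul]
    · rw [halfWave_of_nonpos (s := q.1 - q.2.1), mul_zero]
      by_contra h'
      exact hq ⟨h, by linarith⟩
  rw [density]
  simp only [h, integral_zero, Complex.zero_re]

theorem measurableSet_region : MeasurableSet region :=
  (measurableSet_lt (f := fun _ : ℝ × ℝ × ℝ => (0 : ℝ)) (g := fun q => q.2.1) measurable_const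
    (by fun_prop)).inter
    (measurableSet_lt (f := fun q : ℝ × ℝ × ℝ => q.2.1) (by fun_prop) measurable_fst)

/-- The exponent splits along the shear: `-rt + iμx - (p-r)s = (-ps + iμy) + (-r(t-s) - iμ(y-x))`.
So the transform factors into two transforms of `halfWave`, at opposite imaginary frequencies. -/
theorem integrable_and_integral_exp_mul_density {N : ℕ} (hN : Even N) (h2 : 2 ≤ N) {p r : ℝ}
    (hp : 0 < p) (hr : 0 < r) (μ : ℝ) :
    Integrable (fun q : ℝ × ℝ × ℝ =>
      Complex.exp (-r * q.1 + Complex.I * μ * q.2.2 - (p - r : ℝ) * q.2.1) *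
        (density N q.1 q.2.1 q.2.2 : ℂ)) ∧
    ∫ q : ℝ × ℝ × ℝ, Complex.exp (-r * q.1 + Complex.I * μ * q.2.2 - (p - r : ℝ) * q.2.1) *
        (density N q.1 q.2.1 q.2.2 : ℂ) =
      (∫ q : ℝ × ℝ, Complex.exp (-p * q.1 - (-(Complex.I * μ)) * q.2) * halfWave N q) *
      ∫ q : ℝ × ℝ, Complex.exp (-r * q.1 - (Complex.I * μ) * q.2) * halfWave N q := by
  set Φ : ℝ × ℝ → ℂ := fun q => Complex.exp (-p * q.1 - (-(Complex.I * μ)) * q.2) * halfWave N q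
  set Ψ : ℝ × ℝ → ℂ := fun q => Complex.exp (-r * q.1 - (Complex.I * μ) * q.2) * halfWave N q
  have hΦ : Integrable Φ := integrable_exp_mul_halfWave hN h2 hp (by simp)
  have hΨ : Integrable Ψ := integrable_exp_mul_halfWave hN h2 hr (by simp)
  have hprod : Integrable (fun z : (ℝ × ℝ) × ℝ × ℝ => Φ z.1 * Ψ z.2) := hΦ.mul_prod hΨ
  have hcomp : Integrable (fun z : (ℝ × ℝ × ℝ) × ℝ =>
      Φ (z.1.2.1, z.2) * Ψ (z.1.1 - z.1.2.1, z.2 - z.1.2.2)) :=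
    measurePreserving_shear.integrable_comp_of_integrable hprod
  have hinner : ∀ q : ℝ × ℝ × ℝ,
      ∫ y : ℝ, Φ (q.2.1, y) * Ψ (q.1 - q.2.1, y - q.2.2) =
      Complex.exp (-r * q.1 + Complex.I * μ * q.2.2 - (p - r : ℝ) * q.2.1) *
        (density N q.1 q.2.1 q.2.2 : ℂ) := by
    intro q
    rw [ofReal_density h2, ← integral_const_mul]
    refine integral_congr_ae (Eventually.of_forall fun y => ?_)
    simp only [Φ, Ψ]
    rw [mul_mul_mul_comm, ← Complex.exp_add]
    congr 2
    push_cast; ring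
  refine ⟨hcomp.integral_prod_left.congr (Eventually.of_forall hinner), ?_⟩
  rw [← integral_prod_mul Φ Ψ]
  have h := integral_map (μ := (volume : Measure ((ℝ × ℝ × ℝ) × ℝ)))
    measurePreserving_shear.measurable.aemeasurable
    (f := fun z : (ℝ × ℝ) × ℝ × ℝ => Φ z.1 * Ψ z.2)
    (by rw [measurePreserving_shear.map_eq]; exact hprod.aestronglyMeasurable)
  rw [measurePreserving_shear.map_eq] at h
  refine Eq.trans ?_ h.symm
  rw [Measure.volume_eq_prod] at hcomp ⊢
  rw [Measure.volume_eq_prod (ℝ × ℝ × ℝ) ℝ, integral_prod _ hcomp]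
  exact integral_congr_ae (Eventually.of_forall fun q => (hinner q).symm)

theorem integrableOn_exp_mul_density {N : ℕ} (hN : Even N) (h2 : 2 ≤ N) {r : ℝ} (hr : 0 < r) :
    IntegrableOn (fun q : ℝ × ℝ × ℝ => Real.exp (-r * q.1) * density N q.1 q.2.1 q.2.2)
      region := by
  -- With `p = r` and `μ = 0` the exponential reduces to `e^{-rt}`.
  have h := (integrable_and_integral_exp_mul_density hN h2 hr hr 0).1.re
  refine (h.congr (Eventually.of_forall fun q => ?_)).integrableOn
  have : Complex.exp (-r * q.1 + Complex.I * (0 : ℝ) * q.2.2 - (r - r : ℝ) * q.2.1) =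
      ((Real.exp (-r * q.1) : ℝ) : ℂ) := by
    push_cast; congr 1; ring
  simp only [this]
  rw [← Complex.ofReal_mul]
  exact Complex.ofReal_re _

/-- The second factor has frequency `ζ = iμ`, that is, factors `b + iμθ` over `J`; these are the
factors `b - iμθ` over `K = -J`. -/
theorem density_transform {N : ℕ} (hN : Even N) (h2 : 2 ≤ N) {a b : ℝ} (ha : 0 < a) (hb : 0 < b)
    (μ : ℝ) :
    ∫ q in region, Complex.exp (-(b ^ N : ℝ) * q.1 + Complex.I * μ * q.2.2 -
        (a ^ N - b ^ N : ℝ) * q.2.1) * (density N q.1 q.2.1 q.2.2 : ℂ) =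
      (∏ θ ∈ rootsJ N, (a - Complex.I * μ * θ)⁻¹) * ∏ θ ∈ rootsK N, (b - Complex.I * μ * θ)⁻¹ := by
  rw [setIntegral_eq_integral_of_forall_compl_eq_zero fun q hq => by
    rw [density_of_notMem_region hq, Complex.ofReal_zero, mul_zero],
    (integrable_and_integral_exp_mul_density hN h2 (pow_pos ha N) (pow_pos hb N) μ).2,
    integral_exp_mul_halfWave hN h2 ha (by simp), integral_exp_mul_halfWave hN h2 hb (by simp),
    prod_rootsK hN h2]
  congr 1 <;> refine Finset.prod_congr rfl fun θ _ => by congr 1; ring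

theorem continuousAt_halfWave {N : ℕ} (hN : Even N) (h2 : 2 ≤ N) {s y : ℝ} (hs : 0 < s)
    (hy : y ≠ 0) : ContinuousAt (halfWave N) (s, y) := by
  rcases lt_or_gt_of_ne hy with h | h
  · have : halfWave N =ᶠ[𝓝 (s, y)] fun _ => 0 := by
      filter_upwards [(isOpen_Iio.preimage continuous_snd).mem_nhds
        (show (s, y) ∈ Prod.snd ⁻¹' Set.Iio (0 : ℝ) from h)] with q hq
      exact Set.indicator_of_notMem (fun h' => lt_asymm (Set.mem_Ioi.1 h'.2) hq) _
    exact continuousAt_const.congr this.symm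
  · have : halfWave N =ᶠ[𝓝 (s, y)] fun q => wave N q.1 q.2 := by
      filter_upwards [(isOpen_Ioi.prod isOpen_Ioi).mem_nhds (show (s, y) ∈ quadrant from ⟨hs, h⟩)]
        with q hq
      exact Set.indicator_of_mem hq _
    refine ContinuousAt.congr ?_ this.symm
    exact (continuousOn_wave hN h2).continuousAt
      ((isOpen_Ioi.prod isOpen_univ).mem_nhds ⟨hs, trivial⟩)

theorem norm_halfWave_le {N : ℕ} (q : ℝ × ℝ) : ‖halfWave N q‖ ≤ ‖wave N q.1 q.2‖ :=
  norm_indicator_le_norm_self _ _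

/-- Dominated convergence: near a point of the region one factor decays uniformly and the other is
bounded. The cut-off may make `halfWave` jump at `0`, but at the limit point this affects only `y =
0` and `y = x`. -/
theorem continuousOn_density {N : ℕ} (hN : Even N) (h2 : 2 ≤ N) :
    ContinuousOn (fun q : ℝ × ℝ × ℝ => density N q.1 q.2.1 q.2.2) region := by
  rintro ⟨t, s, x⟩ ⟨hs, hst⟩
  simp only at hs hst
  have hτ : 0 < t - s := by linarith
  refine ContinuousAt.continuousWithinAt (Complex.continuous_re.continuousAt.comp ?_)
  obtain ⟨C, c, hC, hc, hb⟩ := exists_norm_wave_le_of_mem hN h2 (δ := s / 2) (R := 2 * s)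
    (by positivity)
  obtain ⟨C', c', hC', hc', hb'⟩ := exists_norm_wave_le_of_mem hN h2 (δ := (t - s) / 2)
    (R := 2 * (t - s)) (by positivity)
  have h1 : ∀ᶠ q : ℝ × ℝ × ℝ in 𝓝 (t, s, x), q.2.1 ∈ Set.Icc (s / 2) (2 * s) := by
    have : ContinuousAt (fun q : ℝ × ℝ × ℝ => q.2.1) (t, s, x) := by fun_prop
    exact this (Icc_mem_nhds (by simp only; linarith) (by simp only; linarith))
  have h3 : ∀ᶠ q : ℝ × ℝ × ℝ in 𝓝 (t, s, x),
      q.1 - q.2.1 ∈ Set.Icc ((t - s) / 2) (2 * (t - s)) := by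
    have : ContinuousAt (fun q : ℝ × ℝ × ℝ => q.1 - q.2.1) (t, s, x) := by fun_prop
    exact this (Icc_mem_nhds (by simp only; linarith) (by simp only; linarith))
  have hmeas : ∀ s : ℝ, Measurable fun y => halfWave N (s, y) := by
    intro s
    have hcont : Continuous (wave N s) ∨ s ≤ 0 := by
      rcases le_or_gt s 0 with h | h
      · exact Or.inr h
      · left
        exact ((continuousOn_wave hN h2).comp_continuous (f := fun y : ℝ => (s, y)) (by fun_prop)
          fun y => ⟨h, trivial⟩)
    rcases hcont with h | h
    · have he : (fun y => halfWave N (s, y)) =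
          {y : ℝ | (s, y) ∈ quadrant}.indicator (wave N s) := by
        ext y
        by_cases hy : (s, y) ∈ quadrant
        · rw [halfWave, Set.indicator_of_mem hy, Set.indicator_of_mem (by exact hy)]
        · rw [halfWave, Set.indicator_of_notMem hy, Set.indicator_of_notMem (by exact hy)]
      rw [he]
      exact h.measurable.indicator (measurableSet_quadrant.preimage (by fun_prop))
    · simp only [halfWave_of_nonpos h]; exact measurable_const
  refine continuousAt_of_dominated (bound := fun y => C / (1 + c * y ^ 2) * C') ?_ ?_
    ((integrable_div_one_add_mul_sq C hc).mul_const C') ?_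
  · refine Eventually.of_forall fun q => ?_
    exact ((hmeas _).mul ((hmeas _).comp (measurable_id.sub_const _))).aestronglyMeasurable
  · filter_upwards [h1, h3] with q hq hq'
    refine Eventually.of_forall fun y => ?_
    rw [norm_mul]
    refine mul_le_mul ((norm_halfWave_le _).trans (hb _ hq _))
      ((norm_halfWave_le _).trans ((hb' _ hq' _).trans (div_le_self hC'.le ?_))) (norm_nonneg _) ?_
    · have : 0 ≤ c' * (y - q.2.2) ^ 2 := by positivity
      simpa using this
    · positivity
  · have hne : ∀ a : ℝ, ∀ᵐ y : ℝ, y ≠ a := fun a => by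
      simp [ae_iff, measure_singleton]
    filter_upwards [hne 0, hne x] with y hy hy'
    refine ContinuousAt.mul ?_ ?_
    · exact (continuousAt_halfWave hN h2 hs hy).comp (x := (t, s, x))
        (f := fun q : ℝ × ℝ × ℝ => (q.2.1, y)) (by fun_prop)
    · exact (continuousAt_halfWave hN h2 hτ (sub_ne_zero.2 hy')).comp (x := (t, s, x))
        (f := fun q : ℝ × ℝ × ℝ => (q.1 - q.2.1, y - q.2.2)) (by fun_prop)


/-! ### The explicit formula for `x ≥ 0` -/

theorem continuous_calJ (N m : ℕ) : Continuous (calJ N m) := by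
  have : calJ N m = fun z => ∑ p ∈ rays N, rayCoeff N p * rayDir N p ^ m *
      Complex.exp (-rayDir N p * z) := funext (calJ_eq_sum_rays N m)
  rw [this]
  fun_prop

theorem exists_norm_calJ_le {N : ℕ} (hN : Even N) (h2 : 2 ≤ N) (m : ℕ) :
    ∃ C : ℝ, ∀ r : ℝ, 0 ≤ r → ‖calJ N m r‖ ≤ C := by
  refine ⟨∑ p ∈ rays N, ‖rayCoeff N p * rayDir N p ^ m‖, fun r hr => ?_⟩
  rw [calJ_eq_sum_rays]
  refine (norm_sum_le _ _).trans (Finset.sum_le_sum fun p hp => ?_)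
  rw [norm_mul]
  exact mul_le_of_le_one_right (norm_nonneg _)
    (norm_exp_neg_mul_le_one (re_rayDir_nonneg hN h2 hp) hr)

/-- On the relevant half-lines `𝒥_m` is bounded and the Mittag-Leffler factor grows at most linearly
in `ξ^N`, so `exp (-sξ^N)` prevails for every `s > 0`. -/
theorem integrableOn_integrand {N : ℕ} (hN : Even N) (h2 : 2 ≤ N) (m : ℕ) {t s x : ℝ} (hs : 0 < s)
    (hst : s < t) (hx : 0 ≤ x) : IntegrableOn (integrand N m t s x) (Set.Ioi 0) := by
  have hM0 : 0 < (rootsJ N).card := card_rootsJ_pos hN h2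
  have hN0 : (0 : ℝ) < N := by exact_mod_cast (by omega : 0 < N)
  have hb : 0 < ((m : ℝ) + (rootsK N).card) / N := by
    have : (0 : ℝ) < (rootsK N).card := by rw [card_rootsK hN h2]; exact_mod_cast hM0
    positivity
  obtain ⟨C, hC⟩ := exists_norm_calJ_le hN h2 m
  set b := ((m : ℝ) + (rootsK N).card) / N with hbdef
  set k := m + (rootsK N).card with hk
  have hcont : Continuous (integrand N m t s x) := by
    have h1 := continuous_calJ N m
    have h3 := continuous_mittagLeffler hb
    unfold integrand
    fun_prop
  have hG : Integrable (fun ξ : ℝ => (Real.Gamma b)⁻¹ * C * (ξ ^ k * Real.exp (-s * ξ ^ N)) +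
      (t - s) * (Real.Gamma (b + 1))⁻¹ * C * (ξ ^ (k + N) * Real.exp (-s * ξ ^ N)))
      (volume.restrict (Set.Ioi 0)) :=
    ((integrableOn_pow_mul_exp k h2 hs).const_mul _).add
      ((integrableOn_pow_mul_exp (k + N) h2 hs).const_mul _)
  refine Integrable.mono' hG hcont.aestronglyMeasurable ?_
  refine (ae_restrict_mem measurableSet_Ioi).mono fun ξ hξ => ?_
  have hξ : 0 < ξ := hξ
  have hu : 0 ≤ (t - s) * ξ ^ N := mul_nonneg (by linarith) (by positivity)
  have hE := norm_mittagLeffler_le hb hu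
  have hJ := hC (x * ξ) (by positivity)
  have hE' : (-((t : ℂ) - s) * (ξ : ℂ) ^ N) = -(((t - s) * ξ ^ N : ℝ) : ℂ) := by push_cast; ring
  rw [integrand, ofReal_exp_pow, hE', norm_mul, norm_mul, norm_mul, norm_pow, Complex.norm_real,
    Complex.norm_real, Real.norm_of_nonneg hξ.le, Real.norm_of_nonneg (Real.exp_nonneg _)]
  rw [Complex.ofReal_mul] at hJ
  have h0 : 0 ≤ ξ ^ k * Real.exp (-s * ξ ^ N) := by positivity
  refine (mul_le_mul (mul_le_mul_of_nonneg_left hJ h0) hE (norm_nonneg _)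
    (mul_nonneg h0 ((norm_nonneg _).trans hJ))).trans_eq ?_
  rw [pow_add]; ring

/-- After shifting `y` by `x`, the support conditions are `x + y > 0` and `y > 0`; the first is
implied by the second because `x ≥ 0`. -/
theorem density_eq_integral {N : ℕ} (h2 : 2 ≤ N) {t s x : ℝ} (hs : 0 < s) (hst : s < t)
    (hx : 0 ≤ x) :
    (density N t s x : ℂ) =
      ∫ y in Set.Ioi (0 : ℝ), wave N s (x + y) * wave N (t - s) y := by
  rw [ofReal_density h2, ← integral_add_right_eq_self _ x, ← integral_indicator measurableSet_Ioi]
  refine integral_congr_ae (Eventually.of_forall fun y => ?_)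
  simp only [add_sub_cancel_right]
  by_cases hy : 0 < y
  · rw [Set.indicator_of_mem (Set.mem_Ioi.2 hy), halfWave, halfWave, Set.indicator_of_mem,
      Set.indicator_of_mem, add_comm y x]
    · exact ⟨by simpa using hst, hy⟩
    · exact ⟨hs, by simp only [Set.mem_Ioi]; linarith⟩
  · rw [Set.indicator_of_notMem (by simpa using hy), halfWave, halfWave,
      Set.indicator_of_notMem (a := (t - s, y)) fun h => hy h.2, mul_zero]

/-- Insert the integral for `wave N s (x + y)` and integrate `y` first. On each ray `exp (-ω(x+y)ξ)`
splits, so the `y`-integral is the one of `laplace_wave`; the factors `ω^m` it produces turn the ray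
expansion of `𝒥_0` into that of `𝒥_m`. -/
theorem density_eq_sum {N : ℕ} (hN : Even N) (h2 : 2 ≤ N) {t s x : ℝ} (hs : 0 < s) (hst : s < t)
    (hx : 0 ≤ x) :
    (density N t s x : ℂ) = N * Complex.I / (2 * Real.pi) *
      ∑ m ∈ Finset.range ((rootsJ N).card + 1), beta N (-(m : ℤ)) *
        (((t - s) ^ (((m : ℝ) - (rootsJ N).card) / N) : ℝ) : ℂ) *
        ∫ ξ in Set.Ioi (0 : ℝ), integrand N m t s x ξ := by
  have hτ : 0 < t - s := by linarith
  obtain ⟨C, hC⟩ := exists_norm_calJ_le hN h2 0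
  set M := (rootsJ N).card with hM
  set W : ℝ → ℝ → ℂ := fun y ξ => ((ξ : ℂ) ^ M * Complex.exp (-s * ξ ^ N) *
    calJ N 0 (((x + y) * ξ : ℝ) : ℂ)) * wave N (t - s) y with hW
  have hint : Integrable (Function.uncurry W)
      ((volume.restrict (Set.Ioi (0 : ℝ))).prod (volume.restrict (Set.Ioi (0 : ℝ)))) := by
    have h := ((integral_norm_wave hN h2 hτ).1).norm.mul_prod
      ((integrableOn_pow_mul_exp M h2 hs).const_mul C)
    refine h.mono' ?_ ?_
    · have h1 := continuous_calJ N 0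
      have h3 : Continuous (fun q : ℝ × ℝ => (q.2 : ℂ) ^ M * Complex.exp (-s * (q.2 : ℂ) ^ N) *
        calJ N 0 (((x + q.1) * q.2 : ℝ) : ℂ)) := by fun_prop
      exact h3.aestronglyMeasurable.mul
        (integral_norm_wave hN h2 hτ).1.aestronglyMeasurable.comp_fst
    · rw [Measure.prod_restrict]
      refine (ae_restrict_mem measurableSet_quadrant).mono fun q hq => ?_
      have hq1 : 0 < q.1 := hq.1
      have hq2 : 0 < q.2 := hq.2
      have hJ := hC ((x + q.1) * q.2) (by positivity)
      simp only [Function.uncurry, hW]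
      rw [ofReal_exp_pow, norm_mul, norm_mul, norm_mul, norm_pow, Complex.norm_real,
        Complex.norm_real, Real.norm_of_nonneg hq2.le, Real.norm_of_nonneg (Real.exp_nonneg _),
        mul_comm ‖wave N (t - s) q.1‖]
      refine mul_le_mul_of_nonneg_right ?_ (norm_nonneg _)
      have h0 : 0 ≤ q.2 ^ M * Real.exp (-s * q.2 ^ N) := by positivity
      exact (mul_le_mul_of_nonneg_left hJ h0).trans_eq (mul_comm _ _)
  rw [density_eq_integral h2 hs hst hx]
  have h1 : ∫ y in Set.Ioi (0 : ℝ), wave N s (x + y) * wave N (t - s) y =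
      N * Complex.I / (2 * Real.pi) * ∫ y in Set.Ioi (0 : ℝ), ∫ ξ in Set.Ioi (0 : ℝ), W y ξ := by
    rw [← integral_const_mul]
    refine setIntegral_congr_fun measurableSet_Ioi fun y hy => ?_
    have hy : 0 < y := hy
    simp only [hW]
    rw [integral_mul_const, ← mul_assoc, wave, abs_of_nonneg (by linarith : 0 ≤ x + y)]
  rw [h1, integral_integral_swap hint]
  congr 1
  simp only [← integral_const_mul]
  rw [← integral_finsetSum _ fun m _ => (integrableOn_integrand hN h2 m hs hst hx).const_mul _]
  refine setIntegral_congr_fun measurableSet_Ioi fun ξ hξ => ?_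
  have hξ : 0 < ξ := hξ
  have h3 : ∀ y : ℝ, W y ξ = ∑ p ∈ rays N, ((ξ : ℂ) ^ M * Complex.exp (-s * ξ ^ N) *
      (rayCoeff N p * Complex.exp (-rayDir N p * (x * ξ)))) *
      (Complex.exp (-(rayDir N p * ξ) * y) * wave N (t - s) y) := by
    intro y
    simp only [hW]
    rw [calJ_eq_sum_rays, Finset.mul_sum, Finset.sum_mul]
    refine Finset.sum_congr rfl fun p _ => ?_
    have : Complex.exp (-rayDir N p * (((x + y) * ξ : ℝ) : ℂ)) =
        Complex.exp (-rayDir N p * (x * ξ)) * Complex.exp (-(rayDir N p * ξ) * y) := by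
      rw [← Complex.exp_add]; congr 1; push_cast; ring
    rw [this, pow_zero]; ring
  simp only [h3]
  rw [integral_finsetSum]
  · simp only [integral_const_mul]
    rw [Finset.sum_congr rfl fun p hp => by rw [laplace_wave hN h2 hp hξ hτ, Finset.mul_sum],
      Finset.sum_comm]
    refine Finset.sum_congr rfl fun m _ => ?_
    rw [integrand, calJ_eq_sum_rays, card_rootsK hN h2, ← hM]
    have h4 : (-((t - s : ℝ) : ℂ) * ((ξ ^ N : ℝ) : ℂ)) = -((t : ℂ) - s) * (ξ : ℂ) ^ N := by
      push_cast; ring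
    rw [h4, pow_add]
    simp only [Finset.mul_sum, Finset.sum_mul]
    refine Finset.sum_congr rfl fun p _ => ?_
    ring
  · intro p hp
    refine Integrable.const_mul ?_ _
    refine (integral_norm_wave hN h2 hτ).1.norm.mono' ?_ ?_
    · exact (Continuous.aestronglyMeasurable (by fun_prop)).mul
        (integral_norm_wave hN h2 hτ).1.aestronglyMeasurable
    · refine (ae_restrict_mem measurableSet_Ioi).mono fun y hy => ?_
      rw [norm_mul]
      refine mul_le_of_le_one_left (norm_nonneg _) (norm_exp_neg_mul_le_one ?_ (le_of_lt hy))
      rw [Complex.re_mul_ofReal]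
      exact mul_nonneg (re_rayDir_nonneg hN h2 hp) hξ.le

/-! ### Uniqueness of the joint density -/

/-- Uniqueness of limits gives both densities the same transform. Their damped difference is
integrable and orthogonal to the functions `exp (-lt - ms + iμx)`, `l, m ∈ ℕ`, which separate
points. -/
theorem ae_eq_of_isJointDensity {N : ℕ} {f g : ℝ → ℝ → ℝ → ℝ} (hf : IsJointDensity N f)
    (hg : IsJointDensity N g) :
    ∀ᵐ q ∂(volume.restrict region), g q.1 q.2.1 q.2.2 = f q.1 q.2.1 q.2.2 := by
  set S : Set (ℝ × ℝ × ℝ) := {q | 0 ≤ q.1 ∧ 0 ≤ q.2.1} with hS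
  have hRS : region ⊆ S := fun q hq => ⟨(hq.1.trans hq.2).le, hq.1.le⟩
  -- The damping shifts `l` and `m` by one, so that `λ` and `ν` are positive even for `l = m = 0`.
  set d : ℝ × ℝ × ℝ → ℝ := fun q => Real.exp (-q.1 - q.2.1) *
    (g q.1 q.2.1 q.2.2 - f q.1 q.2.1 q.2.2) with hd
  have hexp : ∀ {lam : ℝ}, 0 < lam → ∀ {e : ℝ → ℝ → ℝ → ℝ}, IsJointDensity N e → ∀ μ ν : ℝ,
      0 ≤ ν → IntegrableOn (fun q : ℝ × ℝ × ℝ =>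
        Complex.exp (-lam * q.1 + Complex.I * μ * q.2.2 - ν * q.2.1) *
          (e q.1 q.2.1 q.2.2 : ℂ)) region := by
    intro lam hlam e he μ ν hν
    have h := (he.integrable lam hlam).ofReal (𝕜 := ℂ)
    have hb : Integrable (fun q : ℝ × ℝ × ℝ => Complex.exp (Complex.I * μ * q.2.2 - ν * q.2.1) *
        ((Real.exp (-lam * q.1) * e q.1 q.2.1 q.2.2 : ℝ) : ℂ)) (volume.restrict region) := by
      refine Integrable.bdd_mul (c := 1) h (Continuous.aestronglyMeasurable (by fun_prop)) ?_
      refine (ae_restrict_mem measurableSet_region).mono fun q hq => ?_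
      rw [Complex.norm_exp, Real.exp_le_one_iff]
      have h0 : (Complex.I * μ * q.2.2 - ν * q.2.1).re = -(ν * q.2.1) := by simp
      rw [h0]
      exact neg_nonpos.2 (mul_nonneg hν hq.1.le)
    refine hb.congr (Eventually.of_forall fun q => ?_)
    simp only
    rw [Complex.ofReal_mul, ← mul_assoc, Complex.ofReal_exp, ← Complex.exp_add]
    congr 2
    push_cast; ring
  have hdint : IntegrableOn d region := by
    have h := fun {e : ℝ → ℝ → ℝ → ℝ} (he : IsJointDensity N e) =>
      (hexp one_pos he 0 1 zero_le_one).re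
    refine ((h hg).sub (h hf)).congr (Eventually.of_forall fun q => ?_)
    have h3 : Complex.exp (-(1 : ℝ) * q.1 + Complex.I * (0 : ℝ) * q.2.2 - (1 : ℝ) * q.2.1) =
        ((Real.exp (-q.1 - q.2.1) : ℝ) : ℂ) := by
      push_cast; congr 1; ring
    simp only [Pi.sub_apply, hd]
    rw [h3, mul_sub, ← Complex.ofReal_mul, ← Complex.ofReal_mul]
    rfl
  have hzero := ae_eq_zero_of_transform_eq_zero (D := region.indicator d)
    ((integrable_indicator_iff measurableSet_region).2 hdint).integrableOn (fun l m μ => by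
      have h1 : (fun q : ℝ × ℝ × ℝ =>
          Complex.exp (-l * q.1 - m * q.2.1 + Complex.I * μ * q.2.2) *
            ((region.indicator d q : ℝ) : ℂ)) = region.indicator (fun q =>
          Complex.exp (-(l + 1 : ℝ) * q.1 + Complex.I * μ * q.2.2 - (m + 1 : ℝ) * q.2.1) *
            (g q.1 q.2.1 q.2.2 : ℂ) -
          Complex.exp (-(l + 1 : ℝ) * q.1 + Complex.I * μ * q.2.2 - (m + 1 : ℝ) * q.2.1) *
            (f q.1 q.2.1 q.2.2 : ℂ)) := by
        ext q
        by_cases hq : q ∈ region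
        · rw [Set.indicator_of_mem hq, Set.indicator_of_mem hq, hd, ← mul_sub]
          simp only
          rw [Complex.ofReal_mul, ← Complex.ofReal_sub]
          rw [← mul_assoc, Complex.ofReal_exp, ← Complex.exp_add]
          congr 2
          push_cast; ring
        · rw [Set.indicator_of_notMem hq, Set.indicator_of_notMem hq, Complex.ofReal_zero,
            mul_zero]
      have hl : (0 : ℝ) < l + 1 := by positivity
      have hm : (0 : ℝ) < m + 1 := by positivity
      rw [h1, setIntegral_indicator measurableSet_region, Set.inter_eq_self_of_subset_right hRS,
        integral_sub (hexp hl hg μ _ hm.le) (hexp hl hf μ _ hm.le), sub_eq_zero]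
      exact tendsto_nhds_unique (hg.transform _ μ _ hl hm).2.2 (hf.transform _ μ _ hl hm).2.2)
  have h4 := ae_restrict_of_ae_restrict_of_subset hRS hzero
  filter_upwards [h4, ae_restrict_mem measurableSet_region] with q hq hqr
  rw [Set.indicator_of_mem hqr, hd] at hq
  rcases mul_eq_zero.1 hq with h | h
  · exact absurd h (Real.exp_pos _).ne'
  · linarith


/-! ### Fourier transforms of integrable functions of one variable -/

open scoped FourierTransform

/-- `∫ e^{iμx} u(x) dx`. -/
noncomputable def fourierInt (u : ℝ → ℂ) (μ : ℝ) : ℂ := ∫ x : ℝ, Complex.exp (Complex.I * μ * x) * u x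

theorem fourierInt_eq (u : ℝ → ℂ) (μ : ℝ) : fourierInt u μ = 𝓕 u (-μ / (2 * Real.pi)) := by
  rw [Real.fourier_real_eq_integral_exp_smul, fourierInt]
  refine integral_congr_ae (Eventually.of_forall fun x => ?_)
  simp only [smul_eq_mul]
  congr 2
  push_cast
  have : (Real.pi : ℂ) ≠ 0 := by exact_mod_cast Real.pi_ne_zero
  field_simp

theorem norm_exp_I_mul_mul (μ x : ℝ) : ‖Complex.exp (Complex.I * μ * x)‖ = 1 := by
  rw [show Complex.I * μ * x = ((μ * x : ℝ) : ℂ) * Complex.I by push_cast; ring,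
    Complex.norm_exp_ofReal_mul_I]

theorem integrable_exp_I_mul {u : ℝ → ℂ} (hu : Integrable u) (μ : ℝ) :
    Integrable fun x : ℝ => Complex.exp (Complex.I * μ * x) * u x :=
  hu.bdd_mul (c := 1) (Continuous.aestronglyMeasurable (by fun_prop))
    (Eventually.of_forall fun x => (norm_exp_I_mul_mul μ x).le)

theorem norm_fourierInt_le (u : ℝ → ℂ) (μ : ℝ) : ‖fourierInt u μ‖ ≤ ∫ x, ‖u x‖ := by
  refine (norm_integral_le_integral_norm _).trans_eq ?_
  simp only [norm_mul, norm_exp_I_mul_mul, one_mul]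

theorem ae_eq_zero_of_fourierInt_eq_zero_real {D : ℝ → ℝ} (hD : Integrable D)
    (h0 : ∀ μ, fourierInt (fun x => (D x : ℂ)) μ = 0) : ∀ᵐ x, D x = 0 := by
  have h := ae_eq_zero_on_of_forall_setIntegral_eq_zero (μ := (volume : Measure ℝ))
    (C := Set.univ) isClosed_univ hD.integrableOn
    (Set.range fun μ : ℝ => fun x : ℝ => Complex.exp (Complex.I * μ * x)) ?_ ?_ ?_ ?_ ?_ ?_ ?_
  · rwa [Measure.restrict_univ] at h
  · rintro _ ⟨μ, rfl⟩; fun_prop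
  · rintro _ ⟨μ, rfl⟩ x -; exact (norm_exp_I_mul_mul μ x).le
  · exact ⟨0, by ext x; simp⟩
  · rintro _ ⟨μ, rfl⟩ _ ⟨ν, rfl⟩
    refine ⟨μ + ν, ?_⟩
    ext x
    simp only
    rw [← Complex.exp_add]; congr 1; push_cast; ring
  · rintro _ ⟨μ, rfl⟩
    refine ⟨-μ, ?_⟩
    ext x
    simp only
    rw [← Complex.exp_conj]
    simp
  · intro x _ y _ hxy
    have hsub : (x : ℂ) - y ≠ 0 := by
      rw [← Complex.ofReal_sub]; exact_mod_cast sub_ne_zero.2 hxy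
    refine ⟨_, ⟨Real.pi / (x - y), rfl⟩, fun h => ?_⟩
    simp only at h
    have h1 : Complex.exp (Complex.I * ((Real.pi / (x - y) : ℝ) : ℂ) * x) =
        Complex.exp (Complex.I * ((Real.pi / (x - y) : ℝ) : ℂ) * y) *
          Complex.exp (Real.pi * Complex.I) := by
      rw [← Complex.exp_add]
      congr 1
      push_cast
      field_simp
      ring
    rw [h1, Complex.exp_pi_mul_I, mul_neg_one, neg_eq_self] at h
    exact Complex.exp_ne_zero _ h
  · rintro _ ⟨μ, rfl⟩
    rw [Measure.restrict_univ]
    exact h0 μ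

/-- The transform of the conjugate at `μ` is the conjugate of the transform at `-μ`, so real and
imaginary parts also have vanishing transforms. -/
theorem ae_eq_zero_of_fourierInt_eq_zero {u : ℝ → ℂ} (hu : Integrable u)
    (h0 : ∀ μ, fourierInt u μ = 0) : ∀ᵐ x, u x = 0 := by
  have hconj : ∀ μ : ℝ, ∫ x : ℝ, Complex.exp (Complex.I * μ * x) * (starRingEnd ℂ) (u x) = 0 := by
    intro μ
    have h := congrArg (starRingEnd ℂ) (h0 (-μ))
    rw [fourierInt, ← integral_conj, map_zero] at h
    rw [← h]
    refine integral_congr_ae (Eventually.of_forall fun x => ?_)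
    simp only
    rw [map_mul, ← Complex.exp_conj]
    simp only [map_mul, Complex.conj_I, Complex.conj_ofReal, Complex.ofReal_neg, map_neg,
      neg_mul_neg]
  have hcint : Integrable fun x => (starRingEnd ℂ) (u x) :=
    (Complex.conjLIE.toContinuousLinearEquiv : ℂ →L[ℝ] ℂ).integrable_comp hu
  have hre := ae_eq_zero_of_fourierInt_eq_zero_real hu.re fun μ => by
    have h : ∀ x : ℝ, Complex.exp (Complex.I * μ * x) * ((RCLike.re (u x) : ℝ) : ℂ) =
        (1 / 2) * (Complex.exp (Complex.I * μ * x) * u x +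
          Complex.exp (Complex.I * μ * x) * (starRingEnd ℂ) (u x)) := by
      intro x
      rw [show ((RCLike.re (u x) : ℝ) : ℂ) = ((u x).re : ℂ) from rfl, Complex.re_eq_add_conj]; ring
    rw [fourierInt]
    simp only [h]
    rw [integral_const_mul, integral_add (integrable_exp_I_mul hu μ) (integrable_exp_I_mul hcint μ),
      hconj, add_zero, ← fourierInt, h0, mul_zero]
  have him := ae_eq_zero_of_fourierInt_eq_zero_real hu.im fun μ => by
    have h : ∀ x : ℝ, Complex.exp (Complex.I * μ * x) * ((RCLike.im (u x) : ℝ) : ℂ) =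
        (1 / (2 * Complex.I)) * (Complex.exp (Complex.I * μ * x) * u x -
          Complex.exp (Complex.I * μ * x) * (starRingEnd ℂ) (u x)) := by
      intro x
      rw [show ((RCLike.im (u x) : ℝ) : ℂ) = ((u x).im : ℂ) from rfl, Complex.im_eq_sub_conj]; ring
    rw [fourierInt]
    simp only [h]
    rw [integral_const_mul, integral_sub (integrable_exp_I_mul hu μ) (integrable_exp_I_mul hcint μ),
      hconj, sub_zero, ← fourierInt, h0, mul_zero]
  filter_upwards [hre, him] with x h1 h3
  exact Complex.ext h1 h3

/-! ### The heat-type kernel -/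

/-- `e^{-tμ^N}`. -/
noncomputable def heatSymbol (N : ℕ) (t μ : ℝ) : ℂ := Complex.exp (-t * μ ^ N)

theorem integrable_pow_mul_heatSymbol {N : ℕ} (hN : Even N) (h2 : 2 ≤ N) (k : ℕ) {t : ℝ}
    (ht : 0 < t) : Integrable fun μ : ℝ => (μ : ℂ) ^ k * heatSymbol N t μ := by
  have hcont : Continuous fun μ : ℝ => (μ : ℂ) ^ k * heatSymbol N t μ := by
    unfold heatSymbol; fun_prop
  have hpos : IntegrableOn (fun μ : ℝ => |μ| ^ k * Real.exp (-t * |μ| ^ N)) (Set.Ioi 0) :=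
    (integrableOn_pow_mul_exp k h2 ht).congr_fun (fun μ hμ => by
      rw [abs_of_pos (Set.mem_Ioi.1 hμ)]) measurableSet_Ioi
  have hall : Integrable fun μ : ℝ => |μ| ^ k * Real.exp (-t * |μ| ^ N) := by
    rw [← integrableOn_univ, ← Set.Iic_union_Ioi (a := (0 : ℝ))]
    refine IntegrableOn.union ?_ hpos
    rw [integrableOn_Iic_iff_integrableOn_Iio]
    have h := hpos.comp_neg
    simpa using h
  refine hall.mono' hcont.aestronglyMeasurable (Eventually.of_forall fun μ => ?_)
  rw [heatSymbol, ofReal_exp_pow, norm_mul, norm_pow, Complex.norm_real, Complex.norm_real,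
    Real.norm_of_nonneg (Real.exp_nonneg _), Real.norm_eq_abs, hN.pow_abs]

theorem integrable_heatSymbol {N : ℕ} (hN : Even N) (h2 : 2 ≤ N) {t : ℝ} (ht : 0 < t) :
    Integrable (heatSymbol N t) := by
  simpa using integrable_pow_mul_heatSymbol hN h2 0 ht

/-- The symbol is real and even, hence the inversion integral is real and the real part in the
definition discards nothing. -/
theorem ofReal_heatKernel {N : ℕ} (hN : Even N) (t x : ℝ) :
    (heatKernel N t x : ℂ) = 1 / (2 * Real.pi) * fourierInt (heatSymbol N t) x := by
  have h1 : (∫ μ : ℝ, Complex.exp (-Complex.I * μ * x) *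
      Complex.exp (kappa N * t * (-Complex.I * μ) ^ N)) = fourierInt (heatSymbol N t) x := by
    rw [fourierInt, ← integral_neg_eq_self]
    refine integral_congr_ae (Eventually.of_forall fun μ => ?_)
    simp only
    rw [mul_right_comm (kappa N : ℂ), kappa_mul_neg_I_mul_pow hN, heatSymbol]
    push_cast
    rw [hN.neg_pow]
    congr 2 <;> ring
  have h3 : (starRingEnd ℂ) (fourierInt (heatSymbol N t) x) = fourierInt (heatSymbol N t) x := by
    rw [fourierInt, ← integral_conj, ← integral_neg_eq_self]
    refine integral_congr_ae (Eventually.of_forall fun μ => ?_)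
    simp only
    rw [map_mul, heatSymbol, heatSymbol, ← Complex.exp_conj, ← Complex.exp_conj]
    simp only [map_mul, map_neg, map_pow, Complex.conj_ofReal, Complex.conj_I, Complex.ofReal_neg]
    rw [hN.neg_pow]
    congr 2; ring
  rw [heatKernel, h1, Complex.ofReal_mul, Complex.conj_eq_iff_re.1 h3]
  push_cast; rfl

theorem heatKernel_neg {N : ℕ} (hN : Even N) (t x : ℝ) : heatKernel N t (-x) = heatKernel N t x := by
  have h : (heatKernel N t (-x) : ℂ) = heatKernel N t x := by
    rw [ofReal_heatKernel hN, ofReal_heatKernel hN, fourierInt, ← integral_neg_eq_self, fourierInt]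
    congr 1
    refine integral_congr_ae (Eventually.of_forall fun μ => ?_)
    simp only [heatSymbol]
    push_cast
    rw [hN.neg_pow]
    congr 2; ring
  exact_mod_cast h

theorem heatKernel_scaling {N : ℕ} (hN : Even N) (h2 : 2 ≤ N) {t : ℝ} (ht : 0 < t) (x : ℝ) :
    heatKernel N t x = t ^ (-(1 : ℝ) / N) * heatKernel N 1 (x * t ^ (-(1 : ℝ) / N)) := by
  have hc : 0 < t ^ (-(1 : ℝ) / N) := Real.rpow_pos_of_pos ht _
  have hcN : t * (t ^ (-(1 : ℝ) / N)) ^ N = 1 := by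
    have hN0 : (N : ℝ) ≠ 0 := by exact_mod_cast (by omega : N ≠ 0)
    rw [← Real.rpow_natCast, ← Real.rpow_mul ht.le, div_mul_cancel₀ _ hN0, Real.rpow_neg_one,
      mul_inv_cancel₀ ht.ne']
  set c := t ^ (-(1 : ℝ) / N) with hcdef
  have h : (heatKernel N t x : ℂ) = ((c * heatKernel N 1 (x * c) : ℝ) : ℂ) := by
    rw [Complex.ofReal_mul, ofReal_heatKernel hN, ofReal_heatKernel hN, fourierInt]
    have h3 := Measure.integral_comp_mul_left (fun μ : ℝ =>
      Complex.exp (Complex.I * x * μ) * heatSymbol N t μ) c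
    rw [abs_of_pos (inv_pos.2 hc), Complex.real_smul] at h3
    have h4 : fourierInt (heatSymbol N 1) (x * c) = ∫ μ : ℝ,
        Complex.exp (Complex.I * x * (c * μ : ℝ)) * heatSymbol N t (c * μ) := by
      refine integral_congr_ae (Eventually.of_forall fun μ => ?_)
      simp only [heatSymbol]
      congr 2
      · push_cast; ring
      · have : ((t : ℂ) * (c : ℂ) ^ N) = 1 := by exact_mod_cast hcN
        push_cast; rw [mul_pow]; linear_combination (μ : ℂ) ^ N * this
    rw [h4, h3]
    have : (c : ℂ) ≠ 0 := by exact_mod_cast hc.ne'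
    push_cast
    field_simp
  exact_mod_cast h

theorem hasDerivAt_heatSymbol (N : ℕ) (t μ : ℝ) :
    HasDerivAt (heatSymbol N t) (-t * N * ((μ : ℂ) ^ (N - 1) * heatSymbol N t μ)) μ := by
  have h : HasDerivAt (fun z : ℂ => Complex.exp (-t * z ^ N))
      (Complex.exp (-t * (μ : ℂ) ^ N) * (-t * (N * (μ : ℂ) ^ (N - 1)))) (μ : ℂ) :=
    ((hasDerivAt_pow N (μ : ℂ)).const_mul (-t : ℂ)).cexp
  refine h.comp_ofReal.congr_deriv ?_
  rw [heatSymbol]; ring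

/-- The symbol has two integrable derivatives. The resulting quadratic decay makes the kernel
absolutely integrable, without any information on its sign. -/
theorem exists_norm_fourier_heatSymbol_le {N : ℕ} (hN : Even N) (h2 : 2 ≤ N) {t : ℝ} (ht : 0 < t) :
    ∃ C : ℝ, ∀ v : ℝ, ‖𝓕 (heatSymbol N t) v‖ ≤ C * (1 + v ^ 2)⁻¹ := by
  set G := heatSymbol N t with hG
  have hd1 : deriv G = fun μ : ℝ => -t * N * ((μ : ℂ) ^ (N - 1) * heatSymbol N t μ) :=
    funext fun μ => (hasDerivAt_heatSymbol N t μ).deriv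
  have hdiff : Differentiable ℝ G := fun μ => (hasDerivAt_heatSymbol N t μ).differentiableAt
  have hpow : ∀ (k : ℕ) (μ : ℝ), HasDerivAt (fun μ : ℝ => (μ : ℂ) ^ k)
      (k * (μ : ℂ) ^ (k - 1)) μ := fun k μ => (hasDerivAt_pow k (μ : ℂ)).comp_ofReal
  have hd2' : ∀ μ : ℝ, HasDerivAt (deriv G) (-t * N * (((N - 1 : ℕ) : ℂ) * ((μ : ℂ) ^ (N - 1 - 1) *
      heatSymbol N t μ) + (-t * N) * ((μ : ℂ) ^ (N - 1 + (N - 1)) * heatSymbol N t μ))) μ := by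
    intro μ
    rw [hd1]
    refine (((hpow (N - 1) μ).mul (hasDerivAt_heatSymbol N t μ)).const_mul (-t * N : ℂ)).congr_deriv ?_
    rw [pow_add]; ring
  have hd2 := funext fun μ => (hd2' μ).deriv
  have hi := fun k => integrable_pow_mul_heatSymbol hN h2 k ht
  have hi0 : Integrable G := integrable_heatSymbol hN h2 ht
  have hi1 : Integrable (deriv G) := by
    rw [hd1]; exact (hi _).const_mul _
  have hi2 : Integrable (deriv (deriv G)) := by
    rw [hd2]; exact (((hi _).const_mul _).add ((hi _).const_mul _)).const_mul _
  have hF := Real.fourier_deriv hi1 (fun μ => (hd2' μ).differentiableAt) hi2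
  rw [Real.fourier_deriv hi0 hdiff hi1] at hF
  refine ⟨(∫ μ, ‖G μ‖) + ∫ μ, ‖deriv (deriv G) μ‖, fun v => ?_⟩
  have hb : ∀ u : ℝ → ℂ, ‖𝓕 u v‖ ≤ ∫ μ, ‖u μ‖ := fun u =>
    VectorFourier.norm_fourierIntegral_le_integral_norm _ _ _ _ _
  have h0 := hb G
  have h3 := hb (deriv (deriv G))
  rw [hF] at h3
  simp only [smul_eq_mul, norm_mul, Complex.norm_ofNat, Complex.norm_real, Complex.norm_I,
    Real.norm_of_nonneg Real.pi_pos.le, mul_one, Real.norm_eq_abs] at h3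
  have h4 : 2 * Real.pi * |v| * (2 * Real.pi * |v| * ‖𝓕 G v‖) =
      4 * Real.pi ^ 2 * (v ^ 2 * ‖𝓕 G v‖) := by rw [← sq_abs v]; ring
  have h5 : v ^ 2 * ‖𝓕 G v‖ ≤ 4 * Real.pi ^ 2 * (v ^ 2 * ‖𝓕 G v‖) := by
    refine le_mul_of_one_le_left (by positivity) ?_
    nlinarith [Real.pi_gt_three]
  rw [← div_eq_mul_inv, le_div_iff₀ (by positivity)]
  linarith

theorem integrable_fourier_heatSymbol {N : ℕ} (hN : Even N) (h2 : 2 ≤ N) {t : ℝ} (ht : 0 < t) :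
    Integrable (𝓕 (heatSymbol N t)) := by
  obtain ⟨C, hC⟩ := exists_norm_fourier_heatSymbol_le hN h2 ht
  refine (integrable_inv_one_add_sq.const_mul C).mono' ?_ (Eventually.of_forall hC)
  exact (VectorFourier.fourierIntegral_continuous Real.continuous_fourierChar
    (innerSL ℝ).continuous₂ (integrable_heatSymbol hN h2 ht)).aestronglyMeasurable

theorem ofReal_heatKernel_eq_fourier {N : ℕ} (hN : Even N) (t x : ℝ) :
    (heatKernel N t x : ℂ) =
      1 / (2 * Real.pi) * 𝓕 (heatSymbol N t) (x * (-(1 / (2 * Real.pi)))) := by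
  rw [ofReal_heatKernel hN, fourierInt_eq]
  congr 2; field_simp

theorem continuous_heatKernel {N : ℕ} (hN : Even N) (h2 : 2 ≤ N) {t : ℝ} (ht : 0 < t) :
    Continuous (heatKernel N t) := by
  have h : Continuous (𝓕 (heatSymbol N t)) :=
    VectorFourier.fourierIntegral_continuous Real.continuous_fourierChar
      (innerSL ℝ).continuous₂ (integrable_heatSymbol hN h2 ht)
  have h3 : Continuous fun x => (heatKernel N t x : ℂ) := by
    simp only [ofReal_heatKernel_eq_fourier hN]; fun_prop
  exact Complex.continuous_re.comp h3

theorem integrable_heatKernel {N : ℕ} (hN : Even N) (h2 : 2 ≤ N) {t : ℝ} (ht : 0 < t) :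
    Integrable (heatKernel N t) := by
  have h := ((integrable_fourier_heatSymbol hN h2 ht).comp_mul_right'
    (R := -(1 / (2 * Real.pi))) (neg_ne_zero.2 (by positivity))).const_mul (1 / (2 * Real.pi) : ℂ)
  have h3 : Integrable fun x => (heatKernel N t x : ℂ) :=
    h.congr (Eventually.of_forall fun x => (ofReal_heatKernel_eq_fourier hN t x).symm)
  exact h3.re

/-- The Fourier transform of the heat-type kernel. -/
theorem fourierInt_heatKernel {N : ℕ} (hN : Even N) (h2 : 2 ≤ N) {t : ℝ} (ht : 0 < t) (μ : ℝ) :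
    fourierInt (fun x => (heatKernel N t x : ℂ)) μ = heatSymbol N t μ := by
  have hcont : Continuous (heatSymbol N t) := by unfold heatSymbol; fun_prop
  have h := congrFun (hcont.fourierInv_fourier_eq (integrable_heatSymbol hN h2 ht)
    (integrable_fourier_heatSymbol hN h2 ht)) (-μ)
  have hev : heatSymbol N t (-μ) = heatSymbol N t μ := by
    simp only [heatSymbol]; push_cast; rw [hN.neg_pow]
  rw [hev, Real.fourierInv_eq_fourier_neg, neg_neg, Real.fourier_real_eq_integral_exp_smul] at h
  rw [← h, fourierInt]
  have h3 := Measure.integral_comp_mul_right (fun v : ℝ =>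
    Complex.exp (((-2 * Real.pi * v * μ : ℝ) : ℂ) * Complex.I) • 𝓕 (heatSymbol N t) v)
    (-(1 / (2 * Real.pi)))
  have h4 : |(-(1 / (2 * Real.pi)))⁻¹| = 2 * Real.pi := by
    rw [inv_neg, one_div, inv_inv, abs_neg, abs_of_pos Real.two_pi_pos]
  rw [h4, Complex.real_smul] at h3
  have hpi : (Real.pi : ℂ) ≠ 0 := by exact_mod_cast Real.pi_ne_zero
  have h5 : ∀ x : ℝ, Complex.exp (Complex.I * μ * x) * (heatKernel N t x : ℂ) =
      1 / (2 * Real.pi) * (Complex.exp (((-2 * Real.pi * (x * (-(1 / (2 * Real.pi)))) * μ : ℝ) : ℂ) *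
        Complex.I) • 𝓕 (heatSymbol N t) (x * (-(1 / (2 * Real.pi))))) := by
    intro x
    rw [ofReal_heatKernel_eq_fourier hN, smul_eq_mul]
    have : (((-2 * Real.pi * (x * (-(1 / (2 * Real.pi)))) * μ : ℝ) : ℂ) * Complex.I) =
        Complex.I * μ * x := by push_cast; field_simp
    rw [this]; ring
  simp only [h5]
  rw [integral_const_mul, h3, ← mul_assoc]
  have h6 : (1 / (2 * Real.pi) : ℂ) * ((2 * Real.pi : ℝ) : ℂ) = 1 := by push_cast; field_simp
  rw [h6, one_mul]

/-- The total variation of the pseudo-distribution. -/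
noncomputable def totalMass (N : ℕ) : ℝ := ∫ x, |heatKernel N 1 x|

theorem integral_abs_heatKernel {N : ℕ} (hN : Even N) (h2 : 2 ≤ N) {t : ℝ} (ht : 0 < t) :
    ∫ x, |heatKernel N t x| = totalMass N := by
  have hc : 0 < t ^ (-(1 : ℝ) / N) := Real.rpow_pos_of_pos ht _
  have h : ∀ x, |heatKernel N t x| = t ^ (-(1 : ℝ) / N) * |heatKernel N 1 (x * t ^ (-(1 : ℝ) / N))| := by
    intro x
    rw [heatKernel_scaling hN h2 ht, abs_mul, abs_of_pos hc]
  simp only [h]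
  rw [integral_const_mul, Measure.integral_comp_mul_right (fun x => |heatKernel N 1 x|),
    abs_of_pos (inv_pos.2 hc), smul_eq_mul, mul_inv_cancel_left₀ hc.ne', totalMass]


/-! ### Fourier transforms of integrable functions carried by a set -/

open scoped FourierTransform Convolution

/-- `φ` is the Fourier transform of an integrable function which vanishes outside `S`. -/
def IsFourierOn (S : Set ℝ) (φ : ℝ → ℂ) : Prop :=
  ∃ u : ℝ → ℂ, Integrable u ∧ (∀ x ∉ S, u x = 0) ∧ ∀ μ, φ μ = fourierInt u μ

theorem isFourierOn_zero (S : Set ℝ) : IsFourierOn S 0 :=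
  ⟨0, integrable_zero _ _ _, fun _ _ => rfl, fun μ => by simp [fourierInt]⟩

theorem IsFourierOn.add {S : Set ℝ} {φ ψ : ℝ → ℂ} (hφ : IsFourierOn S φ) (hψ : IsFourierOn S ψ) :
    IsFourierOn S (φ + ψ) := by
  obtain ⟨u, hu, hu0, hue⟩ := hφ
  obtain ⟨v, hv, hv0, hve⟩ := hψ
  refine ⟨u + v, hu.add hv, fun x hx => by simp [hu0 x hx, hv0 x hx], fun μ => ?_⟩
  rw [Pi.add_apply, hue, hve, fourierInt, fourierInt, fourierInt,
    ← integral_add (integrable_exp_I_mul hu μ) (integrable_exp_I_mul hv μ)]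
  simp only [Pi.add_apply, mul_add]

theorem IsFourierOn.const_mul {S : Set ℝ} {φ : ℝ → ℂ} (hφ : IsFourierOn S φ) (c : ℂ) :
    IsFourierOn S fun μ => c * φ μ := by
  obtain ⟨u, hu, hu0, hue⟩ := hφ
  refine ⟨fun x => c * u x, hu.const_mul c, fun x hx => by simp [hu0 x hx], fun μ => ?_⟩
  simp only [hue, fourierInt]
  rw [← integral_const_mul]
  refine integral_congr_ae (Eventually.of_forall fun x => ?_)
  simp only; ring

theorem IsFourierOn.sum {ι : Type*} {S : Set ℝ} {s : Finset ι} {φ : ι → ℝ → ℂ}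
    (h : ∀ i ∈ s, IsFourierOn S (φ i)) : IsFourierOn S fun μ => ∑ i ∈ s, φ i μ := by
  classical
  induction s using Finset.induction_on with
  | empty => simp only [Finset.sum_empty]; exact isFourierOn_zero S
  | insert i s hi ih =>
    simp only [Finset.sum_insert hi]
    exact (h i (Finset.mem_insert_self i s)).add
      (ih fun j hj => h j (Finset.mem_insert_of_mem hj))

/-- The product comes from the convolution, which is carried by `S` because `S` is closed under
addition. -/
theorem IsFourierOn.mul {S : Set ℝ} (hS : ∀ x ∈ S, ∀ y ∈ S, x + y ∈ S) {φ ψ : ℝ → ℂ}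
    (hφ : IsFourierOn S φ) (hψ : IsFourierOn S ψ) : IsFourierOn S fun μ => φ μ * ψ μ := by
  obtain ⟨u, hu, hu0, hue⟩ := hφ
  obtain ⟨v, hv, hv0, hve⟩ := hψ
  refine ⟨u ⋆[ContinuousLinearMap.mul ℂ ℂ] v, hu.integrable_convolution _ hv, fun x hx => ?_,
    fun μ => ?_⟩
  · rw [convolution_def]
    refine integral_eq_zero_of_ae (Eventually.of_forall fun t => ?_)
    simp only [ContinuousLinearMap.mul_apply', Pi.zero_apply, mul_eq_zero]
    by_contra! h
    refine hx ?_
    have := hS t (by_contra fun ht => h.1 (hu0 t ht)) (x - t) (by_contra fun ht => h.2 (hv0 _ ht))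
    simpa using this
  · simp only [hue, hve]
    rw [fourierInt_eq, fourierInt_eq, fourierInt_eq, Real.fourier_mul_convolution_eq hu hv]

theorem eq_zero_of_isFourierOn_of_disjoint {S T : Set ℝ} (hST : Disjoint S T) {φ : ℝ → ℂ}
    (h : IsFourierOn S φ) (h' : IsFourierOn T φ) : φ = 0 := by
  obtain ⟨u, hu, hu0, hue⟩ := h
  obtain ⟨v, hv, hv0, hve⟩ := h'
  have hae := ae_eq_zero_of_fourierInt_eq_zero (hu.sub hv) fun μ => by
    have : fourierInt (u - v) μ = fourierInt u μ - fourierInt v μ := by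
      rw [fourierInt, fourierInt, fourierInt,
        ← integral_sub (integrable_exp_I_mul hu μ) (integrable_exp_I_mul hv μ)]
      simp only [Pi.sub_apply, mul_sub]
    rw [this, ← hue, ← hve, sub_self]
  ext μ
  rw [hue, fourierInt]
  refine integral_eq_zero_of_ae ?_
  filter_upwards [hae] with x hx
  have : u x = 0 := by
    by_cases hxS : x ∈ S
    · rw [Pi.sub_apply, hv0 x (Set.disjoint_left.1 hST hxS), sub_zero] at hx; exact hx
    · exact hu0 x hxS
  rw [this, mul_zero]; rfl

theorem isFourierOn_indicator {S : Set ℝ} (hS : MeasurableSet S) {u : ℝ → ℂ} (hu : Integrable u) :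
    IsFourierOn S (fourierInt (S.indicator u)) :=
  ⟨S.indicator u, hu.indicator hS, fun _ hx => Set.indicator_of_notMem hx _, fun _ => rfl⟩

theorem fourierInt_indicator_add {u : ℝ → ℂ} (hu : Integrable u) (μ : ℝ) :
    fourierInt ((Set.Ici 0).indicator u) μ + fourierInt ((Set.Iio 0).indicator u) μ =
      fourierInt u μ := by
  rw [fourierInt, fourierInt, ← integral_add
    (integrable_exp_I_mul (hu.indicator measurableSet_Ici) μ)
    (integrable_exp_I_mul (hu.indicator measurableSet_Iio) μ), fourierInt]
  refine integral_congr_ae (Eventually.of_forall fun x => ?_)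
  simp only
  rw [← mul_add]
  congr 1
  rcases le_or_gt 0 x with h | h
  · rw [Set.indicator_of_mem (Set.mem_Ici.2 h), Set.indicator_of_notMem (by simpa using h), add_zero]
  · rw [Set.indicator_of_notMem (by simpa using h), Set.indicator_of_mem (Set.mem_Iio.2 h), zero_add]

theorem disjoint_Ici_Iio : Disjoint (Set.Ici (0 : ℝ)) (Set.Iio 0) :=
  Set.disjoint_left.2 fun _ h h' => not_lt.2 (Set.mem_Ici.1 h) (Set.mem_Iio.1 h')

/-- `φ - φ' = ψ' - ψ` is carried by two disjoint half-lines, hence zero. This uniqueness of the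
Wiener–Hopf splitting serves twice: for Spitzer's identity and for the Laplace transforms of the
half-line parts of the kernel. -/
theorem eq_of_isFourierOn_add_eq {φ ψ φ' ψ' : ℝ → ℂ} (hφ : IsFourierOn (Set.Ici 0) φ)
    (hφ' : IsFourierOn (Set.Ici 0) φ') (hψ : IsFourierOn (Set.Iio 0) ψ)
    (hψ' : IsFourierOn (Set.Iio 0) ψ') (h : ∀ μ, φ μ + ψ μ = φ' μ + ψ' μ) : φ = φ' ∧ ψ = ψ' := by
  have h1 := hφ.add (hφ'.const_mul (-1))
  have h2 := hψ'.add (hψ.const_mul (-1))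
  have he : (φ + fun μ => -1 * φ' μ) = ψ' + fun μ => -1 * ψ μ := by
    ext μ; simp only [Pi.add_apply]; linear_combination h μ
  have h0 := eq_zero_of_isFourierOn_of_disjoint disjoint_Ici_Iio h1 (he ▸ h2)
  have hφe : φ = φ' := by
    ext μ
    have := congrFun h0 μ
    simp only [Pi.add_apply, Pi.zero_apply] at this
    linear_combination this
  refine ⟨hφe, ?_⟩
  ext μ
  have := h μ
  rw [hφe] at this
  exact add_left_cancel this

theorem add_mem_Ici (x : ℝ) (hx : x ∈ Set.Ici (0 : ℝ)) (y : ℝ) (hy : y ∈ Set.Ici (0 : ℝ)) :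
    x + y ∈ Set.Ici (0 : ℝ) :=
  Set.mem_Ici.2 (add_nonneg (Set.mem_Ici.1 hx) (Set.mem_Ici.1 hy))

theorem add_mem_Iio (x : ℝ) (hx : x ∈ Set.Iio (0 : ℝ)) (y : ℝ) (hy : y ∈ Set.Iio (0 : ℝ)) :
    x + y ∈ Set.Iio (0 : ℝ) :=
  Set.mem_Iio.2 (add_neg (Set.mem_Iio.1 hx) (Set.mem_Iio.1 hy))


/-! ### The coefficients of the exponential of a power series -/

/-- The coefficients of `exp (∑_{k ≥ 1} c_k X^k / k)`. -/
noncomputable def expCoeff (c : ℕ → ℂ) : ℕ → ℂ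
  | 0 => 1
  | k + 1 => (∑ j : Fin (k + 1), c (j + 1) * expCoeff c (k - j)) / (k + 1)

theorem expCoeff_zero (c : ℕ → ℂ) : expCoeff c 0 = 1 := by rw [expCoeff]

theorem expCoeff_succ (c : ℕ → ℂ) (k : ℕ) : expCoeff c (k + 1) =
    (∑ j ∈ Finset.range (k + 1), c (j + 1) * expCoeff c (k - j)) / (k + 1) := by
  rw [expCoeff, Finset.sum_range]

theorem eq_expCoeff {c b : ℕ → ℂ} (h0 : b 0 = 1) (h : ∀ k : ℕ, (k + 1) * b (k + 1) =
    ∑ j ∈ Finset.range (k + 1), c (j + 1) * b (k - j)) : b = expCoeff c := by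
  ext k
  induction k using Nat.strong_induction_on with
  | _ k ih =>
    rcases k with _ | k
    · rw [h0, expCoeff_zero]
    · have hk : (k : ℂ) + 1 ≠ 0 := by exact_mod_cast k.succ_ne_zero
      rw [expCoeff_succ, eq_div_iff hk, mul_comm, h]
      refine Finset.sum_congr rfl fun j _ => by rw [ih _ (by omega)]

theorem eq_of_hasSum_pow {a b : ℕ → ℂ} {f : ℂ → ℂ}
    (ha : ∀ᶠ x in 𝓝 (0 : ℂ), HasSum (fun k => a k * x ^ k) (f x))
    (hb : ∀ᶠ x in 𝓝 (0 : ℂ), HasSum (fun k => b k * x ^ k) (f x)) : a = b := by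
  have h : ∀ {c : ℕ → ℂ}, (∀ᶠ x in 𝓝 (0 : ℂ), HasSum (fun k => c k * x ^ k) (f x)) →
      HasFPowerSeriesAt f (FormalMultilinearSeries.ofScalars ℂ c) 0 := fun {c} hc => by
    rw [hasFPowerSeriesAt_iff]
    filter_upwards [hc] with x hx
    simpa only [FormalMultilinearSeries.coeff_ofScalars, smul_eq_mul, zero_add, mul_comm] using hx
  have he := (h ha).eq_formalMultilinearSeries (h hb)
  ext k
  have := congrArg (fun p => FormalMultilinearSeries.coeff p k) he
  simpa only [FormalMultilinearSeries.coeff_ofScalars] using this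

/-- The function `f(x) = exp (∑ c_{k+1} x^{k+1}/(k+1))` is holomorphic on a disc of radius larger
than `1` and satisfies `f' = D f` with `D = ∑ c_{k+1} x^k`. Its Taylor coefficients therefore obey
the recurrence of `expCoeff`, and the Taylor series is evaluated at `1`. -/
theorem hasSum_expCoeff {c : ℕ → ℂ} {C z : ℝ} (hz0 : 0 ≤ z) (hz : z < 1)
    (hc : ∀ k, ‖c k‖ ≤ C * z ^ k) :
    HasSum (expCoeff c) (Complex.exp (∑' k : ℕ, c (k + 1) / (k + 1))) := by
  obtain ⟨R, hR1, hzR⟩ : ∃ R : ℝ, 1 < R ∧ z * R < 1 := by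
    -- A radius between `1` and `1/z` that also makes sense for `z = 0`.
    refine ⟨2 / (1 + z), ?_, ?_⟩
    · rw [lt_div_iff₀ (by positivity)]; linarith
    · rw [mul_div_assoc', div_lt_one (by positivity)]; linarith
  have hR0 : 0 < R := by linarith
  have hC : 0 ≤ C := by simpa using (norm_nonneg _).trans (hc 0)
  set B : Set ℂ := Metric.ball 0 R with hB
  have hBmem : ∀ {x : ℂ}, x ∈ B → ‖x‖ < R := fun hx => by simpa [hB] using hx
  have h0B : (0 : ℂ) ∈ B := Metric.mem_ball_self hR0
  have hBo : IsOpen B := Metric.isOpen_ball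
  set L : ℂ → ℂ := fun x => ∑' k : ℕ, c (k + 1) / (k + 1) * x ^ (k + 1) with hL
  set D : ℂ → ℂ := fun x => ∑' k : ℕ, c (k + 1) * x ^ k with hD
  have hbd : ∀ (k : ℕ) (x : ℂ), x ∈ B → ‖c (k + 1) * x ^ k‖ ≤ C * z * (z * R) ^ k := by
    intro k x hx
    rw [norm_mul, norm_pow, mul_pow]
    calc ‖c (k + 1)‖ * ‖x‖ ^ k ≤ (C * z ^ (k + 1)) * R ^ k :=
          mul_le_mul (hc _) (pow_le_pow_left₀ (norm_nonneg _) (hBmem hx).le _) (by positivity)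
            (by positivity)
      _ = C * z * (z ^ k * R ^ k) := by ring
  have hsum : Summable fun k : ℕ => C * z * (z * R) ^ k :=
    (summable_geometric_of_lt_one (by positivity) hzR).mul_left _
  have hDsum : ∀ x ∈ B, HasSum (fun k : ℕ => c (k + 1) * x ^ k) (D x) := fun x hx =>
    (hsum.of_norm_bounded fun k => hbd k x hx).hasSum
  have hLD : ∀ x ∈ B, HasDerivAt L (D x) x := by
    intro x hx
    refine hasDerivAt_tsum_of_isPreconnected hsum hBo (convex_ball _ _).isPreconnected
      (g := fun (k : ℕ) x => c (k + 1) / (k + 1) * x ^ (k + 1)) ?_ hbd h0B ?_ hx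
    · intro k y _
      have hk : (k : ℂ) + 1 ≠ 0 := by exact_mod_cast k.succ_ne_zero
      refine ((hasDerivAt_pow (k + 1) y).const_mul _).congr_deriv ?_
      simp only [Nat.add_sub_cancel]
      push_cast
      field_simp
    · simp [summable_zero]
  set f : ℂ → ℂ := fun x => Complex.exp (L x) with hf
  have hfD : ∀ x ∈ B, HasDerivAt f (D x * f x) x := fun x hx =>
    ((hLD x hx).cexp).congr_deriv (mul_comm _ _)
  have hfdiff : DifferentiableOn ℂ f B := fun x hx =>
    (hfD x hx).differentiableAt.differentiableWithinAt
  have hDdiff : DifferentiableOn ℂ D B :=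
    Complex.differentiableOn_tsum_of_summable_norm hsum (fun k => by fun_prop) hBo hbd
  have hfa : AnalyticAt ℂ f 0 := hfdiff.analyticAt (hBo.mem_nhds h0B)
  have hDa : AnalyticAt ℂ D 0 := hDdiff.analyticAt (hBo.mem_nhds h0B)
  set b : ℕ → ℂ := fun k => ((k.factorial : ℂ))⁻¹ * iteratedDeriv k f 0 with hb
  have hDcoeff : (fun k => ((k.factorial : ℂ))⁻¹ * iteratedDeriv k D 0) = fun k => c (k + 1) := by
    refine eq_of_hasSum_pow (f := D) ?_ ?_
    · filter_upwards [hBo.mem_nhds h0B] with x hx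
      refine (Complex.hasSum_taylorSeries_on_ball hDdiff hx).congr_fun fun k => ?_
      simp only [smul_eq_mul, sub_zero]; ring
    · filter_upwards [hBo.mem_nhds h0B] with x hx using hDsum x hx
  have hfact : ∀ k : ℕ, (k.factorial : ℂ) ≠ 0 := fun k => by exact_mod_cast k.factorial_ne_zero
  have hDk : ∀ k : ℕ, iteratedDeriv k D 0 = k.factorial * c (k + 1) := fun k => by
    have := congrFun hDcoeff k
    rw [← this, mul_inv_cancel_left₀ (hfact k)]
  have hfk : ∀ k : ℕ, iteratedDeriv k f 0 = k.factorial * b k := fun k => by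
    rw [hb]; simp only; rw [mul_inv_cancel_left₀ (hfact k)]
  -- Leibniz' rule for the `k`-th derivative of `f' = D f` at `0`, divided by `k!`, is the
  -- recurrence.
  have hbe : b = expCoeff c := by
    refine eq_expCoeff ?_ fun k => ?_
    · simp [hb, hf, hL]
    · have h1 : deriv f =ᶠ[𝓝 0] D * f := by
        filter_upwards [hBo.mem_nhds h0B] with x hx using (hfD x hx).deriv
      have h3 := congrFun (iteratedDeriv_succ' (n := k) (f := f)) 0
      rw [h1.iteratedDeriv_eq, iteratedDeriv_mul hDa.contDiffAt hfa.contDiffAt, hfk] at h3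
      have h4 : ((k + 1).factorial : ℂ) * b (k + 1) =
          k.factorial * ((k + 1) * b (k + 1)) := by
        rw [Nat.factorial_succ]; push_cast; ring
      rw [h4] at h3
      refine mul_left_cancel₀ (hfact k) (h3.trans ?_)
      rw [Finset.mul_sum]
      refine Finset.sum_congr rfl fun j hj => ?_
      have hjk : j ≤ k := Nat.lt_succ_iff.1 (Finset.mem_range.1 hj)
      have h5 : (k.choose j : ℂ) * j.factorial * (k - j).factorial = k.factorial := by
        exact_mod_cast Nat.choose_mul_factorial_mul_factorial hjk
      rw [hDk, hfk, ← h5]; ring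
  have h1B : (1 : ℂ) ∈ B := by simpa [hB] using hR1
  have h := Complex.hasSum_taylorSeries_on_ball hfdiff h1B
  have he : f 1 = Complex.exp (∑' k : ℕ, c (k + 1) / (k + 1)) := by simp [hf, hL]
  rw [he] at h
  refine h.congr_fun fun k => ?_
  rw [← hbe]
  simp [hb]

theorem derivative_mk_expCoeff (c : ℕ → ℂ) :
    PowerSeries.derivative ℂ (PowerSeries.mk (expCoeff c)) =
      PowerSeries.mk (fun k => c (k + 1)) * PowerSeries.mk (expCoeff c) := by
  ext k
  have hk : (k : ℂ) + 1 ≠ 0 := by exact_mod_cast k.succ_ne_zero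
  rw [PowerSeries.coeff_derivative, PowerSeries.coeff_mk, expCoeff_succ, div_mul_cancel₀ _ hk,
    PowerSeries.coeff_mul, Finset.Nat.sum_antidiagonal_eq_sum_range_succ_mk]
  simp only [PowerSeries.coeff_mk]

theorem mk_pow_mul_one_sub (q : ℂ) :
    PowerSeries.mk (fun k => q ^ (k + 1)) * (1 - PowerSeries.C q * PowerSeries.X) =
      PowerSeries.C q := by
  ext k
  rcases k with _ | k
  · simp
  · rw [mul_sub, mul_one, mul_comm (PowerSeries.C q), ← mul_assoc, map_sub,
      PowerSeries.coeff_mul_C, PowerSeries.coeff_succ_mul_X]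
    simp
    ring

theorem powerSeries_eq_zero_of_derivative_eq {H D : PowerSeries ℂ}
    (h : PowerSeries.derivative ℂ H = D * H) (h0 : PowerSeries.coeff 0 H = 0) : H = 0 := by
  ext k
  rw [map_zero]
  induction k using Nat.strong_induction_on with
  | _ k ih =>
    rcases k with _ | k
    · exact h0
    · have hk : (k : ℂ) + 1 ≠ 0 := by exact_mod_cast k.succ_ne_zero
      have h1 := congrArg (PowerSeries.coeff k) h
      rw [PowerSeries.coeff_derivative, PowerSeries.coeff_mul] at h1
      rw [Finset.sum_eq_zero fun p hp => by
        rw [ih p.2 (by have := Finset.HasAntidiagonal.mem_antidiagonal.1 hp; omega), mul_zero]] at h1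
      exact (mul_eq_zero.1 h1).resolve_right hk

/-- Formally `(1 - qX) exp (∑ c_k X^k/k) = exp (∑ (c_k - q^k) X^k/k)`, so both sides are
coefficients of the same series. To avoid formal logarithms, the two products are compared through
the differential equation `H' = D H` that both satisfy. -/
theorem expCoeff_sub_mul {c d : ℕ → ℂ} {q r : ℂ}
    (h : ∀ k : ℕ, c (k + 1) - q ^ (k + 1) = d (k + 1) - r ^ (k + 1)) (k : ℕ) :
    expCoeff c (k + 1) - q * expCoeff c k = expCoeff d (k + 1) - r * expCoeff d k := by
  set U : ℂ → PowerSeries ℂ := fun q => 1 - PowerSeries.C q * PowerSeries.X with hU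
  have hder : ∀ (c : ℕ → ℂ) (q : ℂ), PowerSeries.derivative ℂ (PowerSeries.mk (expCoeff c) * U q) =
      PowerSeries.mk (fun k => c (k + 1) - q ^ (k + 1)) * (PowerSeries.mk (expCoeff c) * U q) := by
    intro c q
    have h1 : PowerSeries.derivative ℂ (U q) = -PowerSeries.C q := by
      rw [hU]; simp only [map_sub, Derivation.leibniz, PowerSeries.derivative_X,
        PowerSeries.derivative_C, smul_eq_mul, mul_one, mul_zero, add_zero, Derivation.map_one_eq_zero,
        zero_sub]
    have h3 : PowerSeries.mk (fun k => c (k + 1) - q ^ (k + 1)) =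
        PowerSeries.mk (fun k => c (k + 1)) - PowerSeries.mk (fun k => q ^ (k + 1)) := by
      ext k; simp
    rw [Derivation.leibniz, derivative_mk_expCoeff, h1, h3, smul_eq_mul, smul_eq_mul]
    linear_combination PowerSeries.mk (expCoeff c) * (mk_pow_mul_one_sub q)
  have hcoeff : ∀ (c : ℕ → ℂ) (q : ℂ), PowerSeries.coeff (k + 1)
      (PowerSeries.mk (expCoeff c) * U q) = expCoeff c (k + 1) - q * expCoeff c k := by
    intro c q
    rw [hU]; simp only
    rw [mul_sub, mul_one, mul_comm (PowerSeries.C q), ← mul_assoc, map_sub,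
      PowerSeries.coeff_mul_C, PowerSeries.coeff_succ_mul_X, PowerSeries.coeff_mk,
      PowerSeries.coeff_mk, mul_comm q]
  have hzero : PowerSeries.mk (expCoeff c) * U q - PowerSeries.mk (expCoeff d) * U r = 0 := by
    refine powerSeries_eq_zero_of_derivative_eq
      (D := PowerSeries.mk (fun k => c (k + 1) - q ^ (k + 1))) ?_ ?_
    · rw [map_sub, hder, hder]
      simp only [← h]
      ring
    · simp [hU, expCoeff_zero]
  rw [← hcoeff, ← hcoeff, sub_eq_zero.1 hzero]

/-- The index starts at `k + 1` because the zeroth coefficient `1` is the transform of a point mass,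
not of an integrable function; for the same reason the term `j = k` of the recurrence is treated
apart. -/
theorem isFourierOn_expCoeff {S : Set ℝ} (hS : ∀ x ∈ S, ∀ y ∈ S, x + y ∈ S) {c : ℕ → ℝ → ℂ}
    (hc : ∀ k, IsFourierOn S (c (k + 1))) (k : ℕ) :
    IsFourierOn S fun μ => expCoeff (fun j => c j μ) (k + 1) := by
  induction k using Nat.strong_induction_on with
  | _ k ih =>
    have h1 : ∀ j ∈ Finset.range (k + 1), IsFourierOn S
        fun μ => c (j + 1) μ * expCoeff (fun j => c j μ) (k - j) := by
      intro j hj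
      have hjk : j ≤ k := Nat.lt_succ_iff.1 (Finset.mem_range.1 hj)
      rcases hjk.eq_or_lt with rfl | hlt
      · simp only [Nat.sub_self, expCoeff_zero, mul_one]; exact hc j
      · have h3 := ih (k - j - 1) (by omega)
        rw [show k - j - 1 + 1 = k - j by omega] at h3
        exact (hc j).mul hS h3
    have h4 := (IsFourierOn.sum h1).const_mul ((k + 1 : ℂ)⁻¹)
    simp only [expCoeff_succ, div_eq_inv_mul]
    exact h4


/-! ### The functionals of the step process in closed form -/

theorem floor_two_pow_mul {n k : ℕ} {t : ℝ} (h1 : (k : ℝ) / 2 ^ n ≤ t) (h2 : t < (k + 1) / 2 ^ n) :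
    ⌊2 ^ n * t⌋₊ = k := by
  have hp : (0 : ℝ) < 2 ^ n := by positivity
  rw [div_le_iff₀ hp] at h1
  rw [lt_div_iff₀ hp] at h2
  rw [Nat.floor_eq_iff (by rw [mul_comm]; exact k.cast_nonneg.trans h1)]
  constructor <;> linarith

theorem integral_step {n k : ℕ} (G : ℕ → ℝ) {t : ℝ} (h1 : (k : ℝ) / 2 ^ n ≤ t)
    (h2 : t ≤ (k + 1) / 2 ^ n) :
    IntervalIntegrable (fun s : ℝ => G ⌊2 ^ n * s⌋₊) volume ((k : ℝ) / 2 ^ n) t ∧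
    ∫ s in ((k : ℝ) / 2 ^ n)..t, G ⌊2 ^ n * s⌋₊ = (t - k / 2 ^ n) * G k := by
  have he : Set.EqOn (fun _ => G k) (fun s : ℝ => G ⌊2 ^ n * s⌋₊) (Set.Ioo ((k : ℝ) / 2 ^ n) t) :=
    fun s hs => by simp only; rw [floor_two_pow_mul hs.1.le (hs.2.trans_le h2)]
  constructor
  · rw [intervalIntegrable_iff_integrableOn_Ioo_of_le h1]
    exact (integrableOn_const (by simp)).congr_fun he measurableSet_Ioo
  · rw [intervalIntegral.integral_of_le h1, integral_Ioc_eq_integral_Ioo,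
      ← setIntegral_congr_fun measurableSet_Ioo he, setIntegral_const, smul_eq_mul]
    rw [Measure.real, Real.volume_Ioo, ENNReal.toReal_ofReal (by linarith)]

theorem sojournTime_eq {n k : ℕ} (y : ℕ → ℝ) {t : ℝ} (h1 : (k : ℝ) / 2 ^ n ≤ t)
    (h2 : t ≤ (k + 1) / 2 ^ n) :
    sojournTime n y t = (∑ j ∈ Finset.range k, (1 / 2 ^ n) *
      (Set.Ici (0 : ℝ)).indicator (fun _ => (1 : ℝ)) (y j)) +
      (t - k / 2 ^ n) * (Set.Ici (0 : ℝ)).indicator (fun _ => (1 : ℝ)) (y k) := by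
  set G : ℕ → ℝ := fun j => (Set.Ici (0 : ℝ)).indicator (fun _ => (1 : ℝ)) (y j) with hG
  have hle : ∀ j : ℕ, (j : ℝ) / 2 ^ n ≤ ((j + 1 : ℕ) : ℝ) / 2 ^ n := fun j => by
    push_cast; gcongr; linarith
  have hstep : ∀ j : ℕ, IntervalIntegrable (fun s : ℝ => G ⌊2 ^ n * s⌋₊) volume
      ((j : ℝ) / 2 ^ n) (((j + 1 : ℕ) : ℝ) / 2 ^ n) ∧
      ∫ s in ((j : ℝ) / 2 ^ n)..(((j + 1 : ℕ) : ℝ) / 2 ^ n), G ⌊2 ^ n * s⌋₊ = 1 / 2 ^ n * G j := by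
    intro j
    have h := integral_step G (hle j) (by push_cast; exact le_rfl)
    refine ⟨h.1, h.2.trans ?_⟩
    push_cast; ring
  have hsum := intervalIntegral.sum_integral_adjacent_intervals (n := k)
    (a := fun j : ℕ => (j : ℝ) / 2 ^ n) fun j _ => (hstep j).1
  have hint := IntervalIntegrable.trans_iterate (n := k)
    (a := fun j : ℕ => (j : ℝ) / 2 ^ n) fun j _ => (hstep j).1
  simp only [Nat.cast_zero, zero_div] at hsum hint
  have hlast := integral_step G h1 h2
  have : sojournTime n y t = ∫ s in (0 : ℝ)..t, G ⌊2 ^ n * s⌋₊ := rfl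
  rw [this, ← intervalIntegral.integral_add_adjacent_intervals hint hlast.1, ← hsum, hlast.2]
  congr 1
  exact Finset.sum_congr rfl fun j _ => (hstep j).2

/-- The weight `w` on `[0, ∞)` and `1` on `(-∞, 0)`. -/
noncomputable def weight (w : ℂ) (x : ℝ) : ℂ := if 0 ≤ x then w else 1

/-- `∫_0^h e^{-pu} du`. -/
noncomputable def cellIntegral (p h : ℝ) : ℂ := (1 - Complex.exp (-p * h)) / p

/-- The contribution of one time step spent at the point `x`. -/
noncomputable def cellFactor (lam ν h x : ℝ) : ℂ :=
  if 0 ≤ x then cellIntegral (lam + ν) h else cellIntegral lam h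

theorem integral_cell {p : ℝ} (hp : 0 < p) (A : ℂ) (a h : ℝ) :
    ∫ t in a..(a + h), Complex.exp (A - p * (t - a : ℝ)) = Complex.exp A * cellIntegral p h := by
  rw [intervalIntegral.integral_comp_sub_right (fun u : ℝ => Complex.exp (A - p * (u : ℂ))) a,
    sub_self, add_sub_cancel_left]
  have hpc : (-(p : ℂ)) ≠ 0 := neg_ne_zero.2 (by exact_mod_cast hp.ne')
  have h1 : ∀ u : ℝ, Complex.exp (A - p * (u : ℂ)) = Complex.exp A * Complex.exp (-(p : ℂ) * u) := by
    intro u; rw [← Complex.exp_add]; congr 1; ring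
  simp only [h1]
  rw [intervalIntegral.integral_const_mul, integral_exp_mul_complex hpc, cellIntegral,
    Complex.ofReal_zero, mul_zero, Complex.exp_zero]
  congr 1
  rw [div_neg, ← neg_div, neg_sub]

/-- On one cell the sojourn time is affine in `t`, with slope `1` or `0` according to the sign of `y
k`. Each earlier cell contributes `e^{-λh}`, and a factor `e^{-νh}` if its point lies in `[0, ∞)`.
-/
theorem transformTerm_eq {lam ν : ℝ} (hlam : 0 < lam) (hν : 0 < ν) (μ : ℝ) (n k : ℕ) (y : ℕ → ℝ) :
    transformTerm lam μ ν n k y = Complex.exp (-lam * (1 / 2 ^ n : ℝ)) ^ k *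
      (∏ j ∈ Finset.range k, weight (Complex.exp (-ν * (1 / 2 ^ n : ℝ))) (y j)) *
      (Complex.exp (Complex.I * μ * y k) * cellFactor lam ν (1 / 2 ^ n) (y k)) := by
  set ι : ℝ → ℝ := (Set.Ici (0 : ℝ)).indicator (fun _ => (1 : ℝ)) with hι
  set a : ℝ := k / 2 ^ n with ha
  set h : ℝ := 1 / 2 ^ n with hh
  have hh0 : 0 < h := by positivity
  have hah : ((k : ℝ) + 1) / 2 ^ n = a + h := by rw [ha, hh]; ring
  have hakh : a = k * h := by rw [ha, hh]; ring
  have hp : 0 < lam + ν * ι (y k) := by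
    have : 0 ≤ ι (y k) := Set.indicator_nonneg (fun _ _ => zero_le_one) _
    positivity
  have h1 : transformTerm lam μ ν n k y = ∫ t in a..(a + h), Complex.exp
      ((-lam * a + Complex.I * μ * y k - ν * ((∑ j ∈ Finset.range k, h * ι (y j) : ℝ) : ℂ)) -
        ((lam + ν * ι (y k) : ℝ) : ℂ) * (t - a : ℝ)) := by
    rw [transformTerm, hah, intervalIntegral.integral_of_le (by linarith),
      intervalIntegral.integral_of_le (by linarith), integral_Ioc_eq_integral_Ioo,
      integral_Ioc_eq_integral_Ioo]
    refine setIntegral_congr_fun measurableSet_Ioo fun t ht => ?_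
    have ht2 : t < (k + 1) / 2 ^ n := by rw [hah]; exact ht.2
    have hs : sojournTime n y t = (∑ j ∈ Finset.range k, h * ι (y j)) + (t - a) * ι (y k) :=
      sojournTime_eq y ht.1.le ht2.le
    rw [stepProcess, floor_two_pow_mul ht.1.le ht2, hs]
    congr 1
    push_cast
    ring
  rw [h1, integral_cell hp]
  have h3 : cellIntegral (lam + ν * ι (y k)) h = cellFactor lam ν h (y k) := by
    rw [cellFactor]
    split_ifs with h0
    · rw [hι, Set.indicator_of_mem (Set.mem_Ici.2 h0), mul_one]
    · rw [hι, Set.indicator_of_notMem (by simpa using h0), mul_zero, add_zero]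
  have h4 : ∏ j ∈ Finset.range k, weight (Complex.exp (-ν * h)) (y j) =
      Complex.exp (-ν * ((∑ j ∈ Finset.range k, h * ι (y j) : ℝ) : ℂ)) := by
    rw [Complex.ofReal_sum, Finset.mul_sum, Complex.exp_sum]
    refine Finset.prod_congr rfl fun j _ => ?_
    rw [weight]
    split_ifs with h0
    · rw [hι, Set.indicator_of_mem (Set.mem_Ici.2 h0), mul_one]
    · rw [hι, Set.indicator_of_notMem (by simpa using h0), mul_zero, Complex.ofReal_zero, mul_zero,
        Complex.exp_zero]
  rw [h3, h4, ← Complex.exp_nat_mul, ← Complex.exp_add, ← mul_assoc, ← Complex.exp_add, hakh]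
  congr 2
  push_cast
  ring

theorem measurable_trajectory {k : ℕ} (j : ℕ) : Measurable fun x : Fin k → ℝ => trajectory x j := by
  unfold trajectory
  split_ifs
  · exact measurable_pi_apply _
  · exact measurable_const

theorem measurable_weight (w : ℂ) : Measurable (weight w) :=
  Measurable.ite measurableSet_Ici measurable_const measurable_const

theorem norm_weight_le {w : ℂ} (hw : ‖w‖ ≤ 1) (x : ℝ) : ‖weight w x‖ ≤ 1 := by
  rw [weight]; split_ifs
  · exact hw
  · simp

theorem measurable_cellFactor (lam ν h : ℝ) : Measurable (cellFactor lam ν h) :=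
  Measurable.ite measurableSet_Ici measurable_const measurable_const

theorem norm_cellFactor_le (lam ν h x : ℝ) :
    ‖cellFactor lam ν h x‖ ≤ ‖cellIntegral (lam + ν) h‖ + ‖cellIntegral lam h‖ := by
  rw [cellFactor]; split_ifs
  · exact le_add_of_nonneg_right (norm_nonneg _)
  · exact le_add_of_nonneg_left (norm_nonneg _)

theorem norm_exp_neg_mul_ofReal_le {p h : ℝ} (hp : 0 ≤ p) (hh : 0 ≤ h) :
    ‖Complex.exp (-p * h)‖ ≤ 1 := by
  rw [← Complex.ofReal_neg, ← Complex.ofReal_mul, Complex.norm_exp_ofReal, Real.exp_le_one_iff]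
  nlinarith

theorem isTame_transformTerm {lam ν : ℝ} (hlam : 0 < lam) (hν : 0 < ν) (μ : ℝ) (n k : ℕ) :
    IsTame k (transformTerm lam μ ν n k) := by
  have hh : (0 : ℝ) ≤ 1 / 2 ^ n := by positivity
  have hz := norm_exp_neg_mul_ofReal_le hlam.le hh
  have hw := norm_exp_neg_mul_ofReal_le hν.le hh
  constructor
  · simp only [transformTerm_eq hlam hν]
    have h1 : Measurable fun x : Fin k → ℝ => ∏ j ∈ Finset.range k,
        weight (Complex.exp (-ν * (1 / 2 ^ n : ℝ))) (trajectory x j) :=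
      Finset.measurable_fun_prod _ fun j _ => (measurable_weight _).comp (measurable_trajectory j)
    have h3 := (measurable_cellFactor lam ν (1 / 2 ^ n)).comp (measurable_trajectory (k := k) k)
    have h4 : Measurable fun x : Fin k → ℝ => Complex.exp (Complex.I * μ * trajectory x k) :=
      Complex.measurable_exp.comp (measurable_const.mul
        (Complex.measurable_ofReal.comp (measurable_trajectory k)))
    exact (measurable_const.mul h1).mul (h4.mul h3)
  · refine ⟨‖cellIntegral (lam + ν) (1 / 2 ^ n)‖ + ‖cellIntegral lam (1 / 2 ^ n)‖, fun x => ?_⟩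
    rw [transformTerm_eq hlam hν, norm_mul, norm_mul, norm_mul, norm_pow, norm_prod,
      norm_exp_I_mul_mul, one_mul]
    have h1 := pow_le_one₀ (n := k) (norm_nonneg _) hz
    have h3 : ∏ j ∈ Finset.range k, ‖weight (Complex.exp (-ν * (1 / 2 ^ n : ℝ)))
        (trajectory x j)‖ ≤ 1 :=
      Finset.prod_le_one (fun j _ => norm_nonneg _) fun j _ => norm_weight_le hw _
    refine (mul_le_of_le_one_left (norm_nonneg _) (mul_le_one₀ h1 ?_ h3)).trans
      (norm_cellFactor_le _ _ _ _)
    exact Finset.prod_nonneg fun j _ => norm_nonneg _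


/-! ### Expectations along a chain -/

/-- The expectation of `ψ(X_k) ∏_{j<k} W(X_j)` for the chain with transition kernel `P(x - y)`. -/
noncomputable def chainIntegral (P : ℝ → ℝ) (W : ℝ → ℂ) (k : ℕ) (ψ : ℝ → ℂ) : ℂ :=
  ∫ x : Fin k → ℝ, (∏ j ∈ Finset.range k,
    (W (trajectory x j) * (P (trajectory x j - trajectory x (j + 1)) : ℂ))) * ψ (trajectory x k)

theorem trajectory_zero {k : ℕ} (x : Fin k → ℝ) : trajectory x 0 = 0 := by
  simp [trajectory]

theorem trajectory_piFinSuccAbove_symm_of_le {k : ℕ} (p : ℝ × (Fin k → ℝ)) {j : ℕ} (hj : j ≤ k) :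
    trajectory ((MeasurableEquiv.piFinSuccAbove (fun _ : Fin (k + 1) => ℝ) (Fin.last k)).symm p) j =
      trajectory p.2 j := by
  unfold trajectory
  by_cases h1 : 1 ≤ j
  · rw [dif_pos ⟨h1, by omega⟩, dif_pos ⟨h1, hj⟩]
    have : (⟨j - 1, by omega⟩ : Fin (k + 1)) = (Fin.last k).succAbove ⟨j - 1, by omega⟩ := by
      rw [Fin.succAbove_last]; rfl
    rw [this]
    exact Fin.insertNth_apply_succAbove (α := fun _ => ℝ) (Fin.last k) p.1 p.2 _
  · rw [dif_neg (fun h => h1 h.1), dif_neg (fun h => h1 h.1)]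

theorem trajectory_piFinSuccAbove_symm_last {k : ℕ} (p : ℝ × (Fin k → ℝ)) :
    trajectory ((MeasurableEquiv.piFinSuccAbove (fun _ : Fin (k + 1) => ℝ) (Fin.last k)).symm p)
      (k + 1) = p.1 := by
  unfold trajectory
  rw [dif_pos ⟨by omega, le_rfl⟩]
  exact Fin.insertNth_apply_same (α := fun _ => ℝ) (Fin.last k) p.1 p.2

theorem integrable_mul_comp_sub {X : Type*} [MeasurableSpace X] {m : Measure X} [SFinite m]
    {A : X → ℂ} {B : ℝ → ℂ} {a : X → ℝ} (hA : Integrable A m) (hB : Integrable B)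
    (ha : Measurable a) : Integrable (fun q : X × ℝ => A q.1 * B (a q.1 - q.2)) (m.prod volume) := by
  have h : MeasurePreserving (fun q : X × ℝ => (q.1, a q.1 - q.2)) (m.prod volume)
      (m.prod volume) := by
    refine (MeasurePreserving.id m).skew_product (g := fun x y => a x - y)
      ((ha.comp measurable_fst).sub measurable_snd) (Eventually.of_forall fun x => ?_)
    exact (Measure.measurePreserving_sub_left volume (a x)).map_eq
  exact h.integrable_comp_of_integrable (hA.mul_prod hB)

/-- One step of the chain: `W(x) ∫ P(x - y) ψ(y) dy`. -/
noncomputable def chainStep (P : ℝ → ℝ) (W ψ : ℝ → ℂ) (x : ℝ) : ℂ := W x * ∫ y, (P (x - y) : ℂ) * ψ y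

section Chain

variable {P : ℝ → ℝ} {W : ℝ → ℂ} (hP : Integrable P) (hPm : Measurable P) (hW : Measurable W)
  (hW1 : ∀ x, ‖W x‖ ≤ 1) {ψ : ℝ → ℂ} (hψ : Measurable ψ) {C : ℝ} (hC : ∀ x, ‖ψ x‖ ≤ C)

include hPm hW hψ in
theorem measurable_chainStep : Measurable (chainStep P W ψ) := by
  refine hW.mul ?_
  have h : StronglyMeasurable (Function.uncurry fun x y : ℝ => (P (x - y) : ℂ) * ψ y) := by
    refine Measurable.stronglyMeasurable ?_
    have h1 : Measurable fun q : ℝ × ℝ => P (q.1 - q.2) := hPm.comp (by fun_prop)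
    exact (Complex.measurable_ofReal.comp h1).mul (hψ.comp measurable_snd)
  exact h.integral_prod_right.measurable

include hP hW1 hC in
theorem norm_chainStep_le (x : ℝ) : ‖chainStep P W ψ x‖ ≤ (∫ y, |P y|) * C := by
  have hint : Integrable fun y => |P (x - y)| * C := (hP.comp_sub_left x).abs.mul_const C
  rw [chainStep, norm_mul]
  refine (mul_le_of_le_one_left (norm_nonneg _) (hW1 x)).trans ?_
  refine (norm_integral_le_of_norm_le hint (Eventually.of_forall fun y => ?_)).trans_eq ?_
  · rw [norm_mul, Complex.norm_real, Real.norm_eq_abs]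
    exact mul_le_mul_of_nonneg_left (hC y) (abs_nonneg _)
  · rw [integral_mul_const, integral_sub_left_eq_self (fun y => |P y|)]

-- The last observation is integrated out. Integrability is carried along, since it is what the
-- induction in `integrable_chain` needs.
include hP hW hW1 hψ hC in
theorem chainIntegral_succ_of_integrable {k : ℕ} (hint : Integrable fun x : Fin k → ℝ =>
      ∏ j ∈ Finset.range k, (W (trajectory x j) *
        (P (trajectory x j - trajectory x (j + 1)) : ℂ))) :
    (Integrable fun x : Fin (k + 1) → ℝ => (∏ j ∈ Finset.range (k + 1), (W (trajectory x j) *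
        (P (trajectory x j - trajectory x (j + 1)) : ℂ))) * ψ (trajectory x (k + 1))) ∧
    chainIntegral P W (k + 1) ψ = chainIntegral P W k (chainStep P W ψ) := by
  set e := MeasurableEquiv.piFinSuccAbove (fun _ : Fin (k + 1) => ℝ) (Fin.last k) with he
  have hvp : MeasurePreserving e.symm volume volume :=
    (volume_preserving_piFinSuccAbove (fun _ : Fin (k + 1) => ℝ) (Fin.last k)).symm
  set A : (Fin k → ℝ) → ℂ := fun x => (∏ j ∈ Finset.range k, (W (trajectory x j) *
        (P (trajectory x j - trajectory x (j + 1)) : ℂ))) * W (trajectory x k) with hA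
  have hAint : Integrable A := by
    refine hint.mul_bdd (c := 1) ?_ (Eventually.of_forall fun x => hW1 _)
    exact (hW.comp (measurable_trajectory k)).aestronglyMeasurable
  have h1 := integrable_mul_comp_sub hAint hP.ofReal (measurable_trajectory (k := k) k)
  have h3 : Integrable (fun q : (Fin k → ℝ) × ℝ => A q.1 * (P (trajectory q.1 k - q.2) : ℂ) *
      ψ q.2) (volume.prod volume) :=
    h1.mul_bdd (c := C) (hψ.comp measurable_snd).aestronglyMeasurable
      (Eventually.of_forall fun q => hC _)
  set Φ : (Fin (k + 1) → ℝ) → ℂ := fun x => (∏ j ∈ Finset.range (k + 1), (W (trajectory x j) *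
        (P (trajectory x j - trajectory x (j + 1)) : ℂ))) * ψ (trajectory x (k + 1)) with hΦ
  have h4 : ∀ p : ℝ × (Fin k → ℝ), Φ (e.symm p) =
      A p.2 * (P (trajectory p.2 k - p.1) : ℂ) * ψ p.1 := by
    intro p
    simp only [hΦ, hA]
    rw [Finset.prod_range_succ, trajectory_piFinSuccAbove_symm_last,
      trajectory_piFinSuccAbove_symm_of_le p le_rfl]
    have h8 : ∏ j ∈ Finset.range k, (W (trajectory (e.symm p) j) *
        (P (trajectory (e.symm p) j - trajectory (e.symm p) (j + 1)) : ℂ)) =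
        ∏ j ∈ Finset.range k, (W (trajectory p.2 j) *
        (P (trajectory p.2 j - trajectory p.2 (j + 1)) : ℂ)) := by
      refine Finset.prod_congr rfl fun j hj => ?_
      have hj := Finset.mem_range.1 hj
      rw [trajectory_piFinSuccAbove_symm_of_le p hj.le, trajectory_piFinSuccAbove_symm_of_le p hj]
    rw [h8]; ring
  have h5 : Integrable (fun p : ℝ × (Fin k → ℝ) => Φ (e.symm p)) := by
    simp only [h4]
    exact h3.swap
  refine ⟨(hvp.integrable_comp_emb e.symm.measurableEmbedding).1 h5, ?_⟩
  have h6 : chainIntegral P W (k + 1) ψ = ∫ p : ℝ × (Fin k → ℝ), Φ (e.symm p) :=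
    (hvp.integral_comp' Φ).symm
  rw [h6]
  simp only [h4]
  have h7 := integral_prod_symm _ h3.swap
  rw [Measure.volume_eq_prod]
  refine h7.trans ?_
  rw [chainIntegral]
  refine integral_congr_ae (Eventually.of_forall fun x => ?_)
  simp only [Function.comp_apply, Prod.swap_prod_mk, chainStep, hA]
  rw [← mul_assoc, ← integral_const_mul]
  refine integral_congr_ae (Eventually.of_forall fun y => ?_)
  simp only; ring

include hP hW hW1 in
theorem integrable_chain (k : ℕ) : Integrable fun x : Fin k → ℝ =>
    ∏ j ∈ Finset.range k, (W (trajectory x j) *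
      (P (trajectory x j - trajectory x (j + 1)) : ℂ)) := by
  induction k with
  | zero =>
    simp only [Finset.range_zero, Finset.prod_empty]
    rw [Measure.volume_pi_eq_dirac fun i : Fin 0 => i.elim0]
    exact integrable_dirac (by simp)
  | succ k ih =>
    have h := (chainIntegral_succ_of_integrable hP hW hW1 (ψ := fun _ => 1) measurable_const
      (C := 1) (fun _ => by simp) ih).1
    simpa only [mul_one] using h

include hP hW hW1 hψ hC in
theorem chainIntegral_succ (k : ℕ) :
    chainIntegral P W (k + 1) ψ = chainIntegral P W k (chainStep P W ψ) :=
  (chainIntegral_succ_of_integrable hP hW hW1 hψ hC (integrable_chain hP hW hW1 k)).2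

theorem chainIntegral_zero (P : ℝ → ℝ) (W ψ : ℝ → ℂ) : chainIntegral P W 0 ψ = ψ 0 := by
  simp [chainIntegral, trajectory_zero, Measure.volume_pi_eq_dirac fun i : Fin 0 => i.elim0]

/-- The density of the weighted chain after `k + 1` steps. -/
noncomputable def chainDensity (P : ℝ → ℝ) (W : ℝ → ℂ) : ℕ → ℝ → ℂ
  | 0 => fun y => W 0 * (P (0 - y) : ℂ)
  | k + 1 => fun y => ∫ x, W x * chainDensity P W k x * (P (x - y) : ℂ)

include hP hW hW1 in
theorem integrable_chainDensity (k : ℕ) : Integrable (chainDensity P W k) := by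
  induction k with
  | zero => exact (hP.comp_sub_left 0).ofReal.const_mul _
  | succ k ih =>
    have h : Integrable fun x => W x * chainDensity P W k x :=
      ih.bdd_mul (c := 1) hW.aestronglyMeasurable (Eventually.of_forall hW1)
    exact (integrable_mul_comp_sub h hP.ofReal measurable_id).integral_prod_right

-- `chainStep` consumes the chain from its end while `chainDensity` builds it from the start; by
-- Fubini the two recursions are adjoint. The induction must therefore vary `ψ`.
include hP hPm hW hW1 in
theorem chainIntegral_eq_integral (k : ℕ) : ∀ {ψ : ℝ → ℂ}, Measurable ψ → ∀ {C : ℝ},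
    (∀ x, ‖ψ x‖ ≤ C) → chainIntegral P W (k + 1) ψ = ∫ y, chainDensity P W k y * ψ y := by
  induction k with
  | zero =>
    intro ψ hψ C hC
    rw [chainIntegral_succ hP hW hW1 hψ hC, chainIntegral_zero, chainStep, ← integral_const_mul]
    simp only [chainDensity, mul_assoc]
  | succ k ih =>
    intro ψ hψ C hC
    rw [chainIntegral_succ hP hW hW1 hψ hC, ih (measurable_chainStep hPm hW hψ)
      (norm_chainStep_le hP hW1 hC)]
    have h : Integrable fun x => W x * chainDensity P W k x :=
      (integrable_chainDensity hP hW hW1 k).bdd_mul (c := 1) hW.aestronglyMeasurable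
        (Eventually.of_forall hW1)
    have h1 : Integrable (fun q : ℝ × ℝ => W q.1 * chainDensity P W k q.1 *
        (P (q.1 - q.2) : ℂ) * ψ q.2) (volume.prod volume) :=
      (integrable_mul_comp_sub h hP.ofReal measurable_id).mul_bdd (c := C)
        (hψ.comp measurable_snd).aestronglyMeasurable (Eventually.of_forall fun q => hC _)
    have h3 := integral_integral_swap (f := fun x y => W x * chainDensity P W k x *
      (P (x - y) : ℂ) * ψ y) h1
    have h4 : ∀ x, chainDensity P W k x * chainStep P W ψ x =
        ∫ y, W x * chainDensity P W k x * (P (x - y) : ℂ) * ψ y := by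
      intro x
      simp only [mul_assoc (W x * chainDensity P W k x)]
      rw [integral_const_mul, chainStep]; ring
    simp only [h4]
    rw [h3]
    refine integral_congr_ae (Eventually.of_forall fun y => ?_)
    simp only
    rw [integral_mul_const, chainDensity]

end Chain


open scoped FourierTransform Convolution

/-! ### The generating functions of the chain -/

/-- The Fourier transform of the restriction of the heat-type kernel to `S`. -/
noncomputable def halfHeat (S : Set ℝ) (N : ℕ) (t μ : ℝ) : ℂ :=
  fourierInt (S.indicator fun x => (heatKernel N t x : ℂ)) μ

theorem norm_halfHeat_le {N : ℕ} (hN : Even N) (h2 : 2 ≤ N) {t : ℝ} (ht : 0 < t) {S : Set ℝ}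
    (μ : ℝ) : ‖halfHeat S N t μ‖ ≤ totalMass N := by
  rw [← integral_abs_heatKernel hN h2 ht]
  refine (norm_fourierInt_le _ _).trans ?_
  have hi : Integrable fun x => (heatKernel N t x : ℂ) := (integrable_heatKernel hN h2 ht).ofReal
  refine integral_mono_of_nonneg (Eventually.of_forall fun x => norm_nonneg _)
    (integrable_heatKernel hN h2 ht).abs (Eventually.of_forall fun x => ?_)
  refine (norm_indicator_le_norm_self _ _).trans_eq ?_
  rw [Complex.norm_real, Real.norm_eq_abs]

theorem halfHeat_add {N : ℕ} (hN : Even N) (h2 : 2 ≤ N) {t : ℝ} (ht : 0 < t) (μ : ℝ) :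
    halfHeat (Set.Ici 0) N t μ + halfHeat (Set.Iio 0) N t μ = heatSymbol N t μ := by
  have hi : Integrable fun x => (heatKernel N t x : ℂ) := (integrable_heatKernel hN h2 ht).ofReal
  exact (fourierInt_indicator_add hi μ).trans (fourierInt_heatKernel hN h2 ht μ)

theorem fourierInt_chainDensity_zero {N : ℕ} (hN : Even N) (h2 : 2 ≤ N) {h : ℝ} (hh : 0 < h)
    (w : ℂ) (μ : ℝ) :
    fourierInt (chainDensity (heatKernel N h) (weight w) 0) μ = w * heatSymbol N h μ := by
  rw [← fourierInt_heatKernel hN h2 hh, fourierInt, fourierInt, ← integral_const_mul]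
  refine integral_congr_ae (Eventually.of_forall fun y => ?_)
  simp only [chainDensity, zero_sub, heatKernel_neg hN, weight, le_refl, if_true]
  ring

/-- A step multiplies by the weight, which separates the two half-lines, and then convolves with the
kernel; evenness of the kernel turns `p(x - y)` into `p(y - x)`. -/
theorem fourierInt_chainDensity_succ {N : ℕ} (hN : Even N) (h2 : 2 ≤ N) {h : ℝ} (hh : 0 < h)
    {w : ℂ} (hw : ‖w‖ ≤ 1) (k : ℕ) (μ : ℝ) :
    fourierInt (chainDensity (heatKernel N h) (weight w) (k + 1)) μ = heatSymbol N h μ *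
      (w * fourierInt ((Set.Ici 0).indicator (chainDensity (heatKernel N h) (weight w) k)) μ +
        fourierInt ((Set.Iio 0).indicator (chainDensity (heatKernel N h) (weight w) k)) μ) := by
  set g := chainDensity (heatKernel N h) (weight w) k with hg
  have hP : Integrable fun x => (heatKernel N h x : ℂ) := (integrable_heatKernel hN h2 hh).ofReal
  have hgi : Integrable g := integrable_chainDensity (integrable_heatKernel hN h2 hh)
    (measurable_weight w) (norm_weight_le hw) k
  have hWg : Integrable fun x => weight w x * g x :=
    hgi.bdd_mul (c := 1) (measurable_weight w).aestronglyMeasurable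
      (Eventually.of_forall (norm_weight_le hw))
  have hconv : chainDensity (heatKernel N h) (weight w) (k + 1) =
      (fun x => weight w x * g x) ⋆[ContinuousLinearMap.mul ℂ ℂ]
        fun x => (heatKernel N h x : ℂ) := by
    ext y
    rw [convolution_def, chainDensity]
    refine integral_congr_ae (Eventually.of_forall fun x => ?_)
    simp only [ContinuousLinearMap.mul_apply']
    rw [← heatKernel_neg hN, neg_sub]
  rw [hconv, fourierInt_eq, Real.fourier_mul_convolution_eq hWg hP, ← fourierInt_eq,
    ← fourierInt_eq, fourierInt_heatKernel hN h2 hh, mul_comm]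
  congr 1
  rw [fourierInt, fourierInt, fourierInt, ← integral_const_mul, ← integral_add
    ((integrable_exp_I_mul (hgi.indicator measurableSet_Ici) μ).const_mul w)
    (integrable_exp_I_mul (hgi.indicator measurableSet_Iio) μ)]
  refine integral_congr_ae (Eventually.of_forall fun x => ?_)
  simp only
  rw [weight]
  rcases le_or_gt 0 x with hx | hx
  · rw [if_pos hx, Set.indicator_of_mem (Set.mem_Ici.2 hx),
      Set.indicator_of_notMem (by simpa using hx)]
    ring
  · rw [if_neg (not_le.2 hx), Set.indicator_of_notMem (by simpa using hx),
      Set.indicator_of_mem (Set.mem_Iio.2 hx)]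
    ring

/-- The logarithmic coefficients of the generating function on `S`. -/
noncomputable def logCoeff (S : Set ℝ) (N : ℕ) (h : ℝ) (s z w : ℂ) (k : ℕ) (μ : ℝ) : ℂ :=
  s * (1 - w ^ k) * z ^ k * halfHeat S N (k * h) μ

theorem isFourierOn_logCoeff {N : ℕ} (hN : Even N) (h2 : 2 ≤ N) {h : ℝ} (hh : 0 < h) {S : Set ℝ}
    (hS : MeasurableSet S) (s z w : ℂ) (k : ℕ) : IsFourierOn S (logCoeff S N h s z w (k + 1)) := by
  have ht : 0 < ((k + 1 : ℕ) : ℝ) * h := by positivity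
  exact (isFourierOn_indicator hS (integrable_heatKernel hN h2 ht).ofReal).const_mul _

/-- Each logarithmic coefficient involves a single kernel, at time `kh`, whose total variation does
not depend on `k`. Estimating the chain step by step would give `(z · totalMass)^k` instead, which
need not be summable. -/
theorem norm_logCoeff_le {N : ℕ} (hN : Even N) (h2 : 2 ≤ N) {h : ℝ} (hh : 0 < h) (S : Set ℝ)
    {s : ℂ} (hs : ‖s‖ = 1) {z w : ℝ} (hz : 0 ≤ z) (hw : 0 ≤ w) (hw1 : w ≤ 1) (k : ℕ) (μ : ℝ) :
    ‖logCoeff S N h s z w k μ‖ ≤ totalMass N * z ^ k := by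
  have hT : 0 ≤ totalMass N := integral_nonneg fun x => abs_nonneg _
  rcases k with _ | k
  · simpa [logCoeff] using hT
  · have ht : 0 < ((k + 1 : ℕ) : ℝ) * h := by positivity
    have h1 : ‖(1 - (w : ℂ) ^ (k + 1))‖ ≤ 1 := by
      rw [← Complex.ofReal_pow, ← Complex.ofReal_one, ← Complex.ofReal_sub, Complex.norm_real,
        Real.norm_eq_abs, abs_le]
      have h3 : 0 ≤ w ^ (k + 1) := by positivity
      have h4 : w ^ (k + 1) ≤ 1 := pow_le_one₀ hw hw1
      constructor <;> linarith
    rw [logCoeff, norm_mul, norm_mul, norm_mul, hs, one_mul, norm_pow, Complex.norm_real,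
      Real.norm_of_nonneg hz, mul_comm (totalMass N)]
    refine mul_le_mul (mul_le_of_le_one_left (by positivity) h1) (norm_halfHeat_le hN h2 ht μ)
      (norm_nonneg _) (by positivity)

/-- The two half-line transforms at time `kh` add up to `q^k`, where `q` is the symbol at time `h`.
So the logarithmic coefficients differ by `(zq)^k - (zwq)^k`: a factorisation of `(1 - zwq) / (1 -
zq)` into a part for each half-line. -/
theorem expCoeff_logCoeff_sub {N : ℕ} (hN : Even N) (h2 : 2 ≤ N) {h : ℝ} (hh : 0 < h) (z w : ℂ)
    (k : ℕ) (μ : ℝ) :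
    expCoeff (fun j => logCoeff (Set.Iio 0) N h 1 z w j μ) (k + 1) -
      z * heatSymbol N h μ * expCoeff (fun j => logCoeff (Set.Iio 0) N h 1 z w j μ) k =
    expCoeff (fun j => logCoeff (Set.Ici 0) N h (-1) z w j μ) (k + 1) -
      z * w * heatSymbol N h μ * expCoeff (fun j => logCoeff (Set.Ici 0) N h (-1) z w j μ) k := by
  refine expCoeff_sub_mul (fun j => ?_) k
  have ht : 0 < ((j + 1 : ℕ) : ℝ) * h := by positivity
  have h1 := halfHeat_add hN h2 ht μ
  have h3 : heatSymbol N (((j + 1 : ℕ) : ℝ) * h) μ = heatSymbol N h μ ^ (j + 1) := by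
    rw [heatSymbol, heatSymbol, ← Complex.exp_nat_mul]
    congr 1; push_cast; ring
  rw [h3] at h1
  rw [logCoeff, logCoeff, mul_pow, mul_pow, mul_pow]
  linear_combination (1 - w ^ (j + 1)) * z ^ (j + 1) * h1

/-- Spitzer's identity. Both sides obey the same recurrence for the sum of their two half-line
parts, and this sum determines the parts. -/
theorem fourierInt_indicator_chainDensity {N : ℕ} (hN : Even N) (h2 : 2 ≤ N) {h : ℝ} (hh : 0 < h)
    {z w : ℂ} (hw : ‖w‖ ≤ 1) (hw1 : w ≠ 1) (k : ℕ) :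
    ((fun μ => z ^ (k + 1) * fourierInt
      ((Set.Ici 0).indicator (chainDensity (heatKernel N h) (weight w) k)) μ) =
      fun μ => -(w / (1 - w)) *
        expCoeff (fun j => logCoeff (Set.Ici 0) N h (-1) z w j μ) (k + 1)) ∧
    ((fun μ => z ^ (k + 1) * fourierInt
      ((Set.Iio 0).indicator (chainDensity (heatKernel N h) (weight w) k)) μ) =
      fun μ => (w / (1 - w)) *
        expCoeff (fun j => logCoeff (Set.Iio 0) N h 1 z w j μ) (k + 1)) := by
  have hgi : ∀ k, Integrable (chainDensity (heatKernel N h) (weight w) k) := fun k =>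
    integrable_chainDensity (integrable_heatKernel hN h2 hh) (measurable_weight w)
      (norm_weight_le hw) k
  have hw0 : 1 - w ≠ 0 := sub_ne_zero.2 hw1.symm
  -- An identity for the whole transform at step `k` already yields both halves, so the induction
  -- only has to establish that.
  have key : ∀ k, (∀ μ, z ^ (k + 1) * fourierInt (chainDensity (heatKernel N h) (weight w) k) μ =
      (w / (1 - w)) * (expCoeff (fun j => logCoeff (Set.Iio 0) N h 1 z w j μ) (k + 1) -
        expCoeff (fun j => logCoeff (Set.Ici 0) N h (-1) z w j μ) (k + 1))) → _ := fun k hk =>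
    eq_of_isFourierOn_add_eq
      ((isFourierOn_indicator measurableSet_Ici (hgi k)).const_mul (z ^ (k + 1)))
      ((isFourierOn_expCoeff add_mem_Ici (fun j => isFourierOn_logCoeff hN h2 hh measurableSet_Ici
        (-1) z w j) k).const_mul (-(w / (1 - w))))
      ((isFourierOn_indicator measurableSet_Iio (hgi k)).const_mul (z ^ (k + 1)))
      ((isFourierOn_expCoeff add_mem_Iio (fun j => isFourierOn_logCoeff hN h2 hh measurableSet_Iio
        1 z w j) k).const_mul (w / (1 - w)))
      (fun μ => by
        rw [← mul_add, fourierInt_indicator_add (hgi k), hk]; ring)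
  induction k with
  | zero =>
    refine key 0 fun μ => ?_
    have h1 := expCoeff_logCoeff_sub hN h2 hh z w 0 μ
    rw [expCoeff_zero, expCoeff_zero] at h1
    rw [fourierInt_chainDensity_zero hN h2 hh]
    field_simp
    linear_combination -w * h1
  | succ k ih =>
    refine key (k + 1) fun μ => ?_
    have h1 := expCoeff_logCoeff_sub hN h2 hh z w (k + 1) μ
    have h3 := congrFun ih.1 μ
    have h4 := congrFun ih.2 μ

    rw [fourierInt_chainDensity_succ hN h2 hh hw]
    linear_combination (z * heatSymbol N h μ * w) * h3 + (z * heatSymbol N h μ) * h4 -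
      (w / (1 - w)) * h1


/-! ### The series of pseudo-expectations -/

theorem tameExpectation_transformTerm {lam ν : ℝ} (hlam : 0 < lam) (hν : 0 < ν) (μ : ℝ)
    (N n k : ℕ) :
    tameExpectation N n k (transformTerm lam μ ν n k) =
      Complex.exp (-lam * (1 / 2 ^ n : ℝ)) ^ k * chainIntegral (heatKernel N (1 / 2 ^ n))
        (weight (Complex.exp (-ν * (1 / 2 ^ n : ℝ)))) k
        (fun x => Complex.exp (Complex.I * μ * x) * cellFactor lam ν (1 / 2 ^ n) x) := by
  rw [tameExpectation, chainIntegral, ← integral_const_mul]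
  refine integral_congr_ae (Eventually.of_forall fun x => ?_)
  simp only
  rw [transformTerm_eq hlam hν, Finset.prod_mul_distrib]
  ring

theorem integral_mul_cellFactor {g : ℝ → ℂ} (hg : Integrable g) (lam ν h μ : ℝ) :
    ∫ y, g y * (Complex.exp (Complex.I * μ * y) * cellFactor lam ν h y) =
      cellIntegral (lam + ν) h * fourierInt ((Set.Ici 0).indicator g) μ +
        cellIntegral lam h * fourierInt ((Set.Iio 0).indicator g) μ := by
  rw [fourierInt, fourierInt, ← integral_const_mul, ← integral_const_mul, ← integral_add
    ((integrable_exp_I_mul (hg.indicator measurableSet_Ici) μ).const_mul _)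
    ((integrable_exp_I_mul (hg.indicator measurableSet_Iio) μ).const_mul _)]
  refine integral_congr_ae (Eventually.of_forall fun x => ?_)
  simp only
  rw [cellFactor]
  rcases le_or_gt 0 x with hx | hx
  · rw [if_pos hx, Set.indicator_of_mem (Set.mem_Ici.2 hx),
      Set.indicator_of_notMem (by simpa using hx)]
    ring
  · rw [if_neg (not_le.2 hx), Set.indicator_of_notMem (by simpa using hx),
      Set.indicator_of_mem (Set.mem_Iio.2 hx)]
    ring

/-- The logarithm of the generating function on `S`. -/
noncomputable def logGen (S : Set ℝ) (N : ℕ) (h : ℝ) (s z w : ℂ) (μ : ℝ) : ℂ :=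
  ∑' k : ℕ, logCoeff S N h s z w (k + 1) μ / (k + 1)

theorem hasSum_tameExpectation {N : ℕ} (hN : Even N) (h2 : 2 ≤ N) {lam ν : ℝ} (hlam : 0 < lam)
    (hν : 0 < ν) (μ : ℝ) (n : ℕ) {h : ℝ} (hh : h = 1 / 2 ^ n) {z w : ℝ}
    (hz : z = Real.exp (-lam * h)) (hw : w = Real.exp (-ν * h)) :
    HasSum (fun k => tameExpectation N n k (transformTerm lam μ ν n k))
      (cellIntegral (lam + ν) h +
        (cellIntegral (lam + ν) h * -(w / (1 - w)) *
          (Complex.exp (logGen (Set.Ici 0) N h (-1) z w μ) - 1) +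
        cellIntegral lam h * (w / (1 - w)) *
          (Complex.exp (logGen (Set.Iio 0) N h 1 z w μ) - 1))) := by
  have hh0 : 0 < h := by rw [hh]; positivity
  have hzc : Complex.exp (-lam * (1 / 2 ^ n : ℝ)) = (z : ℂ) := by
    rw [hz, ← hh]; push_cast; rfl
  have hwc : Complex.exp (-ν * (1 / 2 ^ n : ℝ)) = (w : ℂ) := by
    rw [hw, ← hh]; push_cast; rfl
  have hz0 : 0 ≤ z := by rw [hz]; positivity
  have hz1 : z < 1 := by
    rw [hz, Real.exp_lt_one_iff]; nlinarith
  have hw0 : 0 ≤ w := by rw [hw]; positivity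
  have hw1 : w < 1 := by
    rw [hw, Real.exp_lt_one_iff]; nlinarith
  have hwn : ‖(w : ℂ)‖ ≤ 1 := by rw [Complex.norm_real, Real.norm_of_nonneg hw0]; exact hw1.le
  have hwne : (w : ℂ) ≠ 1 := by exact_mod_cast hw1.ne
  have hterm : ∀ k, tameExpectation N n k (transformTerm lam μ ν n k) = (z : ℂ) ^ k *
      chainIntegral (heatKernel N h) (weight w) k
        (fun x => Complex.exp (Complex.I * μ * x) * cellFactor lam ν h x) := by
    intro k
    rw [tameExpectation_transformTerm hlam hν, hzc, hwc, hh]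
  have hψm : Measurable fun x : ℝ => Complex.exp (Complex.I * μ * x) * cellFactor lam ν h x :=
    (Continuous.measurable (by fun_prop)).mul (measurable_cellFactor _ _ _)
  have hψb : ∀ x : ℝ, ‖Complex.exp (Complex.I * μ * x) * cellFactor lam ν h x‖ ≤
      ‖cellIntegral (lam + ν) h‖ + ‖cellIntegral lam h‖ := fun x => by
    rw [norm_mul, norm_exp_I_mul_mul, one_mul]; exact norm_cellFactor_le _ _ _ _
  have hsucc : ∀ k, tameExpectation N n (k + 1) (transformTerm lam μ ν n (k + 1)) =
      cellIntegral (lam + ν) h * -(w / (1 - w)) *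
        expCoeff (fun j => logCoeff (Set.Ici 0) N h (-1) z w j μ) (k + 1) +
      cellIntegral lam h * (w / (1 - w)) *
        expCoeff (fun j => logCoeff (Set.Iio 0) N h 1 z w j μ) (k + 1) := by
    intro k
    have hF := fourierInt_indicator_chainDensity hN h2 hh0 (z := z) hwn hwne k
    have h3 := congrFun hF.1 μ
    have h4 := congrFun hF.2 μ
    rw [hterm, chainIntegral_eq_integral (integrable_heatKernel hN h2 hh0)
      (continuous_heatKernel hN h2 hh0).measurable (measurable_weight w) (norm_weight_le hwn) k
      hψm hψb, integral_mul_cellFactor (integrable_chainDensity (integrable_heatKernel hN h2 hh0)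
      (measurable_weight w) (norm_weight_le hwn) k)]
    linear_combination cellIntegral (lam + ν) h * h3 + cellIntegral lam h * h4
  have hexp : ∀ (S : Set ℝ) (s : ℂ), ‖s‖ = 1 →
      HasSum (fun k => expCoeff (fun j => logCoeff S N h s z w j μ) (k + 1))
        (Complex.exp (logGen S N h s z w μ) - 1) := by
    intro S s hs
    have h1 := hasSum_expCoeff hz0 hz1
      (fun k => norm_logCoeff_le hN h2 hh0 S hs hz0 hw0 hw1.le k μ)
    have h3 := (hasSum_nat_add_iff' 1).2 h1
    rw [Finset.range_one, Finset.sum_singleton, expCoeff_zero] at h3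
    exact h3
  -- The starting point `0` belongs to `[0, ∞)`, so the first cell counts as sojourn time.
  have hzero : tameExpectation N n 0 (transformTerm lam μ ν n 0) = cellIntegral (lam + ν) h := by
    rw [hterm, chainIntegral_zero, pow_zero, one_mul, Complex.ofReal_zero, mul_zero,
      Complex.exp_zero, one_mul, cellFactor, if_pos le_rfl]
  refine (hasSum_nat_add_iff' 1).1 ?_
  rw [Finset.range_one, Finset.sum_singleton, hzero, add_sub_cancel_left]
  simp only [hsucc]
  exact ((hexp (Set.Ici 0) (-1) (by simp)).mul_left _).add
    ((hexp (Set.Iio 0) 1 (by simp)).mul_left _)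


/-! ### Riemann sums -/

theorem hasSum_mul_of_integrable_floor {F : ℝ → ℂ} {h : ℝ} (hh : 0 < h)
    (hi : IntegrableOn (fun t : ℝ => F ((⌊t / h⌋₊ + 1) * h)) (Set.Ioi 0)) :
    HasSum (fun k : ℕ => (h : ℂ) * F ((k + 1) * h))
      (∫ t in Set.Ioi (0 : ℝ), F ((⌊t / h⌋₊ + 1) * h)) := by
  rw [← integral_Ici_eq_integral_Ioi]
  rw [← integrableOn_Ici_iff_integrableOn_Ioi] at hi
  set s : ℕ → Set ℝ := fun k => Set.Ico (k * h) ((k + 1) * h) with hs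
  have hmem : ∀ {k : ℕ} {t : ℝ}, t ∈ s k ↔ 0 ≤ t ∧ ⌊t / h⌋₊ = k := by
    intro k t
    simp only [hs, Set.mem_Ico]
    constructor
    · rintro ⟨h1, h2⟩
      have ht : 0 ≤ t := le_trans (by positivity) h1
      refine ⟨ht, (Nat.floor_eq_iff (by positivity)).2 ⟨?_, ?_⟩⟩
      · rwa [le_div_iff₀ hh]
      · rwa [div_lt_iff₀ hh]
    · rintro ⟨ht, h1⟩
      have h2 := (Nat.floor_eq_iff (by positivity)).1 h1
      rw [le_div_iff₀ hh, div_lt_iff₀ hh] at h2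
      exact h2
  have hU : ⋃ k, s k = Set.Ici 0 := by
    ext t
    simp only [Set.mem_iUnion, hmem, Set.mem_Ici]
    exact ⟨fun ⟨_, h1⟩ => h1.1, fun h1 => ⟨_, h1, rfl⟩⟩
  have h1 := hasSum_integral_iUnion (μ := volume) (s := s)
    (f := fun t : ℝ => F ((⌊t / h⌋₊ + 1) * h)) (fun k => measurableSet_Ico)
    (fun i j hij => Set.disjoint_left.2 fun t ht ht' =>
      hij ((hmem.1 ht).2.symm.trans (hmem.1 ht').2)) (by rw [hU]; exact hi)
  rw [hU] at h1
  refine h1.congr_fun fun k => ?_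
  rw [setIntegral_congr_fun (g := fun _ => F ((k + 1) * h)) measurableSet_Ico fun t ht => by
    simp only; rw [(hmem.1 ht).2]]
  rw [setIntegral_const, Measure.real, Real.volume_Ico, ENNReal.toReal_ofReal (by nlinarith),
    Complex.real_smul]
  congr 2; ring

/-- The sum is the integral of `F` evaluated at the right end of the cell containing `t`. Right ends
are positive and exceed `t`, so the exponential bound at `t` dominates uniformly in `h`. -/
theorem tendsto_tsum_mul {F : ℝ → ℂ} (hF : ContinuousOn F (Set.Ioi 0)) {C lam : ℝ} (hlam : 0 < lam)
    (hb : ∀ t, 0 < t → ‖F t‖ ≤ C * Real.exp (-lam * t)) :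
    Tendsto (fun h : ℝ => ∑' k : ℕ, (h : ℂ) * F ((k + 1) * h)) (𝓝[>] 0)
      (𝓝 (∫ t in Set.Ioi (0 : ℝ), F t)) := by
  have hC : 0 ≤ C := by
    have := (norm_nonneg _).trans (hb 1 one_pos)
    exact nonneg_of_mul_nonneg_left this (Real.exp_pos _)
  have hbound : IntegrableOn (fun t : ℝ => C * Real.exp (-lam * t)) (Set.Ioi 0) :=
    (integrableOn_exp_mul_Ioi (neg_lt_zero.2 hlam) 0).const_mul C
  have hlt : ∀ {h t : ℝ}, 0 < h → t < (⌊t / h⌋₊ + 1) * h := fun {h t} hh => by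
    rw [← div_lt_iff₀ hh]; exact Nat.lt_floor_add_one _
  have hmeas : ∀ h : ℝ, AEStronglyMeasurable (fun t : ℝ => F ((⌊t / h⌋₊ + 1) * h))
      (volume.restrict (Set.Ioi 0)) := fun h => by
    have h1 : Measurable fun k : ℕ => F ((k + 1) * h) := measurable_from_nat
    exact (h1.comp (Nat.measurable_floor.comp (measurable_id.div_const h))).aestronglyMeasurable
  have hle : ∀ h : ℝ, 0 < h → ∀ᵐ t ∂(volume.restrict (Set.Ioi (0 : ℝ))),
      ‖F ((⌊t / h⌋₊ + 1) * h)‖ ≤ C * Real.exp (-lam * t) := fun h hh => by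
    refine (ae_restrict_mem measurableSet_Ioi).mono fun t ht => ?_
    have ht : 0 < t := ht
    refine (hb _ (by positivity)).trans (mul_le_mul_of_nonneg_left (Real.exp_le_exp.2 ?_) hC)
    have := (hlt (t := t) hh).le
    nlinarith
  have hT : Tendsto (fun h : ℝ => ∫ t in Set.Ioi (0 : ℝ), F ((⌊t / h⌋₊ + 1) * h)) (𝓝[>] 0)
      (𝓝 (∫ t in Set.Ioi (0 : ℝ), F t)) := by
    refine tendsto_integral_filter_of_dominated_convergence _ (Eventually.of_forall hmeas)
      (eventually_mem_nhdsWithin.mono fun h hh => hle h hh) hbound ?_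
    refine (ae_restrict_mem measurableSet_Ioi).mono fun t ht => ?_
    have ht : 0 < t := ht
    refine ((hF.continuousAt (Ioi_mem_nhds ht)).tendsto).comp ?_
    have h1 : Tendsto (fun h : ℝ => t + h) (𝓝[>] 0) (𝓝 t) := by
      have : Tendsto (fun h : ℝ => t + h) (𝓝 0) (𝓝 (t + 0)) := (continuous_const_add t).tendsto 0
      rw [add_zero] at this
      exact this.mono_left nhdsWithin_le_nhds
    refine tendsto_of_tendsto_of_tendsto_of_le_of_le' tendsto_const_nhds h1 ?_ ?_
    · filter_upwards [self_mem_nhdsWithin] with h hh using (hlt hh).le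
    · filter_upwards [self_mem_nhdsWithin] with h hh
      have hh : 0 < h := hh
      have := Nat.floor_le (div_nonneg ht.le hh.le)
      rw [le_div_iff₀ hh] at this
      linarith
  refine hT.congr' ?_
  filter_upwards [self_mem_nhdsWithin] with h hh
  exact (hasSum_mul_of_integrable_floor hh (hbound.mono' (hmeas h) (hle h hh))).tsum_eq.symm

/-! ### The limit of the series of pseudo-expectations -/

theorem continuous_fourierInt {u : ℝ → ℂ} (hu : Integrable u) : Continuous (fourierInt u) := by
  refine continuous_of_dominated (bound := fun x => ‖u x‖) (fun μ => ?_) (fun μ => ?_) hu.norm ?_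
  · exact (integrable_exp_I_mul hu μ).aestronglyMeasurable
  · refine Eventually.of_forall fun x => ?_
    rw [norm_mul, norm_exp_I_mul_mul, one_mul]
  · exact Eventually.of_forall fun x => by fun_prop

theorem halfHeat_scaling {N : ℕ} (hN : Even N) (h2 : 2 ≤ N) {S : Set ℝ}
    (hS : ∀ c : ℝ, 0 < c → ∀ x, x * c ∈ S ↔ x ∈ S) {t : ℝ} (ht : 0 < t) (μ : ℝ) :
    halfHeat S N t μ = halfHeat S N 1 (μ * t ^ ((1 : ℝ) / N)) := by
  have hc : 0 < t ^ (-(1 : ℝ) / N) := Real.rpow_pos_of_pos ht _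
  have hinv : (t ^ (-(1 : ℝ) / N))⁻¹ = t ^ ((1 : ℝ) / N) := by
    rw [← Real.rpow_neg ht.le]; congr 1; ring
  set c := t ^ (-(1 : ℝ) / N) with hcdef
  have h1 := Measure.integral_comp_mul_right (fun x : ℝ =>
    Complex.exp (Complex.I * (μ * c⁻¹ : ℝ) * x) *
      S.indicator (fun x => (heatKernel N 1 x : ℂ)) x) c
  rw [← hinv, halfHeat, halfHeat, fourierInt]
  rw [abs_of_pos (inv_pos.2 hc), Complex.real_smul] at h1
  have hcc : (c : ℂ) ≠ 0 := by exact_mod_cast hc.ne'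
  have h3 : fourierInt (S.indicator fun x => (heatKernel N 1 x : ℂ)) (μ * c⁻¹) = c * ∫ x : ℝ,
      Complex.exp (Complex.I * (μ * c⁻¹ : ℝ) * (x * c : ℝ)) *
        S.indicator (fun x => (heatKernel N 1 x : ℂ)) (x * c) := by
    rw [h1, fourierInt]; push_cast; field_simp
  rw [h3, ← integral_const_mul]
  refine integral_congr_ae (Eventually.of_forall fun x => ?_)
  simp only
  have h4 : (Complex.I * (μ * c⁻¹ : ℝ) * (x * c : ℝ)) = Complex.I * μ * x := by
    push_cast; field_simp
  rw [h4]
  by_cases hx : x ∈ S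
  · rw [Set.indicator_of_mem hx, Set.indicator_of_mem ((hS c hc x).2 hx),
      heatKernel_scaling hN h2 ht]
    push_cast; ring
  · rw [Set.indicator_of_notMem hx, Set.indicator_of_notMem fun h => hx ((hS c hc x).1 h)]
    ring

theorem mul_mem_Ici_iff (c : ℝ) (hc : 0 < c) (x : ℝ) :
    x * c ∈ Set.Ici (0 : ℝ) ↔ x ∈ Set.Ici (0 : ℝ) := by
  simp only [Set.mem_Ici]; exact mul_nonneg_iff_of_pos_right hc

theorem mul_mem_Iio_iff (c : ℝ) (hc : 0 < c) (x : ℝ) :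
    x * c ∈ Set.Iio (0 : ℝ) ↔ x ∈ Set.Iio (0 : ℝ) := by
  simp only [Set.mem_Iio]
  rw [← not_le, ← not_le, mul_nonneg_iff_of_pos_right hc]

theorem continuousOn_halfHeat {N : ℕ} (hN : Even N) (h2 : 2 ≤ N) {S : Set ℝ} (hSm : MeasurableSet S)
    (hS : ∀ c : ℝ, 0 < c → ∀ x, x * c ∈ S ↔ x ∈ S) (μ : ℝ) :
    ContinuousOn (fun t => halfHeat S N t μ) (Set.Ioi 0) := by
  have hi : Integrable fun x => (heatKernel N 1 x : ℂ) :=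
    (integrable_heatKernel hN h2 one_pos).ofReal
  have h1 : Continuous (halfHeat S N 1) := continuous_fourierInt (hi.indicator hSm)
  have h3 : ContinuousOn (fun t : ℝ => halfHeat S N 1 (μ * t ^ ((1 : ℝ) / N))) (Set.Ioi 0) :=
    h1.comp_continuousOn (continuousOn_const.mul fun t ht =>
      (Real.continuousAt_rpow_const t _ (Or.inl (Set.mem_Ioi.1 ht).ne')).continuousWithinAt)
  exact h3.congr fun t ht => halfHeat_scaling hN h2 hS ht μ

/-- `∫_0^∞ (1 - e^{-νt}) e^{-λt} / t ∫_S e^{iμx} p(t; x) dx dt`. -/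
noncomputable def logLimit (S : Set ℝ) (N : ℕ) (lam ν μ : ℝ) : ℂ :=
  ∫ t in Set.Ioi (0 : ℝ), (((1 - Real.exp (-ν * t)) * Real.exp (-lam * t) / t : ℝ) : ℂ) *
    halfHeat S N t μ

theorem one_sub_exp_mem {ν t : ℝ} (hν : 0 < ν) (ht : 0 < t) :
    0 ≤ 1 - Real.exp (-ν * t) ∧ 1 - Real.exp (-ν * t) ≤ ν * t := by
  have h1 : Real.exp (-ν * t) ≤ 1 := Real.exp_le_one_iff.2 (by nlinarith)
  have h3 := Real.add_one_le_exp (-ν * t)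
  constructor <;> linarith

theorem norm_logLimit_integrand_le {N : ℕ} (hN : Even N) (h2 : 2 ≤ N) {S : Set ℝ} {lam ν : ℝ}
    (hν : 0 < ν) (μ : ℝ) {t : ℝ} (ht : 0 < t) :
    ‖(((1 - Real.exp (-ν * t)) * Real.exp (-lam * t) / t : ℝ) : ℂ) * halfHeat S N t μ‖ ≤
      ν * totalMass N * Real.exp (-lam * t) := by
  obtain ⟨h1, h3⟩ := one_sub_exp_mem hν ht
  have hE := Real.exp_pos (-lam * t)
  rw [norm_mul, Complex.norm_real, Real.norm_of_nonneg (by positivity), mul_right_comm]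
  refine mul_le_mul ?_ (norm_halfHeat_le hN h2 ht μ) (norm_nonneg _) (by positivity)
  rw [div_le_iff₀ ht]
  nlinarith

/-- The factor `1/(k+1)` is `h/t` at `t = (k+1)h`, so the series is a Riemann sum for `logLimit`. -/
theorem tendsto_logGen {N : ℕ} (hN : Even N) (h2 : 2 ≤ N) {S : Set ℝ} (hSm : MeasurableSet S)
    (hS : ∀ c : ℝ, 0 < c → ∀ x, x * c ∈ S ↔ x ∈ S) {lam ν : ℝ} (hlam : 0 < lam) (hν : 0 < ν)
    (μ : ℝ) (s : ℂ) :
    Tendsto (fun h : ℝ => logGen S N h s (Real.exp (-lam * h) : ℝ) (Real.exp (-ν * h) : ℝ) μ)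
      (𝓝[>] 0) (𝓝 (s * logLimit S N lam ν μ)) := by
  have hF : ContinuousOn (fun t : ℝ => (((1 - Real.exp (-ν * t)) * Real.exp (-lam * t) / t : ℝ) : ℂ) *
      halfHeat S N t μ) (Set.Ioi 0) := by
    refine ContinuousOn.mul (Complex.continuous_ofReal.comp_continuousOn ?_)
      (continuousOn_halfHeat hN h2 hSm hS μ)
    exact ContinuousOn.div (by fun_prop) continuousOn_id fun t ht => (Set.mem_Ioi.1 ht).ne'
  have h1 := (tendsto_tsum_mul hF hlam fun t ht =>
    norm_logLimit_integrand_le (S := S) hN h2 hν μ ht).const_mul s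
  refine h1.congr' ?_
  filter_upwards [self_mem_nhdsWithin] with h hh
  have hh : 0 < h := hh
  rw [logGen, ← tsum_mul_left]
  refine tsum_congr fun k => ?_
  have hpow : ∀ p : ℝ, ((Real.exp (-p * h) : ℝ) : ℂ) ^ (k + 1) =
      ((Real.exp (-p * ((k + 1) * h)) : ℝ) : ℂ) := by
    intro p
    rw [← Complex.ofReal_pow, ← Real.exp_nat_mul]
    congr 2; push_cast; ring
  rw [logCoeff, hpow, hpow]
  have hk : (k : ℂ) + 1 ≠ 0 := by exact_mod_cast k.succ_ne_zero
  have hhc : (h : ℂ) ≠ 0 := by exact_mod_cast hh.ne'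
  push_cast
  field_simp

theorem tendsto_one_sub_exp_div (p : ℝ) :
    Tendsto (fun h : ℝ => (1 - Real.exp (-p * h)) / h) (𝓝[>] 0) (𝓝 p) := by
  have h1 : HasDerivAt (fun h : ℝ => 1 - Real.exp (-p * h)) p 0 := by
    have h3 : HasDerivAt (fun h : ℝ => -p * h) (-p) 0 := by
      simpa using (hasDerivAt_id (0 : ℝ)).const_mul (-p)
    refine (h3.exp.const_sub 1).congr_deriv ?_
    simp
  have h4 := h1.tendsto_slope_zero_right
  refine h4.congr fun h => ?_
  simp [div_eq_inv_mul]

/-- The first factor is asymptotic to `h` and the second to `1/(νh)`; in particular the limit does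
not depend on `p`. -/
theorem tendsto_cellIntegral_mul {p ν : ℝ} (hp : 0 < p) (hν : 0 < ν) :
    Tendsto (fun h : ℝ => cellIntegral p h * (((Real.exp (-ν * h) : ℝ) : ℂ) /
      (1 - ((Real.exp (-ν * h) : ℝ) : ℂ)))) (𝓝[>] 0) (𝓝 (1 / (ν : ℂ))) := by
  have h1 : Tendsto (fun h : ℝ => (1 - Real.exp (-p * h)) / h / p * (Real.exp (-ν * h) /
      ((1 - Real.exp (-ν * h)) / h))) (𝓝[>] 0) (𝓝 (p / p * (Real.exp (-ν * 0) / ν))) := by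
    refine ((tendsto_one_sub_exp_div p).div_const p).mul
      (Tendsto.div ?_ (tendsto_one_sub_exp_div ν) hν.ne')
    have : Continuous fun h : ℝ => Real.exp (-ν * h) := by fun_prop
    exact (this.tendsto 0).mono_left nhdsWithin_le_nhds
  have h3 := (Complex.continuous_ofReal.tendsto _).comp h1
  rw [div_self hp.ne', mul_zero, Real.exp_zero, one_mul] at h3
  have h4 : (((1 / ν : ℝ)) : ℂ) = 1 / (ν : ℂ) := by push_cast; rfl
  rw [h4] at h3
  refine h3.congr' ?_
  filter_upwards [self_mem_nhdsWithin] with h hh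
  have hh : 0 < h := hh
  have h5 : 1 - Real.exp (-ν * h) ≠ 0 := by
    have : Real.exp (-ν * h) < 1 := Real.exp_lt_one_iff.2 (by nlinarith)
    linarith
  have h6 : (1 - ((Real.exp (-ν * h) : ℝ) : ℂ)) ≠ 0 := by exact_mod_cast h5
  have hhc : (h : ℂ) ≠ 0 := by exact_mod_cast hh.ne'
  have h7 : Complex.exp (-p * h) = ((Real.exp (-p * h) : ℝ) : ℂ) := by push_cast; rfl
  rw [cellIntegral, h7]
  simp only [Function.comp_apply, Complex.ofReal_mul, Complex.ofReal_div, Complex.ofReal_sub,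
    Complex.ofReal_one]
  field_simp

theorem tendsto_cellIntegral (p : ℝ) : Tendsto (fun h : ℝ => cellIntegral p h) (𝓝[>] 0) (𝓝 0) := by
  have h1 : Continuous fun h : ℝ => cellIntegral p h := by unfold cellIntegral; fun_prop
  have h3 := h1.tendsto 0
  have h4 : cellIntegral p 0 = 0 := by simp [cellIntegral]
  rw [h4] at h3
  exact h3.mono_left nhdsWithin_le_nhds

/-- In the sum of `hasSum_tameExpectation` the first cell vanishes in the limit, the two
coefficients tend to `∓1/ν`, and the two terms `-1` cancel. -/
theorem hasPseudoExpectation_transformTerm {N : ℕ} (hN : Even N) (h2 : 2 ≤ N) {lam ν : ℝ}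
    (hlam : 0 < lam) (hν : 0 < ν) (μ : ℝ) :
    HasPseudoExpectation N (transformTerm lam μ ν)
      (1 / ν * (Complex.exp (logLimit (Set.Iio 0) N lam ν μ) -
        Complex.exp (-logLimit (Set.Ici 0) N lam ν μ))) := by
  have hsum := fun n => hasSum_tameExpectation hN h2 hlam hν μ n rfl rfl rfl
  refine ⟨fun n k => isTame_transformTerm hlam hν μ n k, fun n => (hsum n).summable.norm, ?_⟩
  have hstep : Tendsto (fun n : ℕ => (1 : ℝ) / 2 ^ n) atTop (𝓝[>] 0) := by
    refine tendsto_nhdsWithin_iff.2 ⟨?_, Eventually.of_forall fun n => ?_⟩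
    · have := tendsto_pow_atTop_nhds_zero_of_lt_one (r := (1 / 2 : ℝ)) (by norm_num) (by norm_num)
      refine this.congr fun n => by rw [one_div_pow]
    · exact Set.mem_Ioi.2 (by positivity)
  have hE := fun (S : Set ℝ) (hSm : MeasurableSet S)
      (hS : ∀ c : ℝ, 0 < c → ∀ x, x * c ∈ S ↔ x ∈ S) (s : ℂ) =>
    (Complex.continuous_exp.tendsto _).comp (tendsto_logGen hN h2 hSm hS hlam hν μ s)
  have h1 := ((tendsto_cellIntegral (lam + ν)).add
    (((tendsto_cellIntegral_mul (p := lam + ν) (by linarith) hν).neg.mul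
      ((hE _ measurableSet_Ici mul_mem_Ici_iff (-1)).sub_const 1)).add
    ((tendsto_cellIntegral_mul hlam hν).mul
      ((hE _ measurableSet_Iio mul_mem_Iio_iff 1).sub_const 1)))).comp hstep
  have hval : (0 : ℂ) + (-(1 / (ν : ℂ)) *
      (Complex.exp (-1 * logLimit (Set.Ici 0) N lam ν μ) - 1) +
      1 / ν * (Complex.exp (1 * logLimit (Set.Iio 0) N lam ν μ) - 1)) =
      1 / ν * (Complex.exp (logLimit (Set.Iio 0) N lam ν μ) -
        Complex.exp (-logLimit (Set.Ici 0) N lam ν μ)) := by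
    rw [one_mul, neg_one_mul]; ring
  rw [hval] at h1
  refine h1.congr fun n => ?_
  rw [(hsum n).tsum_eq]
  simp only [Function.comp_apply]
  rw [mul_neg]


/-! ### The Laplace transforms of the half-line Fourier transforms -/

theorem continuousOn_heatKernel {N : ℕ} (hN : Even N) (h2 : 2 ≤ N) :
    ContinuousOn (fun q : ℝ × ℝ => heatKernel N q.1 q.2) (Set.Ioi 0 ×ˢ Set.univ) := by
  have hp : ContinuousOn (fun q : ℝ × ℝ => q.1 ^ (-(1 : ℝ) / N)) (Set.Ioi 0 ×ˢ Set.univ) :=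
    fun q hq => (continuousAt_fst.rpow_const (Or.inl (Set.mem_Ioi.1 hq.1).ne')).continuousWithinAt
  have h : ContinuousOn (fun q : ℝ × ℝ => q.1 ^ (-(1 : ℝ) / N) *
      heatKernel N 1 (q.2 * q.1 ^ (-(1 : ℝ) / N))) (Set.Ioi 0 ×ˢ Set.univ) :=
    hp.mul ((continuous_heatKernel hN h2 one_pos).comp_continuousOn (continuousOn_snd.mul hp))
  exact h.congr fun q hq => heatKernel_scaling hN h2 hq.1 q.2

theorem integrable_exp_mul_heatKernel {N : ℕ} (hN : Even N) (h2 : 2 ≤ N) {p : ℝ} (hp : 0 < p)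
    {S : Set ℝ} (hS : MeasurableSet S) :
    Integrable (fun q : ℝ × ℝ => ((Real.exp (-p * q.1) : ℝ) : ℂ) *
      S.indicator (fun x => (heatKernel N q.1 x : ℂ)) q.2)
      ((volume.restrict (Set.Ioi 0)).prod volume) := by
  have hfull : Integrable (fun q : ℝ × ℝ => ((Real.exp (-p * q.1) : ℝ) : ℂ) *
      (heatKernel N q.1 q.2 : ℂ)) ((volume.restrict (Set.Ioi 0)).prod volume) := by
    have hm : AEStronglyMeasurable (fun q : ℝ × ℝ => ((Real.exp (-p * q.1) : ℝ) : ℂ) *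
      (heatKernel N q.1 q.2 : ℂ)) ((volume.restrict (Set.Ioi 0)).prod volume) := by
      rw [← Measure.restrict_univ (μ := (volume : Measure ℝ)), Measure.restrict_restrict
        measurableSet_Ioi, Set.inter_univ, Measure.prod_restrict]
      refine ContinuousOn.aestronglyMeasurable ?_ (measurableSet_Ioi.prod MeasurableSet.univ)
      exact ContinuousOn.mul (by fun_prop)
        (Complex.continuous_ofReal.comp_continuousOn (continuousOn_heatKernel hN h2))
    rw [integrable_prod_iff hm]
    constructor
    · refine (ae_restrict_mem measurableSet_Ioi).mono fun t ht => ?_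
      have h1 : Integrable fun x => (heatKernel N t x : ℂ) :=
        (integrable_heatKernel hN h2 ht).ofReal
      exact h1.const_mul ((Real.exp (-p * t) : ℝ) : ℂ)
    · have h1 : IntegrableOn (fun t => Real.exp (-p * t) * totalMass N) (Set.Ioi 0) :=
        (integrableOn_exp_mul_Ioi (neg_lt_zero.2 hp) 0).mul_const (totalMass N)
      refine h1.congr_fun (fun t ht => ?_) measurableSet_Ioi
      simp only [norm_mul, Complex.norm_real, Real.norm_eq_abs, Real.abs_exp]
      rw [integral_const_mul, integral_abs_heatKernel hN h2 ht]
  have hS' : MeasurableSet {q : ℝ × ℝ | q.2 ∈ S} := measurable_snd hS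
  refine (hfull.indicator hS').congr (Eventually.of_forall fun q => ?_)
  by_cases hq : q.2 ∈ S
  · simp only
    rw [Set.indicator_of_mem (show q ∈ {q : ℝ × ℝ | q.2 ∈ S} from hq), Set.indicator_of_mem hq]
  · simp only
    rw [Set.indicator_of_notMem (show q ∉ {q : ℝ × ℝ | q.2 ∈ S} from hq),
      Set.indicator_of_notMem hq, mul_zero]

/-- `∫_0^∞ e^{-pt} ∫_S e^{iμx} p(t; x) dx dt`. -/
noncomputable def laplaceHalfHeat (S : Set ℝ) (N : ℕ) (p μ : ℝ) : ℂ :=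
  ∫ t in Set.Ioi (0 : ℝ), ((Real.exp (-p * t) : ℝ) : ℂ) * halfHeat S N t μ

theorem isFourierOn_laplaceHalfHeat {N : ℕ} (hN : Even N) (h2 : 2 ≤ N) {p : ℝ} (hp : 0 < p)
    {S : Set ℝ} (hS : MeasurableSet S) : IsFourierOn S (laplaceHalfHeat S N p) := by
  have hi := integrable_exp_mul_heatKernel hN h2 hp hS
  refine ⟨_, hi.integral_prod_right, fun x hx => ?_, fun μ => ?_⟩
  · simp only [Set.indicator_of_notMem hx, mul_zero, integral_zero]
  · have hi' : Integrable (fun q : ℝ × ℝ => Complex.exp (Complex.I * μ * q.2) *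
        (((Real.exp (-p * q.1) : ℝ) : ℂ) * S.indicator (fun x => (heatKernel N q.1 x : ℂ)) q.2))
        ((volume.restrict (Set.Ioi 0)).prod volume) :=
      hi.bdd_mul (c := 1) (Continuous.aestronglyMeasurable (by fun_prop))
        (Eventually.of_forall fun q => (norm_exp_I_mul_mul μ q.2).le)
    have h1 := integral_integral_swap (f := fun t x : ℝ => Complex.exp (Complex.I * μ * x) *
        (((Real.exp (-p * t) : ℝ) : ℂ) * S.indicator (fun x => (heatKernel N t x : ℂ)) x)) hi'
    rw [laplaceHalfHeat, fourierInt]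
    simp only [← integral_const_mul]
    rw [← h1]
    refine integral_congr_ae (Eventually.of_forall fun t => ?_)
    simp only
    rw [halfHeat, fourierInt, ← integral_const_mul]
    refine integral_congr_ae (Eventually.of_forall fun x => ?_)
    simp only; ring

theorem integrableOn_exp_mul_halfHeat {N : ℕ} (hN : Even N) (h2 : 2 ≤ N) {p : ℝ} (hp : 0 < p)
    {S : Set ℝ} (hSm : MeasurableSet S) (hS : ∀ c : ℝ, 0 < c → ∀ x, x * c ∈ S ↔ x ∈ S) (μ : ℝ) :
    IntegrableOn (fun t : ℝ => ((Real.exp (-p * t) : ℝ) : ℂ) * halfHeat S N t μ) (Set.Ioi 0) := by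
  refine ((integrableOn_exp_mul_Ioi (neg_lt_zero.2 hp) 0).mul_const (totalMass N)).mono' ?_ ?_
  · refine ContinuousOn.aestronglyMeasurable ?_ measurableSet_Ioi
    exact ContinuousOn.mul (by fun_prop) (continuousOn_halfHeat hN h2 hSm hS μ)
  · refine (ae_restrict_mem measurableSet_Ioi).mono fun t ht => ?_
    rw [norm_mul, Complex.norm_real, Real.norm_eq_abs, Real.abs_exp]
    exact mul_le_mul_of_nonneg_left (norm_halfHeat_le hN h2 ht μ) (Real.exp_nonneg _)

theorem laplaceHalfHeat_add {N : ℕ} (hN : Even N) (h2 : 2 ≤ N) {p : ℝ} (hp : 0 < p) (μ : ℝ) :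
    laplaceHalfHeat (Set.Ici 0) N p μ + laplaceHalfHeat (Set.Iio 0) N p μ =
      1 / ((p + μ ^ N : ℝ) : ℂ) := by
  have hpos : 0 < p + μ ^ N := by have := hN.pow_nonneg μ; linarith
  have hre : (-((p + μ ^ N : ℝ) : ℂ)).re < 0 := by
    rw [Complex.neg_re, Complex.ofReal_re]; linarith
  rw [laplaceHalfHeat, laplaceHalfHeat, ← integral_add
    (integrableOn_exp_mul_halfHeat hN h2 hp measurableSet_Ici mul_mem_Ici_iff μ)
    (integrableOn_exp_mul_halfHeat hN h2 hp measurableSet_Iio mul_mem_Iio_iff μ)]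
  have h := integral_exp_mul_complex_Ioi hre 0
  rw [Complex.ofReal_zero, mul_zero, Complex.exp_zero, neg_div_neg_eq] at h
  rw [← h]
  refine setIntegral_congr_fun measurableSet_Ioi fun t ht => ?_
  rw [← mul_add, halfHeat_add hN h2 ht, heatSymbol, Complex.ofReal_exp, ← Complex.exp_add]
  congr 1; push_cast; ring

/-! ### Partial fractions -/

/-- Used with `α` the identity for the partial fractions, and with `α p = p^{1/N}` for the integral
over `[λ, λ + ν]`. -/
theorem hasDerivAt_prod_sub {s : Finset ℂ} {c : ℂ → ℂ} {α : ℝ → ℂ} {α' : ℂ} {p : ℝ}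
    (hα : HasDerivAt α α' p) (hne : ∀ θ ∈ s, α p - c θ ≠ 0) :
    HasDerivAt (fun q => ∏ θ ∈ s, (α q - c θ))
      ((∏ θ ∈ s, (α p - c θ)) * ∑ θ ∈ s, α' / (α p - c θ)) p := by
  classical
  induction s using Finset.induction_on with
  | empty => simpa using hasDerivAt_const p (1 : ℂ)
  | insert θ s hθ ih =>
    simp only [Finset.prod_insert hθ, Finset.sum_insert hθ]
    have h0 := hne θ (Finset.mem_insert_self θ s)
    refine ((hα.sub_const (c θ)).mul
      (ih fun η hη => hne η (Finset.mem_insert_of_mem hη))).congr_deriv ?_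
    field_simp

theorem prod_sub_I_mul_roots {N : ℕ} (hN : Even N) (h2 : 2 ≤ N) (x : ℂ) (μ : ℝ) :
    (∏ θ ∈ rootsJ N, (x - Complex.I * μ * θ)) * ∏ θ ∈ rootsK N, (x - Complex.I * μ * θ) =
      x ^ N + ((μ ^ N : ℝ) : ℂ) := by
  rw [prod_sub_mul_roots hN h2]
  have h := kappa_mul_neg_I_mul_pow hN (-(μ : ℂ))
  rw [neg_mul_neg, hN.neg_pow] at h
  rw [h]; push_cast; ring

theorem sub_I_mul_ne_zero {N : ℕ} (hN : Even N) (h2 : 2 ≤ N) {a : ℝ} (ha : 0 < a) (μ : ℝ) {θ : ℂ}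
    (hθ : θ ∈ rootsJ N ∪ rootsK N) : (a : ℂ) - Complex.I * μ * θ ≠ 0 := by
  intro h0
  have h := prod_sub_I_mul_roots hN h2 a μ
  rw [← Finset.prod_union (disjoint_rootsJ_rootsK N), Finset.prod_eq_zero hθ h0] at h
  have hpos : 0 < a ^ N + μ ^ N := by have := hN.pow_nonneg μ; positivity
  rw [← Complex.ofReal_pow, ← Complex.ofReal_add] at h
  exact hpos.ne (by exact_mod_cast h)

theorem sum_inv_sub_roots {N : ℕ} (hN : Even N) (h2 : 2 ≤ N) {a : ℝ} (ha : 0 < a) (μ : ℝ) :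
    (∑ θ ∈ rootsJ N, 1 / (a - Complex.I * μ * θ)) + ∑ θ ∈ rootsK N, 1 / (a - Complex.I * μ * θ) =
      N * (a : ℂ) ^ (N - 1) / ((a ^ N + μ ^ N : ℝ) : ℂ) := by
  have hpos : 0 < a ^ N + μ ^ N := by have := hN.pow_nonneg μ; positivity
  have h1 := hasDerivAt_prod_sub (s := rootsJ N ∪ rootsK N) (c := fun θ => Complex.I * μ * θ)
    (α := fun x : ℝ => (x : ℂ)) (α' := 1) (p := a) (hasDerivAt_id (a : ℂ)).comp_ofReal
    fun θ hθ => sub_I_mul_ne_zero hN h2 ha μ hθ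
  simp only [Finset.prod_union (disjoint_rootsJ_rootsK N), prod_sub_I_mul_roots hN h2] at h1
  have h3 : HasDerivAt (fun x : ℝ => (x : ℂ) ^ N + ((μ ^ N : ℝ) : ℂ)) (N * (a : ℂ) ^ (N - 1)) a :=
    ((hasDerivAt_pow N (a : ℂ)).comp_ofReal).add_const _
  have h4 := h1.unique h3
  rw [Finset.sum_union (disjoint_rootsJ_rootsK N)] at h4
  have h5 : ((a ^ N + μ ^ N : ℝ) : ℂ) = (a : ℂ) ^ N + ((μ ^ N : ℝ) : ℂ) := by push_cast; rfl
  have h6 : ((a ^ N + μ ^ N : ℝ) : ℂ) ≠ 0 := by exact_mod_cast hpos.ne'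
  rw [eq_div_iff h6, h5, mul_comm, h4]

/-- It is the transform of `θ⁻¹ e^{-ax/θ}` on `x > 0`, integrable because `Re θ⁻¹ > 0`. -/
theorem isFourierOn_inv_sub {a : ℝ} (ha : 0 < a) {θ : ℂ} (hθ : 0 < θ.re) :
    IsFourierOn (Set.Ioi 0) fun μ => 1 / (a - Complex.I * μ * θ) := by
  have hθ0 : θ ≠ 0 := fun h => by rw [h, Complex.zero_re] at hθ; exact lt_irrefl _ hθ
  have hinv : 0 < (θ⁻¹).re := by
    rw [Complex.inv_re]; exact div_pos hθ (Complex.normSq_pos.2 hθ0)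
  have hre : (-(a * θ⁻¹)).re < 0 := by
    rw [Complex.neg_re, Complex.re_ofReal_mul]
    exact neg_lt_zero.2 (mul_pos ha hinv)
  refine ⟨(Set.Ioi 0).indicator fun x : ℝ => θ⁻¹ * Complex.exp (-(a * θ⁻¹) * x), ?_,
    fun x hx => Set.indicator_of_notMem hx _, fun μ => ?_⟩
  · exact (integrable_indicator_iff measurableSet_Ioi).2
      ((integrableOn_exp_mul_complex_Ioi hre 0).const_mul _)
  · have hre' : (Complex.I * μ - a * θ⁻¹).re < 0 := by
      have : (Complex.I * μ - a * θ⁻¹).re = (-(a * θ⁻¹)).re := by simp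
      rw [this]; exact hre
    have h1 : fourierInt ((Set.Ioi 0).indicator fun x : ℝ =>
        θ⁻¹ * Complex.exp (-(a * θ⁻¹) * x)) μ =
        ∫ x in Set.Ioi (0 : ℝ), θ⁻¹ * Complex.exp ((Complex.I * μ - a * θ⁻¹) * x) := by
      rw [fourierInt, ← integral_indicator measurableSet_Ioi]
      refine integral_congr_ae (Eventually.of_forall fun x => ?_)
      by_cases hx : x ∈ Set.Ioi (0 : ℝ)
      · simp only [Set.indicator_of_mem hx]
        rw [mul_left_comm, ← Complex.exp_add]
        congr 2; ring
      · simp only [Set.indicator_of_notMem hx, mul_zero]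
    rw [h1, integral_const_mul, integral_exp_mul_complex_Ioi hre', Complex.ofReal_zero, mul_zero,
      Complex.exp_zero]
    have hne : Complex.I * μ - a * θ⁻¹ ≠ 0 := fun h => by
      rw [h, Complex.zero_re] at hre'; exact lt_irrefl _ hre'
    have hne2 : (a : ℂ) - Complex.I * μ * θ ≠ 0 := fun h => hne (by
      field_simp
      linear_combination -h)
    have h3 : Complex.I * μ - a * θ⁻¹ = -(θ⁻¹ * (a - Complex.I * μ * θ)) := by
      field_simp; ring
    rw [h3]
    field_simp

theorem IsFourierOn.mono {S T : Set ℝ} (hST : S ⊆ T) {φ : ℝ → ℂ} (h : IsFourierOn S φ) :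
    IsFourierOn T φ :=
  let ⟨u, hu, hu0, hue⟩ := h
  ⟨u, hu, fun x hx => hu0 x fun hxS => hx (hST hxS), hue⟩

theorem IsFourierOn.neg {S T : Set ℝ} (hST : ∀ x, -x ∈ S → x ∈ T) {φ : ℝ → ℂ}
    (h : IsFourierOn S φ) : IsFourierOn T fun μ => φ (-μ) := by
  obtain ⟨u, hu, hu0, hue⟩ := h
  refine ⟨fun x => u (-x), hu.comp_neg, fun x hx => hu0 _ fun h => hx (hST x h), fun μ => ?_⟩
  simp only [hue, fourierInt]
  rw [← integral_neg_eq_self]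
  refine integral_congr_ae (Eventually.of_forall fun x => ?_)
  simp only
  congr 2; push_cast; ring

/-- The left sides add up to `1/(a^N + μ^N)`, and so do the right sides by partial fractions. Each
term is carried by its own half-line, so uniqueness of the splitting identifies them without a
formula for the kernel. -/
theorem laplaceHalfHeat_eq {N : ℕ} (hN : Even N) (h2 : 2 ≤ N) {a : ℝ} (ha : 0 < a) (μ : ℝ) :
    laplaceHalfHeat (Set.Ici 0) N (a ^ N) μ =
      (N * (a : ℂ) ^ (N - 1))⁻¹ * ∑ θ ∈ rootsJ N, 1 / (a - Complex.I * μ * θ) ∧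
    laplaceHalfHeat (Set.Iio 0) N (a ^ N) μ =
      (N * (a : ℂ) ^ (N - 1))⁻¹ * ∑ θ ∈ rootsK N, 1 / (a - Complex.I * μ * θ) := by
  have hp : 0 < a ^ N := by positivity
  have hJ : IsFourierOn (Set.Ici 0) fun μ => (N * (a : ℂ) ^ (N - 1))⁻¹ *
      ∑ θ ∈ rootsJ N, 1 / (a - Complex.I * μ * θ) :=
    (IsFourierOn.sum fun θ hθ => (isFourierOn_inv_sub ha ((mem_rootsJ h2).1 hθ).2).mono
      Set.Ioi_subset_Ici_self).const_mul _
  have hK : IsFourierOn (Set.Iio 0) fun μ => (N * (a : ℂ) ^ (N - 1))⁻¹ *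
      ∑ θ ∈ rootsK N, 1 / (a - Complex.I * μ * θ) := by
    refine (IsFourierOn.sum fun θ hθ => ?_).const_mul _
    have hθ' : 0 < (-θ).re := by
      rw [Complex.neg_re]; linarith [((mem_rootsK h2).1 hθ).2]
    -- For `θ ∈ K`, reflecting `x` exchanges the half-lines and replaces `θ` by `-θ`.
    have h1 := (isFourierOn_inv_sub ha hθ').neg (T := Set.Iio 0) fun x hx => by
      simpa using hx
    have he : (fun μ : ℝ => 1 / ((a : ℂ) - Complex.I * μ * θ)) =
        fun μ : ℝ => 1 / ((a : ℂ) - Complex.I * ((-μ : ℝ) : ℂ) * -θ) := by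
      ext μ; congr 2; push_cast; ring
    rw [he]; exact h1
  have h := eq_of_isFourierOn_add_eq
    (isFourierOn_laplaceHalfHeat hN h2 hp measurableSet_Ici) hJ
    (isFourierOn_laplaceHalfHeat hN h2 hp measurableSet_Iio) hK fun μ => by
      rw [laplaceHalfHeat_add hN h2 hp, ← mul_add, sum_inv_sub_roots hN h2 ha]
      have hac : (a : ℂ) ≠ 0 := by exact_mod_cast ha.ne'
      have hNc : (N : ℂ) ≠ 0 := by exact_mod_cast (by omega : N ≠ 0)
      field_simp
  exact ⟨congrFun h.1 μ, congrFun h.2 μ⟩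


/-! ### The limit in closed form -/

theorem integral_exp_neg_mul_eq {lam ν t : ℝ} (ht : 0 < t) :
    ∫ p in lam..(lam + ν), ((Real.exp (-p * t) : ℝ) : ℂ) =
      (((1 - Real.exp (-ν * t)) * Real.exp (-lam * t) / t : ℝ) : ℂ) := by
  rw [intervalIntegral.integral_ofReal]
  congr 1
  have h : ∀ p : ℝ, HasDerivAt (fun p : ℝ => -Real.exp (-p * t) / t) (Real.exp (-p * t)) p := by
    intro p
    have h1 : HasDerivAt (fun p : ℝ => -p * t) (-1 * t) p := (hasDerivAt_id p).neg.mul_const t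
    refine (h1.exp.neg.div_const t).congr_deriv ?_
    field_simp
  rw [intervalIntegral.integral_eq_sub_of_hasDerivAt (fun p _ => h p)
    (Continuous.intervalIntegrable (by fun_prop) _ _)]
  have h3 : -(lam + ν) * t = -ν * t + -lam * t := by ring
  rw [h3, Real.exp_add]
  field_simp
  ring

/-- Fubini, because `(e^{-λt} - e^{-(λ+ν)t}) / t` is the integral of `e^{-pt}` over `p ∈ [λ, λ +
ν]`. -/
theorem logLimit_eq_integral {N : ℕ} (hN : Even N) (h2 : 2 ≤ N) {S : Set ℝ} (hSm : MeasurableSet S)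
    (hS : ∀ c : ℝ, 0 < c → ∀ x, x * c ∈ S ↔ x ∈ S) {lam ν : ℝ} (hlam : 0 < lam) (hν : 0 < ν)
    (μ : ℝ) : logLimit S N lam ν μ = ∫ p in lam..(lam + ν), laplaceHalfHeat S N p μ := by
  have hle : lam ≤ lam + ν := by linarith
  have hi : Integrable (Function.uncurry fun p t : ℝ =>
      ((Real.exp (-p * t) : ℝ) : ℂ) * halfHeat S N t μ)
      ((volume.restrict (Set.Ioc lam (lam + ν))).prod (volume.restrict (Set.Ioi 0))) := by
    have hb : Integrable (fun q : ℝ × ℝ => (1 : ℝ) * (Real.exp (-lam * q.2) * totalMass N))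
        ((volume.restrict (Set.Ioc lam (lam + ν))).prod (volume.restrict (Set.Ioi 0))) := by
      have h1 : Integrable (fun _ : ℝ => (1 : ℝ)) (volume.restrict (Set.Ioc lam (lam + ν))) :=
        integrable_const _
      exact h1.mul_prod ((integrableOn_exp_mul_Ioi (neg_lt_zero.2 hlam) 0).mul_const (totalMass N))
    refine hb.mono' ?_ ?_
    · rw [Measure.prod_restrict]
      refine ContinuousOn.aestronglyMeasurable ?_ (measurableSet_Ioc.prod measurableSet_Ioi)
      refine ContinuousOn.mul (by fun_prop) ?_
      exact (continuousOn_halfHeat hN h2 hSm hS μ).comp continuousOn_snd fun q hq => hq.2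
    · rw [Measure.prod_restrict]
      refine (ae_restrict_mem (measurableSet_Ioc.prod measurableSet_Ioi)).mono fun q hq => ?_
      have h1 : lam < q.1 := hq.1.1
      have h3 : 0 < q.2 := hq.2
      simp only [Function.uncurry]
      rw [norm_mul, Complex.norm_real, Real.norm_eq_abs, Real.abs_exp, one_mul]
      refine mul_le_mul (Real.exp_le_exp.2 (by nlinarith)) (norm_halfHeat_le hN h2 h3 μ)
        (norm_nonneg _) (Real.exp_nonneg _)
  rw [intervalIntegral.integral_of_le hle]
  simp only [laplaceHalfHeat]
  rw [integral_integral_swap hi, logLimit]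
  refine setIntegral_congr_fun measurableSet_Ioi fun t ht => ?_
  rw [integral_mul_const, ← intervalIntegral.integral_of_le hle, integral_exp_neg_mul_eq ht]

/-- An integrating factor solves `R' = R L`; no branch of the complex logarithm has to be chosen. -/
theorem eq_mul_exp_integral {L R : ℝ → ℂ} (hL : ContinuousOn L (Set.Ioi 0))
    (hR : ∀ p, 0 < p → HasDerivAt R (R p * L p) p) {a b : ℝ} (ha : 0 < a) (hb : 0 < b) :
    R b = R a * Complex.exp (∫ p in a..b, L p) := by
  have hI : ∀ q, 0 < q → HasDerivAt (fun q => ∫ p in a..q, L p) (L q) q := by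
    intro q hq
    refine intervalIntegral.integral_hasDerivAt_right ?_ ?_ (hL.continuousAt (Ioi_mem_nhds hq))
    · refine (hL.mono fun p hp => ?_).intervalIntegrable
      exact (lt_min ha hq).trans_le hp.1
    · exact hL.stronglyMeasurableAtFilter isOpen_Ioi q hq
  set G : ℝ → ℂ := fun q => R q * Complex.exp (-∫ p in a..q, L p) with hG
  have hGd : ∀ q, 0 < q → HasDerivAt G 0 q := fun q hq => by
    refine ((hR q hq).mul (hI q hq).neg.cexp).congr_deriv ?_
    ring
  have hc : G b = G a := isOpen_Ioi.is_const_of_deriv_eq_zero (convex_Ioi (0 : ℝ)).isPreconnected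
    (fun q hq => (hGd q hq).differentiableAt.differentiableWithinAt)
    (fun q hq => (hGd q hq).deriv) hb ha
  simp only [hG, intervalIntegral.integral_same, neg_zero, Complex.exp_zero, mul_one] at hc
  rw [← hc, mul_assoc, ← Complex.exp_add, neg_add_cancel, Complex.exp_zero, mul_one]

/-- Since `p^{1/N}` has derivative `(N a^{N-1})⁻¹` at `p = a^N`, the function `L` is the logarithmic
derivative of `∏ (p^{1/N} - iμθ)`. -/
theorem exp_integral_eq_prod_div {N : ℕ} (hN : Even N) (h2 : 2 ≤ N) {s : Finset ℂ}
    (hs : s ⊆ rootsJ N ∪ rootsK N) {L : ℝ → ℂ} (μ : ℝ)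
    (hL : ∀ a : ℝ, 0 < a → L (a ^ N) = (N * (a : ℂ) ^ (N - 1))⁻¹ *
      ∑ θ ∈ s, 1 / (a - Complex.I * μ * θ)) {a b : ℝ} (ha : 0 < a) (hb : 0 < b) :
    Complex.exp (∫ p in (b ^ N)..(a ^ N), L p) =
      (∏ θ ∈ s, (a - Complex.I * μ * θ)) / ∏ θ ∈ s, (b - Complex.I * μ * θ) := by
  have hN0 : N ≠ 0 := by omega
  set r : ℝ → ℝ := fun p => p ^ ((1 : ℝ) / N) with hr
  have hr0 : ∀ p, 0 < p → 0 < r p := fun p hp => Real.rpow_pos_of_pos hp _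
  have hrN : ∀ p, 0 < p → r p ^ N = p := fun p hp => by
    rw [hr]; simp only; rw [one_div, Real.rpow_inv_natCast_pow hp.le hN0]
  have hrinv : ∀ c, 0 < c → r (c ^ N) = c := fun c hc => by
    rw [hr]; simp only; rw [one_div, Real.pow_rpow_inv_natCast hc.le hN0]
  have hne : ∀ p, 0 < p → ∀ θ ∈ s, (r p : ℂ) - Complex.I * μ * θ ≠ 0 := fun p hp θ hθ =>
    sub_I_mul_ne_zero hN h2 (hr0 p hp) μ (hs hθ)
  have hLr : ∀ p, 0 < p → L p = (N * (r p : ℂ) ^ (N - 1))⁻¹ *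
      ∑ θ ∈ s, 1 / (r p - Complex.I * μ * θ) := fun p hp => by
    rw [← hL _ (hr0 p hp), hrN p hp]
  have hrd : ∀ p, 0 < p → HasDerivAt (fun p => (r p : ℂ)) ((N * (r p : ℂ) ^ (N - 1))⁻¹) p := by
    intro p hp
    have h1 : HasDerivAt r ((1 / N) * p ^ ((1 : ℝ) / N - 1)) p :=
      Real.hasDerivAt_rpow_const (Or.inl hp.ne')
    refine h1.ofReal_comp.congr_deriv ?_
    have h3 : p ^ ((1 : ℝ) / N - 1) = (r p ^ (N - 1))⁻¹ := by
      have h4 : r p ^ (N - 1) = p / r p := by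
        rw [eq_div_iff (hr0 p hp).ne', ← pow_succ, Nat.sub_add_cancel (by omega), hrN p hp]
      rw [h4, Real.rpow_sub_one hp.ne', inv_div]
    rw [h3]
    push_cast
    rw [mul_inv, one_div]
  have hLc : ContinuousOn L (Set.Ioi 0) := by
    have hrc : ContinuousOn (fun p => (r p : ℂ)) (Set.Ioi 0) := fun p hp =>
      (hrd p hp).continuousAt.continuousWithinAt
    refine ContinuousOn.congr (f := fun p => (N * (r p : ℂ) ^ (N - 1))⁻¹ *
      ∑ θ ∈ s, 1 / (r p - Complex.I * μ * θ)) ?_ fun p hp => hLr p hp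
    refine ContinuousOn.mul (ContinuousOn.inv₀ (continuousOn_const.mul (hrc.pow _)) fun p hp => ?_)
      (continuousOn_finsetSum _ fun θ hθ => continuousOn_const.div (hrc.sub continuousOn_const)
        fun p hp => hne p hp θ hθ)
    have h1 : (r p : ℂ) ≠ 0 := by exact_mod_cast (hr0 p hp).ne'
    have h3 : (N : ℂ) ≠ 0 := by exact_mod_cast hN0
    exact mul_ne_zero h3 (pow_ne_zero _ h1)
  have hR := eq_mul_exp_integral (R := fun p => ∏ θ ∈ s, ((r p : ℂ) - Complex.I * μ * θ)) hLc
    (fun p hp => by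
      refine (hasDerivAt_prod_sub (c := fun θ => Complex.I * μ * θ) (hrd p hp)
        (hne p hp)).congr_deriv ?_
      rw [hLr p hp]
      simp only [Finset.mul_sum, mul_one_div])
    (pow_pos hb N) (pow_pos ha N)
  simp only [hrinv a ha, hrinv b hb] at hR
  rw [eq_div_iff, mul_comm, hR]
  exact Finset.prod_ne_zero_iff.2 fun θ hθ => sub_I_mul_ne_zero hN h2 hb μ (hs hθ)

/-- With `A_J`, `A_K`, `B_J`, `B_K` the products of `a - iμθ` and `b - iμθ`, the exponentials are
`A_K/B_K` and `B_J/A_J`. Their difference is `(A_J A_K - B_J B_K) / (A_J B_K)`, whose numerator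
`(a^N + μ^N) - (b^N + μ^N)` cancels the prefactor. -/
theorem exp_logLimit_sub {N : ℕ} (hN : Even N) (h2 : 2 ≤ N) {a b : ℝ} (hb : 0 < b) (hab : b < a)
    (μ : ℝ) :
    1 / ((a ^ N - b ^ N : ℝ) : ℂ) *
      (Complex.exp (logLimit (Set.Iio 0) N (b ^ N) (a ^ N - b ^ N) μ) -
        Complex.exp (-logLimit (Set.Ici 0) N (b ^ N) (a ^ N - b ^ N) μ)) =
      (∏ θ ∈ rootsJ N, (a - Complex.I * μ * θ)⁻¹) * ∏ θ ∈ rootsK N, (b - Complex.I * μ * θ)⁻¹ := by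
  have ha : 0 < a := hb.trans hab
  have hlam : 0 < b ^ N := pow_pos hb N
  have hν : 0 < a ^ N - b ^ N := sub_pos.2 (pow_lt_pow_left₀ hab hb.le (by omega))
  have hJ := exp_integral_eq_prod_div hN h2 (s := rootsJ N) Finset.subset_union_left
    (L := fun p => laplaceHalfHeat (Set.Ici 0) N p μ) μ
    (fun c hc => (laplaceHalfHeat_eq hN h2 hc μ).1) ha hb
  have hK := exp_integral_eq_prod_div hN h2 (s := rootsK N) Finset.subset_union_right
    (L := fun p => laplaceHalfHeat (Set.Iio 0) N p μ) μ
    (fun c hc => (laplaceHalfHeat_eq hN h2 hc μ).2) ha hb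
  have hne : ∀ {c : ℝ}, 0 < c → ∀ s ⊆ rootsJ N ∪ rootsK N,
      ∏ θ ∈ s, ((c : ℂ) - Complex.I * μ * θ) ≠ 0 := fun hc s hs =>
    Finset.prod_ne_zero_iff.2 fun θ hθ => sub_I_mul_ne_zero hN h2 hc μ (hs hθ)
  have h1 := hne ha _ Finset.subset_union_left
  have h3 := hne ha _ Finset.subset_union_right
  have h4 := hne hb _ Finset.subset_union_left
  have h5 := hne hb _ Finset.subset_union_right
  rw [logLimit_eq_integral hN h2 measurableSet_Iio mul_mem_Iio_iff hlam hν,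
    logLimit_eq_integral hN h2 measurableSet_Ici mul_mem_Ici_iff hlam hν, add_sub_cancel, hK,
    Complex.exp_neg, hJ, Finset.prod_inv_distrib, Finset.prod_inv_distrib]
  have hA := prod_sub_I_mul_roots hN h2 a μ
  have hB := prod_sub_I_mul_roots hN h2 b μ
  have hνc : ((a ^ N - b ^ N : ℝ) : ℂ) ≠ 0 := by exact_mod_cast hν.ne'
  have hνe : ((a ^ N - b ^ N : ℝ) : ℂ) = (a : ℂ) ^ N - (b : ℂ) ^ N := by push_cast; rfl
  set AJ := ∏ θ ∈ rootsJ N, ((a : ℂ) - Complex.I * μ * θ)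
  set AK := ∏ θ ∈ rootsK N, ((a : ℂ) - Complex.I * μ * θ)
  set BJ := ∏ θ ∈ rootsJ N, ((b : ℂ) - Complex.I * μ * θ)
  set BK := ∏ θ ∈ rootsK N, ((b : ℂ) - Complex.I * μ * θ)
  have h6 : AK / BK - (AJ / BJ)⁻¹ = ((a ^ N - b ^ N : ℝ) : ℂ) * (AJ⁻¹ * BK⁻¹) := by
    rw [hνe]
    field_simp
    linear_combination hA - hB
  rw [h6, one_div, inv_mul_cancel_left₀ hνc]

theorem isJointDensity_density {N : ℕ} (hN : Even N) (h2 : 2 ≤ N) :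
    IsJointDensity N (density N) := by
  refine ⟨fun lam hlam => integrableOn_exp_mul_density hN h2 hlam, fun lam μ ν hlam hν => ?_⟩
  have hN0 : N ≠ 0 := by omega
  obtain ⟨b, hb, rfl⟩ : ∃ b : ℝ, 0 < b ∧ b ^ N = lam :=
    ⟨lam ^ ((N : ℝ)⁻¹), Real.rpow_pos_of_pos hlam _, Real.rpow_inv_natCast_pow hlam.le hN0⟩
  have hs : 0 < b ^ N + ν := by positivity
  obtain ⟨a, ha, haN⟩ : ∃ a : ℝ, 0 < a ∧ a ^ N = b ^ N + ν :=
    ⟨(b ^ N + ν) ^ ((N : ℝ)⁻¹), Real.rpow_pos_of_pos hs _, Real.rpow_inv_natCast_pow hs.le hN0⟩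
  obtain rfl : ν = a ^ N - b ^ N := by linarith
  have hab : b < a := lt_of_pow_lt_pow_left₀ N ha.le (by linarith)
  have h := hasPseudoExpectation_transformTerm hN h2 hlam hν μ
  rw [exp_logLimit_sub hN h2 hb hab, ← density_transform hN h2 ha hb] at h
  exact h

end PseudoProcess

/-! ### Existence, continuity, uniqueness and formula combined. -/

theorem mainTheorem7 (N : ℕ) (hN : Even N) (hN2 : 2 ≤ N) :
    ∃ f : ℝ → ℝ → ℝ → ℝ,
      PseudoProcess.IsJointDensity N f ∧
      ContinuousOn (fun q : ℝ × ℝ × ℝ => f q.1 q.2.1 q.2.2) PseudoProcess.region ∧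
      (∀ g : ℝ → ℝ → ℝ → ℝ, PseudoProcess.IsJointDensity N g →
        ∀ᵐ q ∂(MeasureTheory.volume.restrict PseudoProcess.region),
          g q.1 q.2.1 q.2.2 = f q.1 q.2.1 q.2.2) ∧
      ∀ t s x : ℝ, 0 < s → s < t → 0 ≤ x →
        (∀ m ∈ Finset.range ((PseudoProcess.rootsJ N).card + 1),
          MeasureTheory.IntegrableOn (PseudoProcess.integrand N m t s x) (Set.Ioi 0)) ∧
        (f t s x : ℂ) =
          (N : ℂ) * Complex.I / (2 * Real.pi) *
            ∑ m ∈ Finset.range ((PseudoProcess.rootsJ N).card + 1),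
              PseudoProcess.beta N (-(m : ℤ)) *
                (((t - s) ^ (((m : ℝ) - (PseudoProcess.rootsJ N).card) / N) : ℝ) : ℂ) *
                ∫ ξ in Set.Ioi (0 : ℝ), PseudoProcess.integrand N m t s x ξ := by
  refine ⟨PseudoProcess.density N, PseudoProcess.isJointDensity_density hN hN2,
    PseudoProcess.continuousOn_density hN hN2,
    fun g hg => PseudoProcess.ae_eq_of_isJointDensity
      (PseudoProcess.isJointDensity_density hN hN2) hg,
    fun t s x hs hst hx => ⟨fun m _ => PseudoProcess.integrableOn_integrand hN hN2 m hs hst hx,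
      PseudoProcess.density_eq_sum hN hN2 hs hst hx⟩⟩
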